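/- **Setting.** Let $M$ be a loopless matroid on a finite set $E$, with lattice of flats $\mathcal L(M)$, least flat $\hat 0=\varnothing$, greatest flat $\hat 1=E$, and $\mathcal P(M)=\mathcal L(M)\setminus\{\hat 0,\hat 1\}$. For a flat $F$ let $M^F$ be the restriction to $F$ (on the ground set $F$) and $M_F$ the contraction of $F$ (on the ground set $E\setminus F$, with flats $H\setminus F$ for flats $H\supseteq F$); for flats $F\subsetneq G$ let $M_F^G=(M^G)_F$. In $\mathbb R^{\mathcal P(M)}$, with standard basis $(\delta_F)_{F\in\mathcal P(M)}$, set $\alpha_i=\sum_{F\ni i}\delta_F$ and $\beta_i=\sum_{F\not\ni i}\delta_F$ for $i\in E$; let $W_M=\operatorname{span}\{\alpha_i-\alpha_j: i,j\in E\}$ and $L_M=\mathbb R^{\mathcal P(M)}/W_M$. The classes $\alpha,\beta\in L_M$ of $\alpha_i,\beta_i$ do not depend on $i$. For $F\in\mathcal P(M)$ let $\pi^F:\mathbb R^{\mathcal P(M)}\to L_{M^F}$ be the linear map with $\delta_G\mapsto\delta_G$ if $G\subsetneq F$, $\delta_F\mapsto-\alpha$, and $\delta_G\mapsto 0$ otherwise;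 let $\pi_F:\mathbb R^{\mathcal P(M)}\to L_{M_F}$ be the linear map with $\delta_G\mapsto\delta_{G\setminus F}$ if $G\supsetneq F$, $\delta_F\mapsto-\beta$, and $\delta_G\mapsto0$ otherwise. The volume polynomials $V_M:L_M\to\mathbb R$, also regarded as functions on $\mathbb R^{\mathcal P(M)}$, are the unique family, over all finite loopless matroids, such that $V_M=0$ if $\operatorname{rank}(M)=0$, $V_M=1$ if $\operatorname{rank}(M)=1$, $V_M(0)=0$ if $\operatorname{rank}(M)>1$, and $$\frac{\partial V_M}{\partial t_F}(\mathbf t)=V_{M^F}(\pi^F(\mathbf t))\,V_{M_F}(\pi_F(\mathbf t))\qquad\text{for all }F\in\mathcal P(M),\ \mathbf t\in\mathbb R^{\mathcal P(M)}.$$ The ample cone $\mathcal K_M\subseteq L_M$ is the set of classes of the vectors $\sum_{F\in\mathcal P(M)}c(F)\delta_F$, where $c:2^E\to\mathbb R$ satisfies $c(\varnothing)=c(E)=0$ and $c(I)+c(J)>c(I\cap J)+c(I\cup J)$ for all incomparable $\varnothing\subsetneq I,J\subsetneq E$. For a function $f$ on $\mathbb R^S$, with $S$ finite, $D_{\mathbf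 v}f$ is the directional derivative and $\mathcal H_{\mathbf u}f$ is the $S\times S$ matrix of second partial derivatives at $\mathbf u$. Elements of $\mathcal K_M$ and $\mathcal K_{\mathcal F}$ below are used through arbitrary representatives in $\mathbb R^{\mathcal P(M)}$ and $\mathbb R^{\mathcal F}$. Eigenvalues are counted with multiplicity. **Theorem.** Let $M$ be a loopless matroid on a finite set. 1. For $0\le k\le\operatorname{rank}(M)-3$ and $\mathbf u,\mathbf u_1,\dots,\mathbf u_k\in\mathcal K_M$, the symmetric matrix $\mathcal H_{\mathbf u}(D_{\mathbf u_1}\cdots D_{\mathbf u_k}V_M)$ has exactly one positive eigenvalue. 2. More generally, let $\mathcal F=\{\hat 0=F_0\subsetneq F_1\subsetneq\dots\subsetneq F_{\ell+1}=\hat 1\}$ be a chain of flats of $M$, with $\ell\ge0$. Put $M_i=M_{F_i}^{F_{i+1}}$ for $0\le i\le\ell$, $\mathbb R^{\mathcal F}=\prod_{i=0}^{\ell}\mathbb R^{\mathcal P(M_i)}$, $\mathcal K_{\mathcal F}=\prod_{i=0}^{\ell}\mathcal K_{M_i}$, and $f_{\mathcal F}(\mathbf t_0,\dots,\mathbf t_\ell)=\prod_{i=0}^{\ell}V_{M_i}(\mathbf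 t_i)$ on $\mathbb R^{\mathcal F}$. Then $f_{\mathcal F}$ is a nonzero homogeneous polynomial of degree $\operatorname{rank}(M)-\ell-1$, and for $0\le k\le\deg(f_{\mathcal F})-2=\operatorname{rank}(M)-\ell-3$ and $\mathbf u,\mathbf u_1,\dots,\mathbf u_k\in\mathcal K_{\mathcal F}$ one has $$D_{\mathbf u_1}\cdots D_{\mathbf u_k}f_{\mathcal F}(\mathbf u)>0,$$ and the symmetric matrix $\mathcal H_{\mathbf u}(D_{\mathbf u_1}\cdots D_{\mathbf u_k}f_{\mathcal F})$ has exactly one positive eigenvalue. -/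

import Mathlib

open Matroid

noncomputable section

namespace MatroidVolume

variable {α : Type*}

/-- The rank of a finite matroid, as a natural number. -/
def rk (M : Matroid α) : ℕ := M.eRank.toNat

/-- The set of proper flats: all flats except the minimal flat (the set of loops) and the ground
set. -/
abbrev ProperFlat (M : Matroid α) : Type _ :=
  {F : Set α // M.IsFlat F ∧ F ≠ M.loops ∧ F ≠ M.E}

instance (M : Matroid α) [M.Finite] : Finite (ProperFlat M) := by
  have h : {F : Set α | M.IsFlat F ∧ F ≠ M.loops ∧ F ≠ M.E}.Finite :=
    M.ground_finite.finite_subsets.subset fun F hF => hF.1.subset_ground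
  exact h.to_subtype

instance (M : Matroid α) [M.Finite] : Fintype (ProperFlat M) := Fintype.ofFinite _

open Classical in
/-- The basis vector `δ_G`: the indicator function of the flat `G`. -/
def delta (M : Matroid α) (G : Set α) : ProperFlat M → ℝ := fun F => if F.1 = G then 1 else 0

open Classical in
/-- `α_i`: the sum of `δ_F` over all proper flats `F` that contain `i`. -/
def alphaVec (M : Matroid α) (i : α) : ProperFlat M → ℝ := fun F => if i ∈ F.1 then 1 else 0

open Classical in
/-- `β_i`: the sum of `δ_F` over all proper flats `F` that do not contain `i`. -/
def betaVec (M : Matroid α) (i : α) : ProperFlat M → ℝ := fun F => if i ∈ F.1 then 0 else 1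

/-- `W_M`: the span of all differences `α_i - α_j`. -/
def W (M : Matroid α) : Submodule ℝ (ProperFlat M → ℝ) :=
  Submodule.span ℝ {w | ∃ i ∈ M.E, ∃ j ∈ M.E, w = alphaVec M i - alphaVec M j}

/-- `L_M`: the quotient of the space of functions on proper flats by `W_M`. -/
abbrev L (M : Matroid α) : Type _ := (ProperFlat M → ℝ) ⧸ W M

/-- The projection onto `L_M`. -/
def proj (M : Matroid α) : (ProperFlat M → ℝ) →ₗ[ℝ] L M := (W M).mkQ

open Classical in
/-- The common image `α` in `L_M` of all the `α_i` with `i` in the ground set (and `0` if the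
ground set is empty). -/
def alphaClass (M : Matroid α) : L M :=
  if h : M.E.Nonempty then proj M (alphaVec M h.some) else 0

open Classical in
/-- The common image `β` in `L_M` of all the `β_i` with `i` in the ground set (and `0` if the
ground set is empty). -/
def betaClass (M : Matroid α) : L M :=
  if h : M.E.Nonempty then proj M (betaVec M h.some) else 0

theorem proj_alphaVec (M : Matroid α) {i : α} (hi : i ∈ M.E) :
    proj M (alphaVec M i) = alphaClass M := by
  have h : M.E.Nonempty := ⟨i, hi⟩
  rw [alphaClass, dif_pos h, proj, Submodule.mkQ_apply, Submodule.mkQ_apply,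
    Submodule.Quotient.eq]
  exact Submodule.subset_span ⟨i, hi, _, h.some_mem, rfl⟩

theorem betaVec_sub (M : Matroid α) (i j : α) :
    betaVec M i - betaVec M j = alphaVec M j - alphaVec M i := by
  funext F
  simp only [betaVec, alphaVec, Pi.sub_apply]
  split_ifs <;> norm_num

theorem proj_betaVec (M : Matroid α) {i : α} (hi : i ∈ M.E) :
    proj M (betaVec M i) = betaClass M := by
  have h : M.E.Nonempty := ⟨i, hi⟩
  rw [betaClass, dif_pos h, proj, Submodule.mkQ_apply, Submodule.mkQ_apply,
    Submodule.Quotient.eq, betaVec_sub]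
  exact Submodule.subset_span ⟨_, h.some_mem, i, hi, rfl⟩

open Classical in
/-- The linear map `π^F` from functions on the proper flats of `M` to `L` of the restriction
`M ↾ F`: it sends `δ_G` to `δ_G` if `G ⊊ F`, to `-α` if `G = F`, and to `0` otherwise. -/
def piUpper (M : Matroid α) [M.Finite] (F : Set α) (t : ProperFlat M → ℝ) : L (M ↾ F) :=
  ∑ G : ProperFlat M, t G •
    (if G.1 ⊂ F then proj (M ↾ F) (delta (M ↾ F) G.1)
      else if G.1 = F then -alphaClass (M ↾ F)
      else 0)

open Classical in
/-- The linear map `π_F` from functions on the proper flats of `M` to `L` of the contraction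
`M ／ F`: it sends `δ_G` to `δ_(G \ F)` if `F ⊊ G`, to `-β` if `G = F`, and to `0` otherwise. -/
def piLower (M : Matroid α) [M.Finite] (F : Set α) (t : ProperFlat M → ℝ) : L (M ／ F) :=
  ∑ G : ProperFlat M, t G •
    (if F ⊂ G.1 then proj (M ／ F) (delta (M ／ F) (G.1 \ F))
      else if G.1 = F then -betaClass (M ／ F)
      else 0)

/-- The defining property of the family of volume functions `V_M : L_M → ℝ`, over all finite
loopless matroids `M` (on subsets of `α`): the value is `1` in rank one, `V_M(0) = 0` in rank at
least two (and `V_M = 0` in rank zero), and the partial derivative of `V_M`, as a function on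
`ℝ^(ProperFlat M)`, with respect to the coordinate of the proper flat `F` is the product of the
volumes of the restriction to `F` and of the contraction of `F`. -/
structure IsVolumeFamily (V : ∀ M : Matroid α, L M → ℝ) : Prop where
  rank_zero : ∀ (M : Matroid α) [M.Finite] [M.Loopless], rk M = 0 → ∀ x, V M x = 0
  rank_one : ∀ (M : Matroid α) [M.Finite] [M.Loopless], rk M = 1 → ∀ x, V M x = 1
  map_zero : ∀ (M : Matroid α) [M.Finite] [M.Loopless], 1 < rk M → V M 0 = 0
  hasLineDerivAt : ∀ (M : Matroid α) [M.Finite] [M.Loopless] (F : ProperFlat M)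
    (t : ProperFlat M → ℝ),
    HasLineDerivAt ℝ (fun s : ProperFlat M → ℝ => V M (proj M s))
      (V (M ↾ F.1) (piUpper M F.1 t) * V (M ／ F.1) (piLower M F.1 t)) t (delta M F.1)

theorem contract_loopless {M : Matroid α} {F : Set α} (hF : M.IsFlat F) : (M ／ F).Loopless := by
  refine ⟨?_⟩
  rw [Matroid.loops, Matroid.contract_closure_eq]
  simp [hF.closure]

/-- The defining property determines `V_M` for every finite loopless matroid. -/
theorem IsVolumeFamily.unique {V V' : ∀ M : Matroid α, L M → ℝ} (hV : IsVolumeFamily V)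
    (hV' : IsVolumeFamily V') (M : Matroid α) [M.Finite] [M.Loopless] : V M = V' M := by
  obtain ⟨n, hn⟩ : ∃ n, M.E.ncard = n := ⟨_, rfl⟩
  induction n using Nat.strong_induction_on generalizing M with
  | _ n ih =>
  funext x
  rcases Nat.lt_trichotomy (rk M) 1 with h | h | h
  · rw [hV.rank_zero M (by omega), hV'.rank_zero M (by omega)]
  · rw [hV.rank_one M h, hV'.rank_one M h]
  classical
  obtain ⟨t, rfl⟩ : ∃ t, proj M t = x := (W M).mkQ_surjective x
  have hstep : ∀ (F : ProperFlat M) (s : ProperFlat M → ℝ) (r : ℝ),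
      V M (proj M (s + r • delta M F.1)) - V' M (proj M (s + r • delta M F.1)) =
        V M (proj M s) - V' M (proj M s) := by
    intro F s r
    have hFE : F.1 ⊂ M.E := F.2.1.subset_ground.ssubset_of_ne F.2.2.2
    have hF0 : F.1.Nonempty := by
      exact Set.nonempty_iff_ne_empty.2 fun h => F.2.2.1 (h.trans M.loops_eq_empty.symm)
    have : (M ↾ F.1).Finite := Matroid.restrict_finite (M.ground_finite.subset hFE.subset)
    have : (M ↾ F.1).Loopless := (Matroid.restrict_isRestriction M F.1 hFE.subset).loopless
    have : (M ／ F.1).Loopless := contract_loopless F.2.1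
    have h1 : V (M ↾ F.1) = V' (M ↾ F.1) :=
      ih _ (hn ▸ Set.ncard_lt_ncard hFE M.ground_finite) (M ↾ F.1) rfl
    have h2 : V (M ／ F.1) = V' (M ／ F.1) := by
      refine ih _ (hn ▸ Set.ncard_lt_ncard ?_ M.ground_finite) (M ／ F.1) rfl
      obtain ⟨e, he⟩ := hF0
      exact ⟨Set.sdiff_subset, fun hsub => (hsub (hFE.subset he)).2 he⟩
    have hd : ∀ y : ℝ, HasDerivAt (fun r : ℝ => V M (proj M (s + r • delta M F.1)) -
        V' M (proj M (s + r • delta M F.1))) 0 y := by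
      intro y
      have e1 := hV.hasLineDerivAt M F (s + y • delta M F.1)
      have e2 := hV'.hasLineDerivAt M F (s + y • delta M F.1)
      rw [h1, h2] at e1
      have e3 := e1.sub e2
      rw [sub_self] at e3
      have e4 : HasDerivAt (fun r : ℝ => r - y) 1 y := (hasDerivAt_id y).sub_const y
      have e5 := HasDerivAt.scomp y (h := fun r : ℝ => r - y)
        (by simpa using e3) e4
      simp only [smul_zero] at e5
      convert! e5 using 1
      funext r
      have : s + r • delta M F.1 = s + y • delta M F.1 + (r - y) • delta M F.1 := by module
      simp [this]
    have := is_const_of_deriv_eq_zero (fun y => (hd y).differentiableAt)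
      (fun y => (hd y).deriv) r 0
    simpa using this
  have hsum : ∀ S : Finset (ProperFlat M),
      V M (proj M (∑ F ∈ S, t F • delta M F.1)) - V' M (proj M (∑ F ∈ S, t F • delta M F.1)) = 0 := by
    intro S
    induction S using Finset.induction_on with
    | empty => simp [hV.map_zero M h, hV'.map_zero M h]
    | insert F S hF ihS => rw [Finset.sum_insert hF, add_comm, hstep, ihS]
  have ht : t = ∑ F, t F • delta M F.1 := by
    funext G
    have hG : ∀ F : ProperFlat M, (G.1 = F.1) = (G = F) := fun F => propext Subtype.ext_iff.symm
    simp [Finset.sum_apply, delta, hG]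
  rw [ht]
  exact sub_eq_zero.1 (hsum _)

open Classical in
/-- The volume function `V_M : L_M → ℝ`: the family with the defining property, which is unique on
finite loopless matroids. -/
def vol : ∀ M : Matroid α, L M → ℝ :=
  if h : ∃ V : ∀ M : Matroid α, L M → ℝ, IsVolumeFamily V then h.choose else fun _ _ => 0

/-- The volume polynomial as a function on `ℝ^(ProperFlat M)`. -/
def volFun (M : Matroid α) (t : ProperFlat M → ℝ) : ℝ := vol M (proj M t)

/-- A function on the subsets of `E` is strictly submodular if it vanishes at `∅` and at `E` and
satisfies the strict submodular inequality at all incomparable nonempty proper subsets of `E`. -/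
structure IsStrictlySubmodular (E : Set α) (c : Set α → ℝ) : Prop where
  map_empty : c ∅ = 0
  map_ground : c E = 0
  lt : ∀ I J : Set α, ∅ ⊂ I → I ⊂ E → ∅ ⊂ J → J ⊂ E → ¬ I ⊆ J → ¬ J ⊆ I →
    c (I ∩ J) + c (I ∪ J) < c I + c J

/-- The ample cone in `L_M`. -/
def ampleCone (M : Matroid α) : Set (L M) :=
  {y | ∃ c : Set α → ℝ, IsStrictlySubmodular M.E c ∧ y = proj M (fun F => c F.1)}

/-- The iterated directional derivative `D_{u_1} ⋯ D_{u_k} f`. -/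
def iterD {σ : Type*} (us : List (σ → ℝ)) (f : (σ → ℝ) → ℝ) : (σ → ℝ) → ℝ :=
  us.foldr (fun v g x => lineDeriv ℝ g x v) f

open Classical in
/-- The Hessian matrix of `f` at `u`. -/
def hessian {σ : Type*} (f : (σ → ℝ) → ℝ) (u : σ → ℝ) : Matrix σ σ ℝ :=
  Matrix.of fun i j => iterD [Pi.single i 1, Pi.single j 1] f u

open Classical in
/-- A real symmetric matrix has exactly one positive eigenvalue, counted with multiplicity. -/
def HasUniquePosEigenvalue {σ : Type*} [Fintype σ] (A : Matrix σ σ ℝ) : Prop :=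
  ∃ hA : A.IsHermitian, ∃! i : σ, 0 < hA.eigenvalues i

/-- A chain of flats `0̂ = F_0 ⊊ F_1 ⊊ ⋯ ⊊ F_ℓ ⊊ F_{ℓ+1} = 1̂`. -/
structure FlatChain (M : Matroid α) (ℓ : ℕ) where
  /-- The flats of the chain. -/
  flat : Fin (ℓ + 2) → Set α
  isFlat : ∀ i, M.IsFlat (flat i)
  strictMono : StrictMono flat
  bot : flat 0 = M.loops
  top : flat (Fin.last (ℓ + 1)) = M.E

namespace FlatChain

variable {M : Matroid α} {ℓ : ℕ}

/-- The matroid of the interval between two consecutive flats of the chain: restrict to the larger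
one and contract the smaller one. -/
def minor (C : FlatChain M ℓ) (i : Fin (ℓ + 1)) : Matroid α :=
  (M ↾ C.flat i.succ) ／ C.flat i.castSucc

instance [M.Finite] (C : FlatChain M ℓ) (i : Fin (ℓ + 1)) : (C.minor i).Finite := by
  have : (M ↾ C.flat i.succ).Finite :=
    Matroid.restrict_finite (M.ground_finite.subset (C.isFlat _).subset_ground)
  exact Matroid.contract_finite

/-- The index set of the coordinates of `ℝ^𝓕`: the disjoint union of the sets of proper flats of
the matroids of the chain. -/
abbrev Index (C : FlatChain M ℓ) : Type _ := Σ i : Fin (ℓ + 1), ProperFlat (C.minor i)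

/-- The component of a vector of `ℝ^𝓕` at the `i`-th matroid of the chain. -/
def component (C : FlatChain M ℓ) (t : C.Index → ℝ) (i : Fin (ℓ + 1)) :
    ProperFlat (C.minor i) → ℝ := fun F => t ⟨i, F⟩

/-- The function `f_𝓕`: the product of the volume polynomials of the matroids of the chain. -/
def prodVol (C : FlatChain M ℓ) (t : C.Index → ℝ) : ℝ :=
  ∏ i : Fin (ℓ + 1), volFun (C.minor i) (C.component t i)

/-- The vector `t` of `ℝ^𝓕` represents an element of the product of the ample cones. -/
def MemAmple (C : FlatChain M ℓ) (t : C.Index → ℝ) : Prop :=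
  ∀ i : Fin (ℓ + 1), proj (C.minor i) (C.component t i) ∈ ampleCone (C.minor i)

end FlatChain

end MatroidVolume

end

/-! The proof builds the volume polynomials explicitly, makes derivatives along ample classes
positive combinations of smaller products, and inducts on degree over products of volume
polynomials. Products are unavoidable: a derivative at a flat splits one factor into a restriction
and a contraction.

Construction. `volPoly M` has variables indexed by all sets, so restriction keeps the variables,
contraction is the renaming `S ↦ S ∪ F`, and passing to `L_M` becomes invariance under the modular
functions `1` and `[i ∈ S]`. Write `S_F` for `splitPoly M F`, the product prescribed as the
derivative at `F`. Euler's formula dictates the recursion, and two facts show that its solution has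
these derivatives. Mixed derivatives agree, `∂_G S_F = ∂_F S_G` (`dirDeriv_single_splitPoly_comm`):
for comparable flats both are the triple product along the chain, and for incomparable ones both
vanish. Also, the sum of `S_F` over `F ∋ i` does not depend on `i` (`sum_splitPoly_eq`). Uniqueness
of the family then identifies `vol` with this polynomial (`volFun_eq`).

Positivity. A strictly submodular function lies strictly above a modular function with the same
values at `∅` and `E` (`exists_modularSum_lt`). Modular directions have zero derivative, so its own
derivative is a combination of the `S_F` with positive coefficients. Strict submodularity passes to
restrictions and contractions, and `eval_iterDirDeriv_pos` follows by induction.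

Signature. It suffices that the quadratic form is nonpositive on a hyperplane while positive in one
direction. In degree two this is a product of two linear forms or a rank three matroid, where the
form is minus a sum of squares over the rank two flats. In higher degree, let `B` be the Hessian in
flat coordinates of the full-order derivative, and `v > 0` the coefficients of the derivative along
one ample `u`. Induction gives a reversed Cauchy–Schwarz inequality for each `∂_F f`; weighted by
`v` and summed, these bound `x·Bx` by `Σ (v_a / (Bv)_a) (Bx)_a²`. After rescaling, every eigenvalue
satisfies `λ ≤ λ²`. Off-diagonal entries are nonnegative, so Perron–Frobenius gives `λ ≤ 1`, and
connectedness of the comparability graph makes the eigenvalue `1` simple. Hence there is at most one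
positive eigenvalue (`exists_nonpos_kernel_of_connected`, `hasNonposKernel_cons`). -/

noncomputable section

namespace MatroidVolume

variable {α : Type*}

/-! ### Formal directional derivatives and Euler's identity -/

section DirectionalDerivative

open MvPolynomial

variable {σ τ : Type*}

/-- The directional derivative of a polynomial in the direction of a constant vector. -/
def dirDeriv (w : σ → ℝ) : Derivation ℝ (MvPolynomial σ ℝ) (MvPolynomial σ ℝ) :=
  mkDerivation ℝ fun s => C (w s)

@[simp] theorem dirDeriv_X (w : σ → ℝ) (s : σ) : dirDeriv w (X s) = C (w s) :=
  mkDerivation_X _ _ _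

@[simp] theorem dirDeriv_C (w : σ → ℝ) (r : ℝ) : dirDeriv w (C r) = 0 :=
  derivation_C _ _

theorem dirDeriv_mul (w : σ → ℝ) (p q : MvPolynomial σ ℝ) :
    dirDeriv w (p * q) = dirDeriv w p * q + p * dirDeriv w q := by
  rw [Derivation.leibniz, smul_eq_mul, smul_eq_mul]; ring

theorem dirDeriv_C_mul (w : σ → ℝ) (r : ℝ) (p : MvPolynomial σ ℝ) :
    dirDeriv w (C r * p) = C r * dirDeriv w p := by
  rw [dirDeriv_mul, dirDeriv_C]; ring

theorem dirDeriv_add (v w : σ → ℝ) (p : MvPolynomial σ ℝ) :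
    dirDeriv (v + w) p = dirDeriv v p + dirDeriv w p := by
  have : dirDeriv (v + w) = dirDeriv v + dirDeriv w := derivation_ext fun i => by simp
  rw [this]; rfl

theorem dirDeriv_smul (r : ℝ) (w : σ → ℝ) (p : MvPolynomial σ ℝ) :
    dirDeriv (r • w) p = C r * dirDeriv w p := by
  have : dirDeriv (r • w) = r • dirDeriv w := derivation_ext fun i => by
    simp [smul_eq_C_mul]
  rw [this, Derivation.smul_apply, smul_eq_C_mul]

theorem dirDeriv_sub (v w : σ → ℝ) (p : MvPolynomial σ ℝ) :
    dirDeriv (v - w) p = dirDeriv v p - dirDeriv w p := by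
  have : dirDeriv (v - w) = dirDeriv v - dirDeriv w := derivation_ext fun i => by simp
  rw [this]; rfl

theorem dirDeriv_zero (p : MvPolynomial σ ℝ) : dirDeriv (0 : σ → ℝ) p = 0 := by
  simpa using dirDeriv_smul 0 (0 : σ → ℝ) p

theorem dirDeriv_sum {ι : Type*} (s : Finset ι) (w : ι → σ → ℝ) (p : MvPolynomial σ ℝ) :
    dirDeriv (∑ i ∈ s, w i) p = ∑ i ∈ s, dirDeriv (w i) p := by
  classical
  induction s using Finset.induction_on with
  | empty => simp [dirDeriv_zero]
  | insert a s ha ih => rw [Finset.sum_insert ha, Finset.sum_insert ha, dirDeriv_add, ih]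

theorem dirDeriv_comm (v w : σ → ℝ) (p : MvPolynomial σ ℝ) :
    dirDeriv v (dirDeriv w p) = dirDeriv w (dirDeriv v p) := by
  have : ⁅dirDeriv v, dirDeriv w⁆ = 0 := derivation_ext fun i => by
    simp [Derivation.commutator_apply]
  have h := congrArg (fun D => D p) this
  simpa [Derivation.commutator_apply, sub_eq_zero] using h

theorem dirDeriv_rename (f : σ → τ) (w : τ → ℝ) (p : MvPolynomial σ ℝ) :
    dirDeriv w (rename f p) = rename f (dirDeriv (w ∘ f) p) := by
  induction p using MvPolynomial.induction_on with
  | C a => simp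
  | add p q hp hq => simp [hp, hq]
  | mul_X p n hp => simp [hp]

theorem dirDeriv_prod {ι : Type*} [DecidableEq ι] (s : Finset ι) (w : σ → ℝ)
    (p : ι → MvPolynomial σ ℝ) :
    dirDeriv w (∏ i ∈ s, p i) = ∑ i ∈ s, (∏ j ∈ s.erase i, p j) * dirDeriv w (p i) := by
  induction s using Finset.induction_on with
  | empty => simp
  | insert a s ha ih =>
    rw [Finset.prod_insert ha, Finset.sum_insert ha, dirDeriv_mul, ih, Finset.erase_insert ha,
      Finset.mul_sum, add_comm, mul_comm (dirDeriv w (p a)), add_comm]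
    refine congrArg₂ _ rfl (Finset.sum_congr rfl fun i hi => ?_)
    rw [Finset.erase_insert_of_ne (by rintro rfl; exact ha hi),
      Finset.prod_insert (by simp [ha]), mul_assoc]

theorem dirDeriv_monomial (w : σ → ℝ) (m : σ →₀ ℕ) (r : ℝ) :
    dirDeriv w (monomial m r) =
      ∑ i ∈ m.support, monomial (m - Finsupp.single i 1) (r * m i * w i) := by
  rw [dirDeriv, mkDerivation_monomial, Finsupp.sum, Finset.smul_sum]
  refine Finset.sum_congr rfl fun i _ => ?_
  rw [smul_eq_mul, mul_comm, C_mul_monomial, smul_monomial]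
  congr 1
  simp; ring

theorem IsHomogeneous.dirDeriv {p : MvPolynomial σ ℝ} {n : ℕ} (hp : p.IsHomogeneous n)
    (w : σ → ℝ) : (dirDeriv w p).IsHomogeneous (n - 1) := by
  rw [p.as_sum, map_sum]
  refine IsHomogeneous.sum _ _ _ fun m hm => ?_
  rw [dirDeriv_monomial]
  refine IsHomogeneous.sum _ _ _ fun i hi => isHomogeneous_monomial _ ?_
  have h1 : m.degree = n := by
    rw [Finsupp.degree_eq_weight_one]
    exact hp (mem_support_iff.1 hm)
  have hle : Finsupp.single i 1 ≤ m := by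
    rw [Finsupp.single_le_iff]; exact Nat.one_le_iff_ne_zero.2 (Finsupp.mem_support_iff.1 hi)
  have h2 : (m - Finsupp.single i 1).degree + (Finsupp.single i 1).degree = m.degree := by
    rw [← map_add, tsub_add_cancel_of_le hle]
  rw [Finsupp.degree_single] at h2
  omega

/-- Euler's identity, checked on monomials. Its main use is to conclude that a form of positive
degree is zero once all its derivatives are. -/
theorem eval_dirDeriv_self {p : MvPolynomial σ ℝ} {n : ℕ} (hp : p.IsHomogeneous n) (c : σ → ℝ) :
    eval c (dirDeriv c p) = n * eval c p := by
  have key : ∀ m : σ →₀ ℕ, ∀ r : ℝ, eval c (dirDeriv c (monomial m r)) =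
      m.degree * eval c (monomial m r) := by
    intro m r
    rw [dirDeriv_monomial, map_sum, Finsupp.degree_apply, Nat.cast_sum, Finset.sum_mul]
    refine Finset.sum_congr rfl fun i hi => ?_
    have hle : Finsupp.single i 1 ≤ m := by
      rw [Finsupp.single_le_iff]; exact Nat.one_le_iff_ne_zero.2 (Finsupp.mem_support_iff.1 hi)
    have h2 : monomial m r = monomial (m - Finsupp.single i 1) r * X i := by
      rw [X, monomial_mul, tsub_add_cancel_of_le hle, mul_one]
    rw [h2, show r * m i * c i = (m i * c i) * r by ring, ← C_mul_monomial, (eval c).map_mul,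
      (eval c).map_mul, eval_X, eval_C]
    ring
  conv_lhs => rw [p.as_sum]
  conv_rhs => rw [p.as_sum]
  rw [map_sum, map_sum, map_sum, Finset.mul_sum]
  refine Finset.sum_congr rfl fun m hm => ?_
  have h1 : m.degree = n := by
    rw [Finsupp.degree_eq_weight_one]
    exact hp (mem_support_iff.1 hm)
  rw [key, h1]

theorem hasDerivAt_eval (c w : σ → ℝ) (p : MvPolynomial σ ℝ) (s : ℝ) :
    HasDerivAt (fun s : ℝ => eval (c + s • w) p) (eval (c + s • w) (dirDeriv w p)) s := by
  induction p using MvPolynomial.induction_on with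
  | C a => simpa using hasDerivAt_const s a
  | add p q hp hq => simpa using! hp.add hq
  | mul_X p n hp =>
    have h1 : HasDerivAt (fun s : ℝ => eval (c + s • w) (X n)) (w n) s := by
      simpa using ((hasDerivAt_id s).mul_const (w n)).const_add (c n)
    rw [dirDeriv_mul, dirDeriv_X]
    simpa using! hp.mul h1

theorem eval_add_eq_of_dirDeriv_eq_zero {w : σ → ℝ} {p : MvPolynomial σ ℝ}
    (h : dirDeriv w p = 0) (c : σ → ℝ) : eval (c + w) p = eval c p := by
  have hd := fun s => hasDerivAt_eval c w p s
  simp only [h, map_zero] at hd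
  have := is_const_of_deriv_eq_zero (fun y => (hd y).differentiableAt) (fun y => (hd y).deriv) 1 0
  simpa using this

end DirectionalDerivative

/-! ### Flats and ranks of restrictions and contractions -/

section MatroidFacts

/-- A finite loopless matroid. -/
structure IsFinLoopless (M : Matroid α) : Prop where
  finite : M.Finite
  loopless : M.Loopless

open Classical in
/-- The finset of flats of a finite loopless matroid other than `∅` and the ground set. -/
def properFlats (M : Matroid α) : Finset (Set α) :=
  if h : {F : Set α | M.IsFlat F ∧ F ≠ ∅ ∧ F ≠ M.E}.Finite then h.toFinset else ∅

variable {M : Matroid α} {F G : Set α}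

theorem IsFinLoopless.mem_properFlats (hM : IsFinLoopless M) :
    F ∈ properFlats M ↔ M.IsFlat F ∧ F ≠ ∅ ∧ F ≠ M.E := by
  have h : {F : Set α | M.IsFlat F ∧ F ≠ ∅ ∧ F ≠ M.E}.Finite :=
    hM.finite.ground_finite.finite_subsets.subset fun F hF => hF.1.subset_ground
  rw [properFlats, dif_pos h, Set.Finite.mem_toFinset]
  rfl

theorem IsFinLoopless.isFlat (hM : IsFinLoopless M) (hF : F ∈ properFlats M) : M.IsFlat F :=
  (hM.mem_properFlats.1 hF).1

theorem IsFinLoopless.nonempty (hM : IsFinLoopless M) (hF : F ∈ properFlats M) : F.Nonempty :=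
  Set.nonempty_iff_ne_empty.2 (hM.mem_properFlats.1 hF).2.1

theorem IsFinLoopless.ssubset (hM : IsFinLoopless M) (hF : F ∈ properFlats M) : F ⊂ M.E :=
  (hM.isFlat hF).subset_ground.ssubset_of_ne (hM.mem_properFlats.1 hF).2.2

theorem IsFinLoopless.restrict (hM : IsFinLoopless M) (hF : F ⊆ M.E) :
    IsFinLoopless (M ↾ F) := by
  have := hM.loopless
  exact ⟨Matroid.restrict_finite (hM.finite.ground_finite.subset hF),
    (Matroid.restrict_isRestriction M F hF).loopless⟩

theorem IsFinLoopless.contract (hM : IsFinLoopless M) (hF : M.IsFlat F) :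
    IsFinLoopless (M ／ F) := by
  have := hM.finite
  exact ⟨Matroid.contract_finite, contract_loopless hF⟩

theorem isFlat_restrict_iff (hF : M.IsFlat F) : (M ↾ F).IsFlat G ↔ M.IsFlat G ∧ G ⊆ F := by
  have key : G ⊆ F → (M ↾ F).closure G = M.closure G := fun h => by
    rw [M.restrict_closure_eq h hF.subset_ground]
    exact Set.inter_eq_left.2 (by simpa [hF.closure] using M.closure_subset_closure h)
  constructor
  · intro h
    have hG : G ⊆ F := h.subset_ground
    exact ⟨isFlat_iff_closure_eq.2 ((key hG).symm.trans h.closure), hG⟩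
  · rintro ⟨h, hG⟩
    exact isFlat_iff_closure_eq.2 ((key hG).trans h.closure)

theorem isFlat_contract_iff (hF : F ⊆ M.E) :
    (M ／ F).IsFlat G ↔ Disjoint G F ∧ M.IsFlat (G ∪ F) := by
  rw [isFlat_iff_closure_eq, contract_closure_eq, isFlat_iff_closure_eq]
  constructor
  · intro h
    have hd : Disjoint G F := by rw [← h]; exact Set.disjoint_sdiff_left
    refine ⟨hd, ?_⟩
    have h2 : F ⊆ M.closure (G ∪ F) := by
      have hG : G ⊆ M.E := by
        rw [← h]; exact Set.sdiff_subset.trans (M.closure_subset_ground _)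
      exact Set.subset_union_right.trans (M.subset_closure _ (Set.union_subset hG hF))
    rw [← Set.sdiff_union_of_subset h2, h]
  · rintro ⟨hd, h⟩
    rw [h, Set.union_sdiff_right, hd.sdiff_eq_left]

theorem IsFinLoopless.mem_properFlats_restrict (hM : IsFinLoopless M) (hF : M.IsFlat F)
    (hFE : F ≠ M.E) : G ∈ properFlats (M ↾ F) ↔ G ∈ properFlats M ∧ G ⊂ F := by
  rw [(hM.restrict hF.subset_ground).mem_properFlats, hM.mem_properFlats, isFlat_restrict_iff hF,
    restrict_ground_eq, ssubset_iff_subset_ne]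
  constructor
  · rintro ⟨⟨h1, h2⟩, h3, h4⟩
    refine ⟨⟨h1, h3, ?_⟩, h2, h4⟩
    rintro rfl
    exact hFE (hF.subset_ground.antisymm h2)
  · rintro ⟨⟨h1, h3, -⟩, h2, h4⟩
    exact ⟨⟨h1, h2⟩, h3, h4⟩

theorem IsFinLoopless.mem_properFlats_contract (hM : IsFinLoopless M) (hF : F ∈ properFlats M) :
    G ∈ properFlats (M ／ F) ↔ Disjoint G F ∧ G ≠ ∅ ∧ G ∪ F ∈ properFlats M := by
  have hFE := (hM.isFlat hF).subset_ground
  rw [(hM.contract (hM.isFlat hF)).mem_properFlats, hM.mem_properFlats, isFlat_contract_iff hFE,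
    contract_ground]
  constructor
  · rintro ⟨⟨h1, h2⟩, h3, h4⟩
    refine ⟨h1, h3, h2, by simp [h3], fun h => h4 ?_⟩
    rw [← h, Set.union_sdiff_right, h1.sdiff_eq_left]
  · rintro ⟨h1, h3, h2, -, h4⟩
    refine ⟨⟨h1, h2⟩, h3, fun h => h4 ?_⟩
    rw [h, Set.sdiff_union_of_subset hFE]

theorem IsFinLoopless.sdiff_mem_properFlats_contract (hM : IsFinLoopless M)
    (hF : F ∈ properFlats M) (hG : G ∈ properFlats M) (h : F ⊂ G) :
    G \ F ∈ properFlats (M ／ F) := by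
  rw [hM.mem_properFlats_contract hF, Set.sdiff_union_of_subset h.subset]
  exact ⟨Set.disjoint_sdiff_left, (Set.nonempty_of_ssubset h).ne_empty, hG⟩

theorem IsFinLoopless.eRk_ne_top (hM : IsFinLoopless M) (X : Set α) : M.eRk X ≠ ⊤ := by
  have := hM.finite
  exact eRk_ne_top_iff.2 (M.isRkFinite_set X)

/-- A basis `J` of `F` extends to a base `B`; maximality of `J` forces `B ∩ F = J`, so `B \ F` is a
base of the contraction. -/
theorem eRank_contract_add (hF : F ⊆ M.E) : (M ／ F).eRank + M.eRk F = M.eRank := by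
  obtain ⟨J, hJ⟩ := M.exists_isBasis F
  obtain ⟨B, hB, hJB⟩ := hJ.indep.exists_isBase_superset
  have hBF : B ∩ F = J := by
    refine (hJ.eq_of_subset_indep (hB.indep.inter_right F) (Set.subset_inter hJB hJ.subset)
      Set.inter_subset_right).symm
  have h1 : (M ／ F).IsBasis (B \ F) (M.E \ F) :=
    hB.isBasis_ground.contract_isBasis hJ
      (hB.indep.subset (Set.union_subset Set.sdiff_subset hJB))
  have h2 : (M ／ F).IsBase (B \ F) := by
    rw [← isBasis_ground_iff]; exact h1
  rw [← h2.encard_eq_eRank, ← hJ.encard_eq_eRk, ← hB.encard_eq_eRank, ← hBF,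
    Set.encard_sdiff_add_encard_inter]

theorem IsFinLoopless.rk_contract_add_rk_restrict (hM : IsFinLoopless M) (hF : F ⊆ M.E) :
    rk (M ↾ F) + rk (M ／ F) = rk M := by
  have h := eRank_contract_add hF
  have h1 : M.eRank ≠ ⊤ := by rw [eRank_def]; exact hM.eRk_ne_top _
  have h2 : (M ／ F).eRank ≠ ⊤ := fun h' => h1 (by rw [← h, h', top_add])
  rw [rk, rk, rk, ← h, ENat.toNat_add h2 (hM.eRk_ne_top F), eRank_restrict, add_comm]

theorem IsFinLoopless.rk_eq_zero_iff (hM : IsFinLoopless M) : rk M = 0 ↔ M.E = ∅ := by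
  have h1 : M.eRank ≠ ⊤ := by rw [eRank_def]; exact hM.eRk_ne_top _
  have := hM.loopless
  rw [rk, ENat.toNat_eq_zero, or_iff_left h1, eRank_def, eRk_eq_zero_iff, M.loops_eq_empty,
    Set.subset_empty_iff]

theorem IsFinLoopless.rk_pos_iff (hM : IsFinLoopless M) : 0 < rk M ↔ M.E.Nonempty := by
  rw [Nat.pos_iff_ne_zero, Ne, hM.rk_eq_zero_iff, Set.nonempty_iff_ne_empty]

theorem IsFinLoopless.rk_restrict_pos (hM : IsFinLoopless M) (hF : F ∈ properFlats M) :
    0 < rk (M ↾ F) :=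
  (hM.restrict (hM.ssubset hF).subset).rk_pos_iff.2 (hM.nonempty hF)

theorem IsFinLoopless.rk_contract_pos (hM : IsFinLoopless M) (hF : F ∈ properFlats M) :
    0 < rk (M ／ F) := by
  refine (hM.contract (hM.isFlat hF)).rk_pos_iff.2 ?_
  exact Set.nonempty_of_ssubset (hM.ssubset hF)

theorem IsFinLoopless.rk_add (hM : IsFinLoopless M) (hF : F ∈ properFlats M) :
    rk (M ↾ F) + rk (M ／ F) = rk M :=
  hM.rk_contract_add_rk_restrict (hM.ssubset hF).subset

theorem IsFinLoopless.properFlats_eq_empty (hM : IsFinLoopless M) (h : rk M ≤ 1) :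
    properFlats M = ∅ := by
  refine Finset.eq_empty_of_forall_notMem fun F hF => ?_
  have h1 := hM.rk_restrict_pos hF
  have h2 := hM.rk_contract_pos hF
  have h3 := hM.rk_add hF
  omega

theorem IsFinLoopless.closure_mem_properFlats (hM : IsFinLoopless M) {X : Set α}
    (hX : X.Nonempty) (hXE : X ⊆ M.E) (hr : M.eRk X < rk M) : M.closure X ∈ properFlats M := by
  rw [hM.mem_properFlats]
  refine ⟨M.isFlat_closure X, ?_, ?_⟩
  · exact (hX.mono (M.subset_closure X)).ne_empty
  · intro h
    have h1 : M.eRank ≠ ⊤ := by rw [eRank_def]; exact hM.eRk_ne_top _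
    rw [← eRk_closure_eq, h, ← eRank_def, rk, ENat.natCast_toNat h1] at hr
    exact lt_irrefl _ hr

theorem IsFinLoopless.closure_singleton_mem_properFlats (hM : IsFinLoopless M) {i : α}
    (hi : i ∈ M.E) (hr : 2 ≤ rk M) : M.closure {i} ∈ properFlats M := by
  refine hM.closure_mem_properFlats (Set.singleton_nonempty i) (by simpa) ?_
  refine (M.eRk_singleton_le i).trans_lt ?_
  exact_mod_cast hr

theorem IsFinLoopless.closure_pair_mem_properFlats (hM : IsFinLoopless M) {i j : α}
    (hi : i ∈ M.E) (hj : j ∈ M.E) (hr : 3 ≤ rk M) : M.closure {i, j} ∈ properFlats M := by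
  refine hM.closure_mem_properFlats ⟨i, by simp⟩ (Set.insert_subset hi (by simpa)) ?_
  refine (M.eRk_insert_le_add_one i {j}).trans_lt ?_
  refine (add_le_add_left (M.eRk_singleton_le j) 1).trans_lt ?_
  exact_mod_cast hr

/-- In rank at least three, a function that agrees on comparable proper flats is constant. -/
theorem IsFinLoopless.eq_of_comparable (hM : IsFinLoopless M) (hr : 3 ≤ rk M) {β : Type*}
    (φ : Set α → β)
    (hφ : ∀ F ∈ properFlats M, ∀ G ∈ properFlats M, F ⊂ G → φ F = φ G)
    (hF : F ∈ properFlats M) (hG : G ∈ properFlats M) : φ F = φ G := by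
  have hle : ∀ F ∈ properFlats M, ∀ G ∈ properFlats M, F ⊆ G → φ F = φ G := by
    intro F hF G hG h
    rcases eq_or_ssubset_of_subset h with rfl | h
    · rfl
    · exact hφ F hF G hG h
  obtain ⟨i, hi⟩ := hM.nonempty hF
  obtain ⟨j, hj⟩ := hM.nonempty hG
  have hiE := (hM.ssubset hF).subset hi
  have hjE := (hM.ssubset hG).subset hj
  have ci := hM.closure_singleton_mem_properFlats hiE (by omega)
  have cj := hM.closure_singleton_mem_properFlats hjE (by omega)
  have cij := hM.closure_pair_mem_properFlats hiE hjE hr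
  have e1 := hle _ ci _ hF
    ((hM.isFlat hF).closure ▸ M.closure_subset_closure (Set.singleton_subset_iff.2 hi))
  have e2 := hle _ cj _ hG
    ((hM.isFlat hG).closure ▸ M.closure_subset_closure (Set.singleton_subset_iff.2 hj))
  have e3 := hle _ ci _ cij (M.closure_subset_closure (by simp))
  have e4 := hle _ cj _ cij (M.closure_subset_closure (by simp))
  rw [← e1, ← e2, e3, e4]

/-- A proper flat with restriction of rank one lies in every flat that meets it. -/
theorem IsFinLoopless.subset_of_rk_restrict_eq_one (hM : IsFinLoopless M)
    (hF : F ∈ properFlats M) (hr : rk (M ↾ F) = 1) {i : α} (hi : i ∈ F) (hG : M.IsFlat G)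
    (hiG : i ∈ G) : F ⊆ G := by
  have := hM.loopless
  have := hM.finite
  have hFE := (hM.ssubset hF).subset
  have h1 : M.eRk F ≤ M.eRk {i} := by
    rw [eRk_singleton_eq (hFE hi), ← eRank_restrict]
    have h2 : (M ↾ F).eRank ≠ ⊤ := hM.eRk_ne_top F
    rw [← ENat.natCast_toNat h2]
    exact_mod_cast hr.le
  have h2 := (M.isRkFinite_set {i}).closure_eq_closure_of_subset_of_eRk_ge_eRk
    (Set.singleton_subset_iff.2 hi) h1
  rw [← (hM.isFlat hF).closure, ← h2, ← hG.closure]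
  exact M.closure_subset_closure (Set.singleton_subset_iff.2 hiG)

/-- In rank two, each element of the ground set lies in exactly one proper flat. -/
theorem IsFinLoopless.filter_mem_properFlats (hM : IsFinLoopless M) (hr : rk M = 2) {i : α}
    (hi : i ∈ M.E) [DecidablePred fun F : Set α => i ∈ F] :
    {F ∈ properFlats M | i ∈ F} = {M.closure {i}} := by
  have hc := hM.closure_singleton_mem_properFlats hi hr.ge
  have h1 : ∀ F ∈ properFlats M, rk (M ↾ F) = 1 := by
    intro F hF
    have h1 := hM.rk_restrict_pos hF
    have h2 := hM.rk_contract_pos hF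
    have h3 := hM.rk_add hF
    omega
  have hic : i ∈ M.closure {i} := M.mem_closure_of_mem rfl (by simpa)
  ext F
  rw [Finset.mem_filter, Finset.mem_singleton]
  constructor
  · rintro ⟨hF, hiF⟩
    exact (hM.subset_of_rk_restrict_eq_one hF (h1 F hF) hiF (hM.isFlat hc) hic).antisymm
      (hM.subset_of_rk_restrict_eq_one hc (h1 _ hc) hic (hM.isFlat hF) hiF)
  · rintro rfl
    exact ⟨hc, hic⟩

end MatroidFacts

/-! ### Construction of the volume polynomial and its derivatives -/

section VolumePolynomial

open MvPolynomial

variable {M : Matroid α} {F G : Set α}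

open Classical in
/-- The value at `F` of the function `w` minus the combination of `1` and the indicator of `i` that
agrees with `w` at `∅` and at the ground set. -/
def normalize (M : Matroid α) (i : α) (w : Set α → ℝ) (F : Set α) : ℝ :=
  w F - if i ∈ F then w M.E else w ∅

open Classical in
/-- The recursion for the volume polynomial, with a bound for its depth. -/
def volPolyAux : ℕ → Matroid α → MvPolynomial (Set α) ℝ
  | 0, _ => 0
  | n + 1, M =>
    if rk M = 0 then 0
    else if rk M = 1 then 1
    else C ((rk M - 1 : ℝ)⁻¹) * ∑ F ∈ properFlats M,
      (X F - if ∃ h : M.E.Nonempty, h.some ∈ F then X M.E else X ∅) *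
        (volPolyAux n (M ↾ F) * rename (· ∪ F) (volPolyAux n (M ／ F)))

/-- The volume polynomial of a finite loopless matroid, in variables indexed by sets. Only flats
contribute. It is invariant under the modular functions `1` and `F ↦ [i ∈ F]`. -/
def volPoly (M : Matroid α) : MvPolynomial (Set α) ℝ := volPolyAux (rk M) M

/-- The product of the volume polynomials of the restriction to `F` and the contraction of `F`. -/
def splitPoly (M : Matroid α) (F : Set α) : MvPolynomial (Set α) ℝ :=
  volPoly (M ↾ F) * rename (· ∪ F) (volPoly (M ／ F))

/-- Both minors at a proper flat have positive rank, and the two ranks add up to `rk M`, so each is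
strictly smaller and the recursion stops before the bound is reached. -/
theorem volPolyAux_succ (n : ℕ) :
    ∀ M : Matroid α, IsFinLoopless M → rk M ≤ n → volPolyAux (n + 1) M = volPolyAux n M := by
  induction n with
  | zero =>
    intro M _ h
    simp [volPolyAux, Nat.le_zero.1 h]
  | succ n ih =>
    intro M hM h
    rw [volPolyAux, volPolyAux]
    split_ifs with h0 h1
    · rfl
    · rfl
    · congr 1
      refine Finset.sum_congr rfl fun F hF => ?_
      have h1 := hM.rk_restrict_pos hF
      have h2 := hM.rk_contract_pos hF
      have h3 := hM.rk_add hF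
      rw [ih _ (hM.restrict (hM.ssubset hF).subset) (by omega),
        ih _ (hM.contract (hM.isFlat hF)) (by omega)]

theorem volPolyAux_eq (hM : IsFinLoopless M) (n : ℕ) (h : rk M ≤ n) :
    volPolyAux n M = volPoly M := by
  induction n, h using Nat.le_induction with
  | base => rfl
  | succ n hn ih => rw [volPolyAux_succ n M hM hn, ih]

theorem volPoly_rank_zero (h : rk M = 0) : volPoly M = 0 := by
  rw [volPoly, h, volPolyAux]

theorem volPoly_rank_one (h : rk M = 1) : volPoly M = 1 := by
  rw [volPoly, h, volPolyAux, if_neg (by omega), if_pos h]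

open Classical in
theorem exists_volPoly_eq (hM : IsFinLoopless M) (h : 2 ≤ rk M) :
    ∃ b ∈ M.E, volPoly M = C ((rk M - 1 : ℝ)⁻¹) * ∑ F ∈ properFlats M,
      (X F - if b ∈ F then X M.E else X ∅) * splitPoly M F := by
  obtain ⟨n, hn⟩ : ∃ n, rk M = n + 1 := ⟨rk M - 1, by omega⟩
  have hE : M.E.Nonempty := hM.rk_pos_iff.1 (by omega)
  refine ⟨hE.some, hE.some_mem, ?_⟩
  conv_lhs => rw [volPoly, hn]
  rw [volPolyAux, if_neg (by omega), if_neg (by omega)]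
  congr 1
  refine Finset.sum_congr rfl fun F hF => ?_
  have h1 := hM.rk_restrict_pos hF
  have h2 := hM.rk_contract_pos hF
  have h3 := hM.rk_add hF
  rw [volPolyAux_eq (hM.restrict (hM.ssubset hF).subset) n (by omega),
    volPolyAux_eq (hM.contract (hM.isFlat hF)) n (by omega), splitPoly]
  congr 2
  simp [hE]

/-- The defining properties of the volume polynomial: it is homogeneous of degree one less than the
rank, and its directional derivatives are combinations of products of volume polynomials. -/
structure VolPolySpec (M : Matroid α) : Prop where
  isHomogeneous : (volPoly M).IsHomogeneous (rk M - 1)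
  dirDeriv_eq : ∀ i ∈ M.E, ∀ w : Set α → ℝ, dirDeriv w (volPoly M) =
    ∑ F ∈ properFlats M, C (normalize M i w F) * splitPoly M F

theorem VolPolySpec.dirDeriv_congr (hs : VolPolySpec M) (hE : M.E.Nonempty) {w w' : Set α → ℝ}
    (h : ∀ F ∈ properFlats M, w F = w' F) (h0 : w ∅ = w' ∅) (h1 : w M.E = w' M.E) :
    dirDeriv w (volPoly M) = dirDeriv w' (volPoly M) := by
  obtain ⟨i, hi⟩ := hE
  rw [hs.dirDeriv_eq i hi, hs.dirDeriv_eq i hi]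
  refine Finset.sum_congr rfl fun F hF => ?_
  rw [normalize, normalize, h F hF, h0, h1]

theorem VolPolySpec.dirDeriv_eq_zero (hs : VolPolySpec M) {i : α} (hi : i ∈ M.E) {w : Set α → ℝ}
    (h : ∀ F ∈ properFlats M, normalize M i w F = 0) : dirDeriv w (volPoly M) = 0 := by
  rw [hs.dirDeriv_eq i hi]
  refine Finset.sum_eq_zero fun F hF => ?_
  rw [h F hF, C_0, zero_mul]

open Classical in
theorem normalize_single (hM : IsFinLoopless M) (i : α) (hG : G ∈ properFlats M) :
    normalize M i (Pi.single G 1) F = if F = G then 1 else 0 := by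
  obtain ⟨-, h1, h2⟩ := hM.mem_properFlats.1 hG
  rw [normalize, Pi.single_eq_of_ne' h2, Pi.single_eq_of_ne' h1]
  simp [Pi.single_apply]

open Classical in
theorem VolPolySpec.dirDeriv_single (hs : VolPolySpec M) (hM : IsFinLoopless M)
    (hG : G ∈ properFlats M) : dirDeriv (Pi.single G 1) (volPoly M) = splitPoly M G := by
  obtain ⟨i, hi⟩ := hM.nonempty hG
  rw [hs.dirDeriv_eq i ((hM.ssubset hG).subset hi)]
  simp_rw [normalize_single hM i hG]
  rw [Finset.sum_eq_single G]
  · simp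
  · intro F _ h; simp [h]
  · intro h; exact absurd hG h

open Classical in
-- The variables of the renamed contraction factor are sets containing `F`, and `G` is not one of
-- them.
theorem dirDeriv_single_splitPoly_of_not_superset (h : ¬ F ⊆ G) : dirDeriv (Pi.single G 1) (splitPoly M F) =
      dirDeriv (Pi.single G 1) (volPoly (M ↾ F)) * rename (· ∪ F) (volPoly (M ／ F)) := by
  have h1 : (Pi.single G 1 : Set α → ℝ) ∘ (· ∪ F) = 0 := by
    funext S
    refine Pi.single_eq_of_ne ?_ _
    rintro rfl
    exact h Set.subset_union_right
  rw [splitPoly, dirDeriv_mul, dirDeriv_rename, h1, dirDeriv_zero, map_zero, mul_zero, add_zero]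

section Step

variable (hM : IsFinLoopless M)
  (ih : ∀ N : Matroid α, IsFinLoopless N → 0 < rk N → rk N < rk M → VolPolySpec N)

include hM ih

theorem volPolySpec_restrict (hF : F ∈ properFlats M) : VolPolySpec (M ↾ F) := by
  have h1 := hM.rk_restrict_pos hF
  have h2 := hM.rk_contract_pos hF
  have h3 := hM.rk_add hF
  exact ih _ (hM.restrict (hM.ssubset hF).subset) h1 (by omega)

theorem volPolySpec_contract (hF : F ∈ properFlats M) : VolPolySpec (M ／ F) := by
  have h1 := hM.rk_restrict_pos hF
  have h2 := hM.rk_contract_pos hF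
  have h3 := hM.rk_add hF
  exact ih _ (hM.contract (hM.isFlat hF)) h2 (by omega)

theorem isHomogeneous_splitPoly (hF : F ∈ properFlats M) :
    (splitPoly M F).IsHomogeneous (rk M - 2) := by
  have h1 := hM.rk_restrict_pos hF
  have h2 := hM.rk_contract_pos hF
  have h3 := hM.rk_add hF
  have := (volPolySpec_restrict hM ih hF).isHomogeneous.mul
    ((volPolySpec_contract hM ih hF).isHomogeneous.rename_isHomogeneous (f := (· ∪ F)))
  rwa [show rk (M ↾ F) - 1 + (rk (M ／ F) - 1) = rk M - 2 by omega] at this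

/-- The hypothesis says that on flats `w` is a combination of `1` and `[i ∈ ·]`. This form survives
in both factors. In the one whose ground set misses `i` it is constant, so any other base element
`j` serves there. -/
theorem dirDeriv_splitPoly_eq_zero (hF : F ∈ properFlats M) {i : α} (hi : i ∈ M.E)
    {w : Set α → ℝ} (h : ∀ G ∈ properFlats M, normalize M i w G = 0) :
    dirDeriv w (splitPoly M F) = 0 := by
  have h1 : dirDeriv w (volPoly (M ↾ F)) = 0 := by
    by_cases hiF : i ∈ F
    · refine (volPolySpec_restrict hM ih hF).dirDeriv_eq_zero (i := i) hiF fun G hG => ?_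
      rw [hM.mem_properFlats_restrict (hM.isFlat hF) (hM.ssubset hF).ne] at hG
      have e1 := h G hG.1
      have e2 := h F hF
      simp only [normalize, if_pos hiF, restrict_ground_eq] at e1 e2 ⊢
      rw [sub_eq_zero.1 e2, e1]
    · obtain ⟨j, hj⟩ := hM.nonempty hF
      refine (volPolySpec_restrict hM ih hF).dirDeriv_eq_zero (i := j) hj fun G hG => ?_
      rw [hM.mem_properFlats_restrict (hM.isFlat hF) (hM.ssubset hF).ne] at hG
      have e1 := h G hG.1
      have e2 := h F hF
      have hiG : i ∉ G := fun h' => hiF (hG.2.subset h')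
      simp only [normalize, if_neg hiF, if_neg hiG, restrict_ground_eq] at e1 e2 ⊢
      rw [sub_eq_zero.1 e2, ite_self, e1]
  have h2 : dirDeriv (w ∘ (· ∪ F)) (volPoly (M ／ F)) = 0 := by
    have hE : (M.E \ F) ∪ F = M.E := Set.sdiff_union_of_subset (hM.ssubset hF).subset
    by_cases hiF : i ∈ F
    · obtain ⟨j, hj⟩ := Set.nonempty_of_ssubset (hM.ssubset hF)
      refine (volPolySpec_contract hM ih hF).dirDeriv_eq_zero (i := j) hj fun G hG => ?_
      rw [hM.mem_properFlats_contract hF] at hG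
      have e1 := h _ hG.2.2
      have e2 := h F hF
      simp only [normalize, if_pos hiF, contract_ground, Function.comp, hE, Set.empty_union] at e1 e2 ⊢
      rw [if_pos (show i ∈ G ∪ F from Or.inr hiF)] at e1
      rw [sub_eq_zero.1 e2, ite_self, e1]
    · refine (volPolySpec_contract hM ih hF).dirDeriv_eq_zero (i := i) ⟨hi, hiF⟩ fun G hG => ?_
      rw [hM.mem_properFlats_contract hF] at hG
      have e1 := h _ hG.2.2
      have e2 := h F hF
      have hiG : i ∈ G ∪ F ↔ i ∈ G := by simp [hiF]
      simp only [normalize, if_neg hiF, contract_ground, Function.comp, hE,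
        Set.empty_union] at e1 e2 ⊢
      rw [sub_eq_zero.1 e2]
      by_cases hG' : i ∈ G
      · rw [if_pos (hiG.2 hG')] at e1
        rw [if_pos hG', e1]
      · rw [if_neg (hiG.not.2 hG')] at e1
        rw [if_neg hG', e1]
  rw [splitPoly, dirDeriv_mul, dirDeriv_rename, h1, h2]
  simp

open Classical in
-- The difference of `w` and its normalized expansion in flat coordinates has zero normalization, so
-- it does not contribute.
theorem dirDeriv_splitPoly_eq_sum (hF : F ∈ properFlats M) {i : α} (hi : i ∈ M.E)
    (w : Set α → ℝ) :
    dirDeriv w (splitPoly M F) = ∑ G ∈ properFlats M,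
      C (normalize M i w G) * dirDeriv (Pi.single G 1) (splitPoly M F) := by
  have h := dirDeriv_splitPoly_eq_zero hM ih hF hi
    (w := w - ∑ G ∈ properFlats M, normalize M i w G • Pi.single G 1) ?_
  · rw [dirDeriv_sub, dirDeriv_sum, sub_eq_zero] at h
    rw [h]
    exact Finset.sum_congr rfl fun G _ => dirDeriv_smul _ _ _
  · intro G hG
    have hz : ∀ S : Set α, S = ∅ ∨ S = M.E →
        (∑ G ∈ properFlats M, normalize M i w G • (Pi.single G 1 : Set α → ℝ)) S = 0 := by
      intro S hS
      rw [Finset.sum_apply]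
      refine Finset.sum_eq_zero fun G' hG' => ?_
      obtain ⟨-, h1, h2⟩ := hM.mem_properFlats.1 hG'
      rw [Pi.smul_apply, Pi.single_eq_of_ne, smul_zero]
      rcases hS with rfl | rfl
      · exact h1.symm
      · exact h2.symm
    have hg : (∑ G ∈ properFlats M, normalize M i w G • (Pi.single G 1 : Set α → ℝ)) G =
        normalize M i w G := by
      rw [Finset.sum_apply, Finset.sum_eq_single G]
      · simp
      · intro b _ hb
        rw [Pi.smul_apply, Pi.single_eq_of_ne hb.symm, smul_zero]
      · intro h; exact absurd hG h
    rw [normalize, Pi.sub_apply, Pi.sub_apply, Pi.sub_apply, hz _ (Or.inl rfl),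
      hz _ (Or.inr rfl), hg, normalize]
    split_ifs <;> ring

open Classical in
-- The restriction factor only sees `w` at subsets of `F`, and `δ_G` vanishes on all of these.
theorem dirDeriv_single_splitPoly_of_not_subset (hF : F ∈ properFlats M) (hG : G ∈ properFlats M)
    (h : ¬ G ⊆ F) : dirDeriv (Pi.single G 1) (splitPoly M F) =
      volPoly (M ↾ F) *
        rename (· ∪ F) (dirDeriv (Pi.single G 1 ∘ (· ∪ F)) (volPoly (M ／ F))) := by
  obtain ⟨i, hi⟩ := hM.nonempty hF
  have h1 : dirDeriv (Pi.single G 1) (volPoly (M ↾ F)) = 0 := by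
    refine (volPolySpec_restrict hM ih hF).dirDeriv_eq_zero hi fun G' hG' => ?_
    have hG'F := ((hM.mem_properFlats_restrict (hM.isFlat hF) (hM.ssubset hF).ne).1 hG').2.subset
    have e1 : G' ≠ G := by rintro rfl; exact h hG'F
    have e2 : F ≠ G := by rintro rfl; exact h subset_rfl
    have e3 : ∅ ≠ G := (hM.nonempty hG).ne_empty.symm
    simp [normalize, Pi.single_eq_of_ne e1, Pi.single_eq_of_ne e2, Pi.single_eq_of_ne e3]
  rw [splitPoly, dirDeriv_mul, dirDeriv_rename, h1, zero_mul, zero_add]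

open Classical in
-- On sets disjoint from `F`, the pullback of `δ_G` along `S ↦ S ∪ F` is `δ_(G \ F)`; the
-- contraction depends on no other values.
theorem dirDeriv_single_contract (hF : F ∈ properFlats M) (hG : G ∈ properFlats M) (h : F ⊂ G) :
    dirDeriv (Pi.single G 1 ∘ (· ∪ F)) (volPoly (M ／ F)) = splitPoly (M ／ F) (G \ F) := by
  have hd := hM.sdiff_mem_properFlats_contract hF hG h
  have hs := volPolySpec_contract hM ih hF
  rw [← hs.dirDeriv_single (hM.contract (hM.isFlat hF)) hd]
  have key : ∀ S : Set α, Disjoint S F →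
      (Pi.single G 1 ∘ (· ∪ F) : Set α → ℝ) S = (Pi.single (G \ F) 1 : Set α → ℝ) S := by
    intro S hS
    have : S ∪ F = G ↔ S = G \ F := by
      constructor
      · rintro rfl; rw [Set.union_sdiff_right, hS.sdiff_eq_left]
      · rintro rfl; rw [Set.sdiff_union_of_subset h.subset]
    simp [Pi.single_apply, this]
  refine hs.dirDeriv_congr (Set.nonempty_of_ssubset (hM.ssubset hF)) (fun S hS => ?_)
    (key _ (Set.empty_disjoint F)) (key _ Set.disjoint_sdiff_left)
  exact key S ((hM.mem_properFlats_contract hF).1 hS).1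

open Classical in
-- Both sides are the product of the volume polynomials of the three intervals of the chain `∅ ⊂ G ⊂
-- F ⊂ E`; the middle minor is the same in either order of restriction and contraction.
theorem dirDeriv_single_splitPoly_comm_of_ssubset (hF : F ∈ properFlats M)
    (hG : G ∈ properFlats M) (h : G ⊂ F) : dirDeriv (Pi.single G 1) (splitPoly M F) =
      dirDeriv (Pi.single F 1) (splitPoly M G) := by
  have hGF : G ∈ properFlats (M ↾ F) :=
    (hM.mem_properFlats_restrict (hM.isFlat hF) (hM.ssubset hF).ne).2 ⟨hG, h⟩
  rw [dirDeriv_single_splitPoly_of_not_superset h.not_subset,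
    (volPolySpec_restrict hM ih hF).dirDeriv_single (hM.restrict (hM.ssubset hF).subset) hGF,
    dirDeriv_single_splitPoly_of_not_subset hM ih hG hF h.not_subset,
    dirDeriv_single_contract hM ih hG hF h, splitPoly, splitPoly, map_mul, rename_rename,
    M.restrict_restrict_eq h.subset, restrict_contract_eq_contract_restrict M h.subset,
    contract_contract, Set.union_sdiff_cancel h.subset]
  have : (fun S : Set α => S ∪ G) ∘ (fun S : Set α => S ∪ F \ G) = fun S => S ∪ F := by
    funext S
    simp only [Function.comp]
    rw [Set.union_assoc, Set.sdiff_union_of_subset h.subset]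
  rw [this]
  ring

open Classical in
theorem dirDeriv_single_splitPoly_of_incomparable (hF : F ∈ properFlats M)
    (hG : G ∈ properFlats M) (h : ¬ G ⊆ F) (h' : ¬ F ⊆ G) :
    dirDeriv (Pi.single G 1) (splitPoly M F) = 0 := by
  rw [dirDeriv_single_splitPoly_of_not_subset hM ih hF hG h]
  have h1 : (Pi.single G 1 : Set α → ℝ) ∘ (· ∪ F) = 0 := by
    funext S
    refine Pi.single_eq_of_ne ?_ _
    rintro rfl
    exact h' Set.subset_union_right
  rw [h1, dirDeriv_zero, map_zero, mul_zero]

open Classical in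
theorem dirDeriv_single_splitPoly_comm (hF : F ∈ properFlats M) (hG : G ∈ properFlats M) :
    dirDeriv (Pi.single G 1) (splitPoly M F) = dirDeriv (Pi.single F 1) (splitPoly M G) := by
  by_cases h : G ⊆ F
  · rcases eq_or_ssubset_of_subset h with rfl | h
    · rfl
    · exact dirDeriv_single_splitPoly_comm_of_ssubset hM ih hF hG h
  by_cases h' : F ⊆ G
  · exact (dirDeriv_single_splitPoly_comm_of_ssubset hM ih hG hF
      (h'.ssubset_of_ne (by rintro rfl; exact h subset_rfl))).symm
  · rw [dirDeriv_single_splitPoly_of_incomparable hM ih hF hG h h',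
      dirDeriv_single_splitPoly_of_incomparable hM ih hG hF h' h]

open Classical in
-- On flats, the sum of `δ_F` over `F ∋ i` plus `δ_E` is the modular function `[i ∈ ·]`, whose
-- derivative is zero. The point is that the right side is free of `i`.
theorem sum_dirDeriv_single_splitPoly (hG : G ∈ properFlats M) {i : α} (hi : i ∈ M.E) :
    ∑ F ∈ properFlats M with i ∈ F, dirDeriv (Pi.single F 1) (splitPoly M G) =
      -dirDeriv (Pi.single M.E 1) (splitPoly M G) := by
  have h := dirDeriv_splitPoly_eq_zero hM ih hG hi
    (w := ∑ F ∈ properFlats M with i ∈ F, Pi.single F 1 + Pi.single M.E 1) ?_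
  · rw [dirDeriv_add, dirDeriv_sum] at h
    exact eq_neg_of_add_eq_zero_left h
  · intro F hF
    have e1 : ∀ S : Set α, (∑ F ∈ properFlats M with i ∈ F, (Pi.single F 1 : Set α → ℝ)) S =
        if S ∈ properFlats M ∧ i ∈ S then 1 else 0 := by
      intro S
      rw [Finset.sum_apply]
      simp [Pi.single_apply, Finset.sum_ite_eq]
    have e2 : (∅ : Set α) ∉ properFlats M := fun h => (hM.mem_properFlats.1 h).2.1 rfl
    have e3 : M.E ∉ properFlats M := fun h => (hM.mem_properFlats.1 h).2.2 rfl
    have e4 : ∅ ≠ M.E := (Set.nonempty_of_mem hi).ne_empty.symm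
    simp only [normalize, Pi.add_apply, e1, e2, e3, hF, Pi.single_eq_same,
      Pi.single_eq_of_ne e4, Pi.single_eq_of_ne (hM.ssubset hF).ne]
    by_cases h : i ∈ F <;> simp [h]

open Classical in
-- This is what makes the recursion independent of the chosen element. In rank two each sum is a
-- single term equal to `1`. In higher rank symmetry of the mixed derivatives and
-- `sum_dirDeriv_single_splitPoly` show that the two sums have equal derivatives in every direction,
-- and Euler's identity in positive degree gives equality.
theorem sum_splitPoly_eq (hr : 2 ≤ rk M) {i j : α} (hi : i ∈ M.E) (hj : j ∈ M.E) :
    ∑ F ∈ properFlats M with i ∈ F, splitPoly M F =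
      ∑ F ∈ properFlats M with j ∈ F, splitPoly M F := by
  rcases hr.eq_or_lt with hr | hr
  · have key : ∀ i ∈ M.E, ∑ F ∈ properFlats M with i ∈ F, splitPoly M F = 1 := by
      intro i hi
      have hc := hM.closure_singleton_mem_properFlats hi (by omega)
      have h1 := hM.rk_restrict_pos hc
      have h2 := hM.rk_contract_pos hc
      have h3 := hM.rk_add hc
      rw [hM.filter_mem_properFlats hr.symm hi, Finset.sum_singleton, splitPoly,
        volPoly_rank_one (by omega), volPoly_rank_one (by omega), map_one, mul_one]
    rw [key i hi, key j hj]
  · rw [← sub_eq_zero]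
    set p := ∑ F ∈ properFlats M with i ∈ F, splitPoly M F -
      ∑ F ∈ properFlats M with j ∈ F, splitPoly M F with hp
    have hhom : p.IsHomogeneous (rk M - 2) := by
      refine IsHomogeneous.sub (IsHomogeneous.sum _ _ _ fun F hF => ?_)
        (IsHomogeneous.sum _ _ _ fun F hF => ?_)
      all_goals exact isHomogeneous_splitPoly hM ih (Finset.mem_filter.1 hF).1
    have hsum : ∀ k ∈ M.E, ∀ c : Set α → ℝ,
        dirDeriv c (∑ F ∈ properFlats M with k ∈ F, splitPoly M F) =
        ∑ G ∈ properFlats M, C (normalize M i c G) *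
          -dirDeriv (Pi.single M.E 1) (splitPoly M G) := by
      intro k hk c
      rw [map_sum, Finset.sum_congr rfl fun F hF =>
        dirDeriv_splitPoly_eq_sum hM ih (Finset.mem_filter.1 hF).1 hi c, Finset.sum_comm]
      refine Finset.sum_congr rfl fun G hG => ?_
      rw [← sum_dirDeriv_single_splitPoly hM ih hG hk, Finset.mul_sum]
      refine Finset.sum_congr rfl fun F hF => ?_
      rw [dirDeriv_single_splitPoly_comm hM ih (Finset.mem_filter.1 hF).1 hG]
    refine MvPolynomial.funext fun c => ?_
    have h1 := eval_dirDeriv_self hhom c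
    rw [hp, map_sub, hsum i hi, hsum j hj, sub_self, map_zero, ← hp] at h1
    have h2 : ((rk M - 2 : ℕ) : ℝ) ≠ 0 := by
      rw [Nat.cast_ne_zero]; omega
    rw [map_zero]
    exact (mul_eq_zero.1 h1.symm).resolve_left h2

/-- The products `S_F` are integrated to a potential by Euler's formula. The product rule gives `1`
copy of the wanted sum from the linear factors and `rk M - 2` copies from the `S_F`; the factor `(rk
M - 1)⁻¹` cancels the total. -/
theorem volPolySpec_of_two_le (hr : 2 ≤ rk M) : VolPolySpec M := by
  classical
  obtain ⟨b, hb, hP⟩ := exists_volPoly_eq hM hr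
  have hd : ((rk M : ℝ) - 1) ≠ 0 := by
    have : (2 : ℝ) ≤ rk M := by exact_mod_cast hr
    linarith
  constructor
  · rw [hP]
    have : (∑ F ∈ properFlats M, (X F - if b ∈ F then X M.E else X ∅) *
        splitPoly M F).IsHomogeneous (1 + (rk M - 2)) := by
      refine IsHomogeneous.sum _ _ _ fun F hF => IsHomogeneous.mul ?_
        (isHomogeneous_splitPoly hM ih hF)
      refine IsHomogeneous.sub (isHomogeneous_X _ _) ?_
      split_ifs <;> exact isHomogeneous_X _ _
    have h2 := (isHomogeneous_C (Set α) ((rk M - 1 : ℝ)⁻¹)).mul this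
    rwa [show 0 + (1 + (rk M - 2)) = rk M - 1 by omega] at h2
  · have hbase : ∀ w : Set α → ℝ, dirDeriv w (volPoly M) =
        ∑ F ∈ properFlats M, C (normalize M b w F) * splitPoly M F := by
      intro w
      have hN : ∀ (w : Set α → ℝ) (F : Set α),
          dirDeriv w (X F - if b ∈ F then X M.E else X ∅) = C (normalize M b w F) := by
        intro w F
        rw [normalize]
        split_ifs <;> simp
      -- Expanding `dirDeriv w` in flat coordinates and exchanging the mixed derivatives turns the
      -- sum over `F` into a radial derivative of each `splitPoly M G`, to which Euler's identity in
      -- degree `rk M - 2` applies.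
      have key : ∑ F ∈ properFlats M, (X F - if b ∈ F then X M.E else X ∅) *
          dirDeriv w (splitPoly M F) = C ((rk M : ℝ) - 2) *
            ∑ F ∈ properFlats M, C (normalize M b w F) * splitPoly M F := by
        refine MvPolynomial.funext fun c => ?_
        have hNc : ∀ F : Set α, eval c (X F - if b ∈ F then X M.E else X ∅) =
            normalize M b c F := by
          intro F
          rw [normalize]
          split_ifs <;> simp
        simp only [map_sum, map_mul, hNc, eval_C]
        calc ∑ F ∈ properFlats M, normalize M b c F * eval c (dirDeriv w (splitPoly M F))
            = ∑ F ∈ properFlats M, ∑ G ∈ properFlats M, normalize M b w G *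
                (normalize M b c F * eval c (dirDeriv (Pi.single F 1) (splitPoly M G))) := by
              refine Finset.sum_congr rfl fun F hF => ?_
              rw [dirDeriv_splitPoly_eq_sum hM ih hF hb w, map_sum, Finset.mul_sum]
              refine Finset.sum_congr rfl fun G hG => ?_
              rw [dirDeriv_single_splitPoly_comm hM ih hF hG, map_mul, eval_C]
              ring
          _ = ∑ G ∈ properFlats M, normalize M b w G * eval c (dirDeriv c (splitPoly M G)) := by
              rw [Finset.sum_comm]
              refine Finset.sum_congr rfl fun G hG => ?_
              rw [dirDeriv_splitPoly_eq_sum hM ih hG hb c, map_sum, Finset.mul_sum]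
              refine Finset.sum_congr rfl fun F hF => ?_
              rw [map_mul, eval_C]
          _ = _ := by
              rw [Finset.mul_sum]
              refine Finset.sum_congr rfl fun G hG => ?_
              rw [eval_dirDeriv_self (isHomogeneous_splitPoly hM ih hG), Nat.cast_sub hr]
              push_cast
              ring
      rw [hP, dirDeriv_C_mul, map_sum]
      simp only [dirDeriv_mul, hN]
      rw [Finset.sum_add_distrib, key, ← one_add_mul, ← mul_assoc, ← C_1, ← C_add, ← C_mul,
        show (rk M - 1 : ℝ)⁻¹ * (1 + (rk M - 2)) = 1 by field_simp; ring, C_1, one_mul]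
    intro i hi w
    rw [hbase w]
    -- Replacing the base element `b` by `i` changes the sum by a multiple of the difference of two
    -- sums over flats through a point, which is zero.
    have hT := sum_splitPoly_eq hM ih hr hi hb
    rw [Finset.sum_filter, Finset.sum_filter] at hT
    rw [← sub_eq_zero, ← Finset.sum_sub_distrib]
    have : ∀ F ∈ properFlats M, C (normalize M b w F) * splitPoly M F -
        C (normalize M i w F) * splitPoly M F =
        C (w M.E - w ∅) * ((if i ∈ F then splitPoly M F else 0) -
          if b ∈ F then splitPoly M F else 0) := by
      intro F _
      rw [← sub_mul, ← C_sub, normalize, normalize]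
      split_ifs <;> simp
      ring
    rw [Finset.sum_congr rfl this, ← Finset.mul_sum, Finset.sum_sub_distrib, hT, sub_self,
      mul_zero]

end Step

theorem volPolySpec (M : Matroid α) (hM : IsFinLoopless M) (hr : 0 < rk M) : VolPolySpec M := by
  obtain ⟨n, hn⟩ : ∃ n, rk M = n := ⟨_, rfl⟩
  induction n using Nat.strong_induction_on generalizing M with
  | _ n ih =>
  by_cases h : 2 ≤ rk M
  · exact volPolySpec_of_two_le hM (fun N hN h1 h2 => ih _ (hn ▸ h2) N hN h1 rfl) h
  · have h1 : rk M = 1 := by omega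
    constructor
    · rw [volPoly_rank_one h1, h1]
      exact isHomogeneous_one _ _
    · intro i _ w
      rw [volPoly_rank_one h1, hM.properFlats_eq_empty h1.le, Finset.sum_empty, ← C_1,
        dirDeriv_C]

end VolumePolynomial

/-! ### The defining recursion holds, and `vol` is the constructed polynomial -/

section Existence

open MvPolynomial

variable {M : Matroid α} {F G : Set α}

theorem VolPolySpec.eval_congr (hs : VolPolySpec M) {i : α} (hi : i ∈ M.E) {c c' : Set α → ℝ}
    (h : ∀ F ∈ properFlats M, normalize M i c F = normalize M i c' F) :
    eval c (volPoly M) = eval c' (volPoly M) := by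
  have hd : dirDeriv (c - c') (volPoly M) = 0 := by
    refine hs.dirDeriv_eq_zero hi fun F hF => ?_
    have h1 := h F hF
    unfold normalize at h1 ⊢
    simp only [Pi.sub_apply]
    split_ifs at h1 ⊢ <;> linarith
  simpa using eval_add_eq_of_dirDeriv_eq_zero hd c'

open Classical in
/-- The extension by zero of a function on proper flats to all sets. -/
def extendZero (M : Matroid α) : (ProperFlat M → ℝ) →ₗ[ℝ] (Set α → ℝ) where
  toFun t S := if h : M.IsFlat S ∧ S ≠ M.loops ∧ S ≠ M.E then t ⟨S, h⟩ else 0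
  map_add' s t := by
    funext S
    simp only [Pi.add_apply]
    split_ifs <;> simp
  map_smul' r t := by
    funext S
    simp only [Pi.smul_apply, RingHom.id_apply]
    split_ifs <;> simp

theorem extendZero_apply (t : ProperFlat M → ℝ) (F : ProperFlat M) : extendZero M t F.1 = t F :=
  dif_pos F.2

theorem extendZero_of_not (t : ProperFlat M → ℝ) {S : Set α}
    (h : ¬ (M.IsFlat S ∧ S ≠ M.loops ∧ S ≠ M.E)) : extendZero M t S = 0 :=
  dif_neg h

theorem extendZero_ground (t : ProperFlat M → ℝ) : extendZero M t M.E = 0 :=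
  extendZero_of_not t fun h => h.2.2 rfl

theorem IsFinLoopless.mem_properFlats' (hM : IsFinLoopless M) :
    F ∈ properFlats M ↔ M.IsFlat F ∧ F ≠ M.loops ∧ F ≠ M.E := by
  have := hM.loopless
  rw [hM.mem_properFlats, M.loops_eq_empty]

theorem extendZero_empty (hM : IsFinLoopless M) (t : ProperFlat M → ℝ) :
    extendZero M t ∅ = 0 := by
  have := hM.loopless
  exact extendZero_of_not t fun h => h.2.1 M.loops_eq_empty.symm

open Classical in
theorem extendZero_delta (F : ProperFlat M) : extendZero M (delta M F.1) = Pi.single F.1 1 := by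
  funext S
  by_cases h : M.IsFlat S ∧ S ≠ M.loops ∧ S ≠ M.E
  · rw [extendZero_apply _ ⟨S, h⟩, delta, Pi.single_apply]
  · rw [extendZero_of_not _ h, Pi.single_eq_of_ne]
    rintro rfl
    exact h F.2

/-- On flats `α_i + δ_E` is the modular function `[i ∈ ·]`, so `α_i` acts as `-δ_E`, whatever `i`
is. Therefore `W_M` acts trivially. -/
theorem VolPolySpec.dirDeriv_extendZero_alphaVec (hs : VolPolySpec M) (hM : IsFinLoopless M)
    {i : α} (hi : i ∈ M.E) : ∃ w : Set α → ℝ, (∀ F ∈ properFlats M, w F = 0) ∧ w ∅ = 0 ∧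
      w M.E = 1 ∧ dirDeriv (extendZero M (alphaVec M i)) (volPoly M) =
        -dirDeriv w (volPoly M) := by
  classical
  refine ⟨Pi.single M.E 1, fun F hF => Pi.single_eq_of_ne (hM.ssubset hF).ne _,
    Pi.single_eq_of_ne (Set.nonempty_of_mem hi).ne_empty.symm _, Pi.single_eq_same _ _, ?_⟩
  rw [eq_neg_iff_add_eq_zero, ← dirDeriv_add]
  refine hs.dirDeriv_eq_zero hi fun F hF => ?_
  simp only [normalize, Pi.add_apply, extendZero_ground, extendZero_empty hM,
    Pi.single_eq_of_ne (hM.ssubset hF).ne, Pi.single_eq_same,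
    Pi.single_eq_of_ne (Set.nonempty_of_mem hi).ne_empty.symm,
    extendZero_apply _ ⟨F, hM.mem_properFlats'.1 hF⟩, alphaVec]
  split_ifs <;> simp

theorem VolPolySpec.dirDeriv_extendZero_of_mem_W (hs : VolPolySpec M) (hM : IsFinLoopless M)
    {w : ProperFlat M → ℝ} (hw : w ∈ W M) : dirDeriv (extendZero M w) (volPoly M) = 0 := by
  induction hw using Submodule.span_induction with
  | mem x hx =>
    obtain ⟨i, hi, j, hj, rfl⟩ := hx
    obtain ⟨v, hv, hv0, hv1, e⟩ := hs.dirDeriv_extendZero_alphaVec hM hi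
    obtain ⟨v', hv', hv0', hv1', e'⟩ := hs.dirDeriv_extendZero_alphaVec hM hj
    rw [map_sub, dirDeriv_sub, e, e', hs.dirDeriv_congr ⟨i, hi⟩ (w := v) (w' := v')
      (fun F hF => by rw [hv F hF, hv' F hF]) (by rw [hv0, hv0']) (by rw [hv1, hv1']), sub_self]
  | zero => rw [map_zero, dirDeriv_zero]
  | add x y _ _ hx hy => rw [map_add, dirDeriv_add, hx, hy, add_zero]
  | smul r x _ hx => rw [map_smul, dirDeriv_smul, hx, mul_zero]

/-- The volume function given by the volume polynomial. -/
def volOfPoly (M : Matroid α) (x : L M) : ℝ :=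
  eval (extendZero M (Function.surjInv (W M).mkQ_surjective x)) (volPoly M)

theorem volOfPoly_proj (hM : IsFinLoopless M) (t : ProperFlat M → ℝ) :
    volOfPoly M (proj M t) = eval (extendZero M t) (volPoly M) := by
  by_cases hr : rk M = 0
  · rw [volOfPoly, volPoly_rank_zero hr, map_zero, map_zero]
  · have hs := volPolySpec M hM (Nat.pos_of_ne_zero hr)
    rw [volOfPoly]
    set s := Function.surjInv (W M).mkQ_surjective (proj M t) with hsdef
    have h1 : s - t ∈ W M := by
      have : (W M).mkQ s = (W M).mkQ t := Function.surjInv_eq _ _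
      rwa [Submodule.mkQ_apply, Submodule.mkQ_apply, Submodule.Quotient.eq] at this
    have h2 := eval_add_eq_of_dirDeriv_eq_zero (hs.dirDeriv_extendZero_of_mem_W hM h1)
      (extendZero M t)
    rwa [← map_add, add_sub_cancel] at h2

theorem volOfPoly_proj_normalize (hM : IsFinLoopless M) {i : α} (hi : i ∈ M.E) (c : Set α → ℝ) :
    volOfPoly M (proj M fun F => normalize M i c F.1) = eval c (volPoly M) := by
  rw [volOfPoly_proj hM]
  have hs := volPolySpec M hM (hM.rk_pos_iff.2 ⟨i, hi⟩)
  refine hs.eval_congr hi fun F hF => ?_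
  rw [normalize, extendZero_ground, extendZero_empty hM, ite_self, sub_zero,
    extendZero_apply _ ⟨F, hM.mem_properFlats'.1 hF⟩]

/-- The rule `δ_F ↦ -α` is exactly normalization in the restriction: `t_F`, the value at the top, is
removed by subtracting `t_F [i ∈ ·]`. -/
theorem piUpper_eq (hM : IsFinLoopless M) [M.Finite] (F : ProperFlat M) {i : α} (hi : i ∈ F.1)
    (t : ProperFlat M → ℝ) : piUpper M F.1 t =
      proj (M ↾ F.1) fun G => normalize (M ↾ F.1) i (extendZero M t) G.1 := by
  classical
  have hF := hM.mem_properFlats'.2 F.2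
  have key : ∀ G : ProperFlat M, (t G • if G.1 ⊂ F.1 then proj (M ↾ F.1) (delta (M ↾ F.1) G.1)
      else if G.1 = F.1 then -alphaClass (M ↾ F.1) else 0) = proj (M ↾ F.1)
      (t G • if G.1 ⊂ F.1 then delta (M ↾ F.1) G.1
        else if G.1 = F.1 then -alphaVec (M ↾ F.1) i else 0) := by
    intro G
    rw [map_smul, apply_ite (proj (M ↾ F.1)), apply_ite (proj (M ↾ F.1)), map_neg, map_zero,
      proj_alphaVec (M ↾ F.1) (i := i) hi]
  rw [piUpper]
  rw [Finset.sum_congr rfl fun G _ => key G, ← map_sum]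
  congr 1
  funext H
  have hH := (hM.mem_properFlats_restrict (hM.isFlat hF) (hM.ssubset hF).ne).1
    ((hM.restrict (hM.ssubset hF).subset).mem_properFlats'.2 H.2)
  have hE : extendZero M t (M ↾ F.1).E = t F := extendZero_apply t F
  rw [normalize, hE, extendZero_empty hM,
    extendZero_apply t ⟨H.1, hM.mem_properFlats'.1 hH.1⟩, Finset.sum_apply]
  have hne : (⟨H.1, hM.mem_properFlats'.1 hH.1⟩ : ProperFlat M) ≠ F := by
    intro h
    exact hH.2.ne (congrArg Subtype.val h)
  rw [← Finset.sum_subset (Finset.subset_univ {⟨H.1, hM.mem_properFlats'.1 hH.1⟩, F}),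
    Finset.sum_pair hne]
  · simp only [Pi.smul_apply, smul_eq_mul, hH.2, if_true, ssubset_irrefl, if_false, delta,
      Pi.neg_apply, alphaVec]
    split_ifs <;> simp [sub_eq_add_neg]
  · intro G _ hG
    rw [Finset.mem_insert, Finset.mem_singleton, not_or] at hG
    have h1 : G.1 ≠ F.1 := fun h => hG.2 (Subtype.ext h)
    have h2 : H.1 ≠ G.1 := fun h => hG.1 (Subtype.ext h.symm)
    rw [if_neg h1, Pi.smul_apply]
    split_ifs
    · rw [delta, if_neg h2, smul_zero]
    · simp

/-- Dually, `t_F` is the value at `∅` after the shift `S ↦ S ∪ F`, and `δ_F ↦ -β` subtracts `t_F [i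
∉ ·]`. -/
theorem piLower_eq (hM : IsFinLoopless M) [M.Finite] (F : ProperFlat M) {i : α}
    (hi : i ∈ M.E \ F.1) (t : ProperFlat M → ℝ) : piLower M F.1 t =
      proj (M ／ F.1) fun G => normalize (M ／ F.1) i (extendZero M t ∘ (· ∪ F.1)) G.1 := by
  classical
  have hF := hM.mem_properFlats'.2 F.2
  have key : ∀ G : ProperFlat M,
      (t G • if F.1 ⊂ G.1 then proj (M ／ F.1) (delta (M ／ F.1) (G.1 \ F.1))
      else if G.1 = F.1 then -betaClass (M ／ F.1) else 0) = proj (M ／ F.1)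
      (t G • if F.1 ⊂ G.1 then delta (M ／ F.1) (G.1 \ F.1)
        else if G.1 = F.1 then -betaVec (M ／ F.1) i else 0) := by
    intro G
    rw [map_smul, apply_ite (proj (M ／ F.1)), apply_ite (proj (M ／ F.1)), map_neg, map_zero,
      proj_betaVec (M ／ F.1) (i := i) hi]
  rw [piLower]
  rw [Finset.sum_congr rfl fun G _ => key G, ← map_sum]
  congr 1
  funext H
  have hH := (hM.mem_properFlats_contract hF).1
    ((hM.contract (hM.isFlat hF)).mem_properFlats'.2 H.2)
  have hss : F.1 ⊂ H.1 ∪ F.1 := by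
    refine Set.ssubset_iff_subset_ne.2 ⟨Set.subset_union_right, fun h => hH.2.1 ?_⟩
    exact (Set.disjoint_of_subset_iff_left_eq_empty (Set.union_eq_right.1 h.symm)).1 hH.1
  have e1 : (extendZero M t ∘ (· ∪ F.1)) (M ／ F.1).E = 0 := by
    show extendZero M t ((M.E \ F.1) ∪ F.1) = 0
    rw [Set.sdiff_union_of_subset (hM.ssubset hF).subset, extendZero_ground]
  have e2 : (extendZero M t ∘ (· ∪ F.1)) ∅ = t F := by
    show extendZero M t (∅ ∪ F.1) = t F
    rw [Set.empty_union, extendZero_apply]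
  have e3 : (extendZero M t ∘ (· ∪ F.1)) H.1 = t ⟨H.1 ∪ F.1, hM.mem_properFlats'.1 hH.2.2⟩ :=
    extendZero_apply t ⟨H.1 ∪ F.1, hM.mem_properFlats'.1 hH.2.2⟩
  rw [normalize, e1, e2, e3, Finset.sum_apply]
  have hne : (⟨H.1 ∪ F.1, hM.mem_properFlats'.1 hH.2.2⟩ : ProperFlat M) ≠ F := by
    intro h
    exact hss.ne (congrArg Subtype.val h).symm
  have hd : (H.1 ∪ F.1) \ F.1 = H.1 := by rw [Set.union_sdiff_right, hH.1.sdiff_eq_left]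
  rw [← Finset.sum_subset (Finset.subset_univ {⟨H.1 ∪ F.1, hM.mem_properFlats'.1 hH.2.2⟩, F}),
    Finset.sum_pair hne]
  · simp only [Pi.smul_apply, smul_eq_mul, hss, if_true, ssubset_irrefl, if_false, delta,
      Pi.neg_apply, betaVec, hd]
    split_ifs <;> simp [sub_eq_add_neg]
  · intro G _ hG
    rw [Finset.mem_insert, Finset.mem_singleton, not_or] at hG
    have h1 : G.1 ≠ F.1 := fun h => hG.2 (Subtype.ext h)
    rw [if_neg h1, Pi.smul_apply]
    split_ifs with h3
    · have h2 : H.1 ≠ G.1 \ F.1 := fun h => hG.1 (Subtype.ext (by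
        show G.1 = H.1 ∪ F.1
        rw [h, Set.sdiff_union_of_subset h3.subset]))
      rw [delta, if_neg h2, smul_zero]
    · simp

theorem isVolumeFamily_volOfPoly : IsVolumeFamily (volOfPoly (α := α)) where
  rank_zero M _ _ h x := by rw [volOfPoly, volPoly_rank_zero h, map_zero]
  rank_one M _ _ h x := by rw [volOfPoly, volPoly_rank_one h, map_one]
  map_zero M _ _ h := by
    have hM : IsFinLoopless M := ⟨inferInstance, inferInstance⟩
    have h1 := volOfPoly_proj hM 0
    rw [map_zero, map_zero] at h1
    rw [h1]
    have h2 := eval_dirDeriv_self (volPolySpec M hM (by omega)).isHomogeneous 0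
    rw [dirDeriv_zero, map_zero] at h2
    have h3 : ((rk M - 1 : ℕ) : ℝ) ≠ 0 := by rw [Nat.cast_ne_zero]; omega
    exact (mul_eq_zero.1 h2.symm).resolve_left h3
  hasLineDerivAt M _ _ F t := by
    classical
    have hM : IsFinLoopless M := ⟨inferInstance, inferInstance⟩
    have hF := hM.mem_properFlats'.2 F.2
    obtain ⟨i, hi⟩ := hM.nonempty hF
    obtain ⟨j, hj⟩ := Set.nonempty_of_ssubset (hM.ssubset hF)
    have hs := volPolySpec M hM (hM.rk_pos_iff.2 ⟨i, (hM.ssubset hF).subset hi⟩)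
    rw [piUpper_eq hM F hi, piLower_eq hM F hj,
      volOfPoly_proj_normalize (hM.restrict (hM.ssubset hF).subset) hi,
      volOfPoly_proj_normalize (hM.contract (hM.isFlat hF)) hj]
    have h := hasDerivAt_eval (extendZero M t) (Pi.single F.1 1) (volPoly M) 0
    rw [hs.dirDeriv_single hM hF, splitPoly, zero_smul, add_zero, map_mul, eval_rename] at h
    refine h.congr_of_eventuallyEq (Filter.Eventually.of_forall fun r => ?_)
    simp only
    rw [volOfPoly_proj hM, map_add, map_smul, extendZero_delta]

theorem volFun_eq (hM : IsFinLoopless M) (t : ProperFlat M → ℝ) :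
    volFun M t = eval (extendZero M t) (volPoly M) := by
  have hex : ∃ V : ∀ M : Matroid α, L M → ℝ, IsVolumeFamily V := ⟨_, isVolumeFamily_volOfPoly⟩
  have := hM.finite
  have := hM.loopless
  have h1 : IsVolumeFamily (vol (α := α)) := by
    rw [vol, dif_pos hex]
    exact hex.choose_spec
  rw [volFun, h1.unique isVolumeFamily_volOfPoly M, volOfPoly_proj hM]

end Existence

/-! ### Quadratic forms with at most one positive direction -/

section LinearAlgebra

open Matrix

/-- A bilinear form whose quadratic form is nonpositive on the kernel of a linear functional. -/
def HasNonposKernel {V : Type*} [AddCommGroup V] [Module ℝ V] (A : V →ₗ[ℝ] V →ₗ[ℝ] ℝ) : Prop :=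
  ∃ s : V →ₗ[ℝ] ℝ, ∀ z, s z = 0 → A z z ≤ 0

/-- Reversed Cauchy–Schwarz: the form is nonpositive at `s(v) x - s(x) v`, which lies in the kernel
of `s`; expanding and completing the square gives the bound. -/
theorem HasNonposKernel.mul_le_sq {V : Type*} [AddCommGroup V] [Module ℝ V]
    {A : V →ₗ[ℝ] V →ₗ[ℝ] ℝ} (h : HasNonposKernel A) (hA : ∀ x y, A x y = A y x) {v : V}
    (hv : 0 < A v v) (x : V) : A x x * A v v ≤ A x v ^ 2 := by
  obtain ⟨s, hs⟩ := h
  have hsv : s v ≠ 0 := fun h => (hs v h).not_gt hv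
  have h1 := hs (s v • x - s x • v) (by simp [mul_comm])
  simp only [map_sub, map_smul, LinearMap.sub_apply, LinearMap.smul_apply, smul_eq_mul,
    hA v x] at h1
  have h2 : 0 < s v ^ 2 := by positivity
  have h3 : (s x * A v v - s v * A x v) ^ 2 ≤ s v ^ 2 * (A x v ^ 2 - A x x * A v v) := by
    nlinarith
  have h4 : 0 ≤ s v ^ 2 * (A x v ^ 2 - A x x * A v v) := (sq_nonneg _).trans h3
  have := nonneg_of_mul_nonneg_right h4 h2
  linarith

variable {σ : Type*} [Fintype σ]

theorem exists_orthonormal_eigenvectors [DecidableEq σ] {A : Matrix σ σ ℝ} (hA : A.IsHermitian) :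
    ∃ e : σ → σ → ℝ, (∀ i j, e i ⬝ᵥ e j = if i = j then 1 else 0) ∧
      (∀ i, A *ᵥ e i = hA.eigenvalues i • e i) ∧ ∀ y : σ → ℝ, y = ∑ i, (e i ⬝ᵥ y) • e i := by
  refine ⟨fun i => ⇑(hA.eigenvectorBasis i), fun i j => ?_, hA.mulVec_eigenvectorBasis,
    fun y => ?_⟩
  · have h := orthonormal_iff_ite.1 hA.eigenvectorBasis.orthonormal i j
    rw [EuclideanSpace.inner_eq_star_dotProduct] at h
    rw [← h, dotProduct_comm]
    simp
  · have h := hA.eigenvectorBasis.sum_repr' (WithLp.toLp 2 y)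
    have h' := congrArg WithLp.ofLp h
    simp only [WithLp.ofLp_sum, WithLp.ofLp_smul, EuclideanSpace.inner_eq_star_dotProduct] at h'
    conv_lhs => rw [← h']
    refine Finset.sum_congr rfl fun i _ => ?_
    rw [dotProduct_comm]
    simp

theorem quadratic_eq_sum {A : Matrix σ σ ℝ} {e : σ → σ → ℝ} {μ : σ → ℝ}
    (h1 : ∀ i, A *ᵥ e i = μ i • e i) (h2 : ∀ y : σ → ℝ, y = ∑ i, (e i ⬝ᵥ y) • e i)
    (y : σ → ℝ) : y ⬝ᵥ A *ᵥ y = ∑ i, μ i * (e i ⬝ᵥ y) ^ 2 := by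
  have h : A *ᵥ y = ∑ i, (e i ⬝ᵥ y) • μ i • e i := by
    conv_lhs => rw [h2 y, ← mulVecLin_apply, map_sum]
    refine Finset.sum_congr rfl fun i _ => ?_
    rw [map_smul, mulVecLin_apply, h1]
  rw [h, dotProduct_sum]
  refine Finset.sum_congr rfl fun i _ => ?_
  rw [dotProduct_smul, dotProduct_smul, dotProduct_comm y]
  simp only [smul_eq_mul]
  ring

/-- Two eigenvectors with positive eigenvalues would span a positive definite plane, which must meet
the hyperplane `s = 0`. -/
theorem existsUnique_pos_eigenvalue [DecidableEq σ] {A : Matrix σ σ ℝ} (hA : A.IsHermitian)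
    {v : σ → ℝ} (hv : 0 < v ⬝ᵥ A *ᵥ v) (s : (σ → ℝ) →ₗ[ℝ] ℝ)
    (hs : ∀ z, s z = 0 → z ⬝ᵥ A *ᵥ z ≤ 0) : ∃! i, 0 < hA.eigenvalues i := by
  obtain ⟨e, he, hAe, hsum⟩ := exists_orthonormal_eigenvectors hA
  have hq := quadratic_eq_sum hAe hsum
  have hex : ∃ i, 0 < hA.eigenvalues i := by
    by_contra! h
    rw [hq v] at hv
    exact hv.not_ge (Finset.sum_nonpos fun i _ =>
      mul_nonpos_of_nonpos_of_nonneg (h i) (sq_nonneg _))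
  obtain ⟨i, hi⟩ := hex
  refine ⟨i, hi, fun j hj => ?_⟩
  by_contra hne
  have hne' : i ≠ j := fun h => hne h.symm
  obtain ⟨a, b, hab, h0⟩ : ∃ a b : ℝ, (a ≠ 0 ∨ b ≠ 0) ∧ s (a • e i + b • e j) = 0 := by
    by_cases h : s (e i) = 0
    · exact ⟨1, 0, Or.inl one_ne_zero, by simp [h]⟩
    · exact ⟨s (e j), -s (e i), Or.inr (neg_ne_zero.2 h), by simp [mul_comm]⟩
  have h1 := hs _ h0
  have h2 : (a • e i + b • e j) ⬝ᵥ A *ᵥ (a • e i + b • e j) =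
      hA.eigenvalues i * a ^ 2 + hA.eigenvalues j * b ^ 2 := by
    rw [mulVec_add, mulVec_smul, mulVec_smul, hAe, hAe]
    simp only [dotProduct_add, add_dotProduct, smul_dotProduct, dotProduct_smul, he, hne, hne',
      if_true, if_false, smul_eq_mul]
    ring
  rw [h2] at h1
  rcases hab with ha | hb
  · have : 0 < hA.eigenvalues i * a ^ 2 := by positivity
    have : 0 ≤ hA.eigenvalues j * b ^ 2 := by positivity
    linarith
  · have : 0 ≤ hA.eigenvalues i * a ^ 2 := by positivity
    have : 0 < hA.eigenvalues j * b ^ 2 := by positivity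
    linarith

/-- Expansion of `(f a - f b)²`: the quadratic form, taken in coordinates relative to `v`, is a
diagonal form minus a Dirichlet energy. -/
theorem quadratic_add_laplacian {B : Matrix σ σ ℝ} (hB : ∀ a b, B a b = B b a) (v f : σ → ℝ) :
    (∑ a, ∑ b, B a b * (v a * f a) * (v b * f b)) +
      (∑ a, ∑ b, B a b * v a * v b * (f a - f b) ^ 2) / 2 =
      ∑ a, (∑ b, B a b * v b) * v a * f a ^ 2 := by
  have h1 : ∑ a, ∑ b, B a b * v a * v b * f b ^ 2 = ∑ a, ∑ b, B a b * v a * v b * f a ^ 2 := by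
    rw [Finset.sum_comm]
    refine Finset.sum_congr rfl fun a _ => Finset.sum_congr rfl fun b _ => ?_
    rw [hB b a]; ring
  have h2 : ∑ a, ∑ b, B a b * v a * v b * (f a - f b) ^ 2 =
      (∑ a, ∑ b, B a b * v a * v b * f a ^ 2) + (∑ a, ∑ b, B a b * v a * v b * f b ^ 2) -
      2 * ∑ a, ∑ b, B a b * (v a * f a) * (v b * f b) := by
    rw [Finset.mul_sum, ← Finset.sum_add_distrib, ← Finset.sum_sub_distrib]
    refine Finset.sum_congr rfl fun a _ => ?_
    rw [Finset.mul_sum, ← Finset.sum_add_distrib, ← Finset.sum_sub_distrib]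
    refine Finset.sum_congr rfl fun b _ => ?_
    ring
  have h3 : ∑ a, (∑ b, B a b * v b) * v a * f a ^ 2 =
      ∑ a, ∑ b, B a b * v a * v b * f a ^ 2 := by
    refine Finset.sum_congr rfl fun a _ => ?_
    rw [Finset.sum_mul, Finset.sum_mul]
    refine Finset.sum_congr rfl fun b _ => ?_
    ring
  rw [h2, h1, h3]
  ring

/-- A symmetric matrix with nonnegative off-diagonal entries and connected support has a quadratic
form that is nonpositive on a hyperplane, if it satisfies the given quadratic inequality for a
positive vector `v` with positive image. -/
theorem exists_nonpos_kernel_of_connected {B : Matrix σ σ ℝ} (hB : ∀ a b, B a b = B b a)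
    (hoff : ∀ a b, a ≠ b → 0 ≤ B a b)
    (hconn : ∀ φ : σ → ℝ, (∀ a b, a ≠ b → 0 < B a b → φ a = φ b) → ∀ a b, φ a = φ b)
    {v : σ → ℝ} (hv : ∀ a, 0 < v a) (hBv : ∀ a, 0 < (B *ᵥ v) a)
    (hkey : ∀ x : σ → ℝ, x ⬝ᵥ B *ᵥ x ≤ ∑ a, v a / (B *ᵥ v) a * (B *ᵥ x) a ^ 2) :
    ∃ s : (σ → ℝ) →ₗ[ℝ] ℝ, ∀ z, s z = 0 → z ⬝ᵥ B *ᵥ z ≤ 0 := by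
  classical
  -- The scaling is chosen so that `B' = RBR`, with `R` the diagonal matrix of `r`, fixes the
  -- positive vector `v / r`.
  set r : σ → ℝ := fun a => Real.sqrt (v a / (B *ᵥ v) a) with hr
  have hrpos : ∀ a, 0 < r a := fun a => Real.sqrt_pos.2 (div_pos (hv a) (hBv a))
  have hrsq : ∀ a, r a ^ 2 = v a / (B *ᵥ v) a := fun a =>
    Real.sq_sqrt (div_pos (hv a) (hBv a)).le
  set B' : Matrix σ σ ℝ := Matrix.of fun a b => r a * B a b * r b with hB'
  have hH : B'.IsHermitian := by
    ext a b
    simp only [hB', conjTranspose_apply, of_apply, star_trivial, hB b a]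
    ring
  obtain ⟨e, he, hAe, hsum⟩ := exists_orthonormal_eigenvectors hH
  have hmul : ∀ y : σ → ℝ, ∀ a, (B' *ᵥ y) a = r a * (B *ᵥ fun b => r b * y b) a := by
    intro y a
    simp only [mulVec, dotProduct, hB', of_apply, Finset.mul_sum]
    refine Finset.sum_congr rfl fun b _ => ?_
    ring
  have hquad : ∀ y : σ → ℝ, (fun b => r b * y b) ⬝ᵥ (B *ᵥ fun b => r b * y b) =
      y ⬝ᵥ B' *ᵥ y := by
    intro y
    simp only [dotProduct, hmul]
    refine Finset.sum_congr rfl fun b _ => ?_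
    ring
  -- The defect `y·y - y·B'y` is a Dirichlet energy with nonnegative weights, hence all eigenvalues
  -- of `B'` are at most `1`.
  have hlap : ∀ y : σ → ℝ, y ⬝ᵥ B' *ᵥ y + (∑ a, ∑ b, B a b * v a * v b *
      (r a * y a / v a - r b * y b / v b) ^ 2) / 2 = y ⬝ᵥ y := by
    intro y
    have h := quadratic_add_laplacian hB v fun a => r a * y a / v a
    have e1 : ∀ a, v a * (r a * y a / v a) = r a * y a := fun a => by
      field_simp [(hv a).ne']
    simp only [e1] at h
    rw [← hquad y]
    have e2 : ((fun b => r b * y b) ⬝ᵥ B *ᵥ fun b => r b * y b) =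
        ∑ a, ∑ b, B a b * (r a * y a) * (r b * y b) := by
      simp only [dotProduct, mulVec, Finset.mul_sum]
      refine Finset.sum_congr rfl fun a _ => Finset.sum_congr rfl fun b _ => ?_
      ring
    rw [e2, h, dotProduct]
    refine Finset.sum_congr rfl fun a _ => ?_
    have e3 : ∑ b, B a b * v b = (B *ᵥ v) a := rfl
    rw [e3, div_pow, mul_pow, hrsq]
    have := (hv a).ne'
    have := (hBv a).ne'
    field_simp
  have hterm : ∀ y : σ → ℝ, ∀ a b, 0 ≤ B a b * v a * v b *
      (r a * y a / v a - r b * y b / v b) ^ 2 := by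
    intro y a b
    by_cases hab : a = b
    · subst hab; simp
    · have := hoff a b hab
      have := hv a
      have := hv b
      positivity
  have hquade : ∀ i, e i ⬝ᵥ B' *ᵥ e i = hH.eigenvalues i := by
    intro i
    rw [hAe, dotProduct_smul, he, if_pos rfl, smul_eq_mul, mul_one]
  have hle : ∀ i, hH.eigenvalues i ≤ 1 := by
    intro i
    have h := hlap (e i)
    rw [hquade, he, if_pos rfl] at h
    have : 0 ≤ ∑ a, ∑ b, B a b * v a * v b * (r a * e i a / v a - r b * e i b / v b) ^ 2 :=
      Finset.sum_nonneg fun a _ => Finset.sum_nonneg fun b _ => hterm (e i) a b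
    linarith
  -- After rescaling, the hypothesis reads `y·B'y ≤ |B'y|²`; on a unit eigenvector this is `λ ≤ λ²`.
  have hsq : ∀ i, hH.eigenvalues i ≤ hH.eigenvalues i ^ 2 := by
    intro i
    have h := hkey fun b => r b * e i b
    rw [hquad, hquade] at h
    refine h.trans (le_of_eq ?_)
    have e1 : ∀ a, v a / (B *ᵥ v) a * (B *ᵥ fun b => r b * e i b) a ^ 2 =
        hH.eigenvalues i ^ 2 * (e i a * e i a) := by
      intro a
      rw [← hrsq, ← mul_pow, ← hmul, hAe, Pi.smul_apply, smul_eq_mul]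
      ring
    simp only [e1]
    rw [← Finset.mul_sum]
    have e2 : ∑ a, e i a * e i a = 1 := by
      have := he i i
      rwa [if_pos rfl] at this
    rw [e2, mul_one]
  -- A positive `λ` with `λ ≤ λ²` and `λ ≤ 1` equals `1`, so the Dirichlet energy vanishes and
  -- connectedness makes the eigenvector a multiple of `v / r`.
  have hone : ∀ i, 0 < hH.eigenvalues i → ∃ κ : ℝ, ∀ a, r a * e i a = κ * v a := by
    intro i hi
    have h1 : hH.eigenvalues i = 1 := by
      refine le_antisymm (hle i) ?_
      have := hsq i
      nlinarith
    have h := hlap (e i)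
    rw [hquade, he, if_pos rfl, h1] at h
    have h0 : ∑ a, ∑ b, B a b * v a * v b * (r a * e i a / v a - r b * e i b / v b) ^ 2 = 0 := by
      linarith
    have h2 : ∀ a b, a ≠ b → 0 < B a b → r a * e i a / v a = r b * e i b / v b := by
      intro a b _ hab
      have h3 := (Finset.sum_eq_zero_iff_of_nonneg fun a _ =>
        Finset.sum_nonneg fun b _ => hterm (e i) a b).1 h0 a (Finset.mem_univ a)
      have h4 := (Finset.sum_eq_zero_iff_of_nonneg fun b _ => hterm (e i) a b).1 h3 b
        (Finset.mem_univ b)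
      have h5 : B a b * v a * v b ≠ 0 := (mul_pos (mul_pos hab (hv a)) (hv b)).ne'
      exact sub_eq_zero.1 (pow_eq_zero_iff two_ne_zero |>.1 ((mul_eq_zero.1 h4).resolve_left h5))
    refine ⟨r i * e i i / v i, fun a => ?_⟩
    rw [← hconn _ h2 a i, div_mul_cancel₀ _ (hv a).ne']
  have hquadz : ∀ z : σ → ℝ, z ⬝ᵥ B *ᵥ z =
      ∑ i, hH.eigenvalues i * (e i ⬝ᵥ fun a => z a / r a) ^ 2 := by
    intro z
    have hz : (fun b => r b * (z b / r b)) = z :=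
      funext fun b => mul_div_cancel₀ _ (hrpos b).ne'
    rw [← quadratic_eq_sum hAe hsum, ← hquad, hz]
  -- Distinct eigenvectors of the basis are orthogonal, but nonzero multiples of one positive vector
  -- are not.
  have huniq : ∀ i j, 0 < hH.eigenvalues i → 0 < hH.eigenvalues j → i = j := by
    intro i j hi hj
    by_contra hij
    obtain ⟨κ, hκ⟩ := hone i hi
    obtain ⟨κ', hκ'⟩ := hone j hj
    have e1 : ∀ (k : σ) (c : ℝ), (∀ a, r a * e k a = c * v a) → c ≠ 0 := by
      rintro k c h rfl
      have : e k = 0 := funext fun a => by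
        have := h a
        rw [zero_mul] at this
        exact (mul_eq_zero.1 this).resolve_left (hrpos a).ne'
      have h1 := he k k
      rw [this, if_pos rfl] at h1
      simp at h1
    have h := he i j
    rw [if_neg hij] at h
    have e2 : ∀ a, e i a * e j a = κ * κ' * (v a / r a) ^ 2 := by
      intro a
      have := (hrpos a).ne'
      have h1 : e i a = κ * v a / r a := by rw [← hκ a]; field_simp
      have h2 : e j a = κ' * v a / r a := by rw [← hκ' a]; field_simp
      rw [h1, h2]; ring
    simp only [dotProduct, e2] at h
    rw [← Finset.mul_sum] at h
    have h3 := (mul_eq_zero.1 h).resolve_left (mul_ne_zero (e1 i κ hκ) (e1 j κ' hκ'))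
    have h4 : 0 < ∑ a, (v a / r a) ^ 2 :=
      Finset.sum_pos (fun a _ => by have := hv a; have := hrpos a; positivity) ⟨i, Finset.mem_univ i⟩
    exact h4.ne' h3
  by_cases hex : ∃ i, 0 < hH.eigenvalues i
  · obtain ⟨i, hi⟩ := hex
    refine ⟨{ toFun := fun z => e i ⬝ᵥ fun a => z a / r a
              map_add' := fun y z => by
                rw [← dotProduct_add]; congr 1; funext a; simp [add_div]
              map_smul' := fun c z => by
                rw [RingHom.id_apply, ← dotProduct_smul]; congr 1; funext a
                simp [mul_div_assoc] }, fun z hz => ?_⟩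
    rw [hquadz]
    refine Finset.sum_nonpos fun j _ => ?_
    by_cases hj : 0 < hH.eigenvalues j
    · rw [huniq j i hj hi]
      have hz' : (e i ⬝ᵥ fun a => z a / r a) = 0 := hz
      rw [hz']; simp
    · exact mul_nonpos_of_nonpos_of_nonneg (not_lt.1 hj) (sq_nonneg _)
  · push Not at hex
    refine ⟨0, fun z _ => ?_⟩
    rw [hquadz]
    exact Finset.sum_nonpos fun j _ => mul_nonpos_of_nonpos_of_nonneg (hex j) (sq_nonneg _)

end LinearAlgebra

/-! ### Strictly submodular functions above modular ones -/

section Submodular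

/-- A set function that satisfies the strict submodular inequality at all incomparable subsets of
`E`. -/
def StrictlySubmodularOn (E : Set α) (c : Set α → ℝ) : Prop :=
  ∀ I J : Set α, I ⊆ E → J ⊆ E → ¬ I ⊆ J → ¬ J ⊆ I → c (I ∩ J) + c (I ∪ J) < c I + c J

theorem IsStrictlySubmodular.strictlySubmodularOn {E : Set α} {c : Set α → ℝ}
    (h : IsStrictlySubmodular E c) : StrictlySubmodularOn E c := by
  intro I J hI hJ h1 h2
  refine h.lt I J ?_ (hI.ssubset_of_ne ?_) ?_ (hJ.ssubset_of_ne ?_) h1 h2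
  · exact Set.empty_ssubset.2 (Set.nonempty_iff_ne_empty.2 fun h => h1 (h ▸ Set.empty_subset J))
  · rintro rfl; exact h2 hJ
  · exact Set.empty_ssubset.2 (Set.nonempty_iff_ne_empty.2 fun h => h2 (h ▸ Set.empty_subset I))
  · rintro rfl; exact h1 hI

theorem StrictlySubmodularOn.le {E : Set α} {c : Set α → ℝ} (h : StrictlySubmodularOn E c)
    {I J : Set α} (hI : I ⊆ E) (hJ : J ⊆ E) : c (I ∩ J) + c (I ∪ J) ≤ c I + c J := by
  by_cases h1 : I ⊆ J
  · rw [Set.inter_eq_left.2 h1, Set.union_eq_right.2 h1]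
  by_cases h2 : J ⊆ I
  · rw [Set.inter_eq_right.2 h2, Set.union_eq_left.2 h2, add_comm]
  exact (h I J hI hJ h1 h2).le

theorem StrictlySubmodularOn.mono {E E' : Set α} {c : Set α → ℝ}
    (h : StrictlySubmodularOn E c) (hE : E' ⊆ E) : StrictlySubmodularOn E' c :=
  fun I J hI hJ => h I J (hI.trans hE) (hJ.trans hE)

theorem StrictlySubmodularOn.union {E F : Set α} {c : Set α → ℝ}
    (h : StrictlySubmodularOn E c) (hF : F ⊆ E) :
    StrictlySubmodularOn (E \ F) (c ∘ (· ∪ F)) := by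
  intro I J hI hJ h1 h2
  have e1 : I ∪ F ⊆ E := Set.union_subset (hI.trans Set.sdiff_subset) hF
  have e2 : J ∪ F ⊆ E := Set.union_subset (hJ.trans Set.sdiff_subset) hF
  have key : ∀ {A B : Set α}, A ⊆ E \ F → ¬ A ⊆ B → ¬ A ∪ F ⊆ B ∪ F := by
    intro A B hA hAB hs
    exact hAB fun x hx => (hs (Or.inl hx)).resolve_right (hA hx).2
  have := h (I ∪ F) (J ∪ F) e1 e2 (key hI h1) (key hJ h2)
  rw [← Set.inter_union_distrib_right, ← Set.union_union_distrib_right] at this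
  exact this

theorem StrictlySubmodularOn.compl {E : Set α} {c : Set α → ℝ}
    (h : StrictlySubmodularOn E c) : StrictlySubmodularOn E fun S => c (E \ S) := by
  intro I J hI hJ h1 h2
  have key : ∀ {A B : Set α}, A ⊆ E → ¬ A ⊆ B → ¬ E \ B ⊆ E \ A := by
    intro A B hA hAB hs
    exact hAB fun x hx => by
      by_contra hxB
      exact (hs ⟨hA hx, hxB⟩).2 hx
  have := h (E \ I) (E \ J) Set.sdiff_subset Set.sdiff_subset (key hJ h2) (key hI h1)
  rw [← Set.sdiff_inter, Set.sdiff_inter_sdiff] at this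
  simp only
  linarith

open Classical in
/-- The modular function on sets with weights `x` on the finset `E`. -/
def modularSum (E : Finset α) (x : α → ℝ) (S : Set α) : ℝ := ∑ i ∈ E, if i ∈ S then x i else 0

theorem modularSum_empty (E : Finset α) (x : α → ℝ) : modularSum E x ∅ = 0 := by
  simp [modularSum]

/-- One step of the greedy algorithm: the new element receives its marginal value `c (E ∪ {e}) - c
E`. The second bound is the one that submodularity, applied to `S` and `E`, compares with `c S`. -/
theorem exists_modularSum_insert {E : Finset α} {e : α} (he : e ∉ E) {c : Set α → ℝ}
    {x : α → ℝ} (hle : ∀ S : Set α, S ⊆ E → c ∅ + modularSum E x S ≤ c S)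
    (heq : c ∅ + modularSum E x E = c E) [DecidableEq α] :
    ∃ y : α → ℝ, (∀ S : Set α, S ⊆ E → c ∅ + modularSum (insert e E) y S ≤ c S) ∧
      (∀ S : Set α, e ∈ S → S ⊆ insert e (E : Set α) → c ∅ + modularSum (insert e E) y S ≤
        c (S ∩ E) + (c (S ∪ E) - c E)) ∧
      c ∅ + modularSum (insert e E) y (insert e (E : Set α)) = c (insert e (E : Set α)) := by
  classical
  set y := Function.update x e (c (insert e (E : Set α)) - c E) with hy
  have h0 : ∀ S : Set α, modularSum (insert e E) y S =
      (if e ∈ S then c (insert e (E : Set α)) - c E else 0) + modularSum E x (S ∩ E) := by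
    intro S
    rw [modularSum, Finset.sum_insert he, modularSum]
    congr 1
    · simp [hy]
    · refine Finset.sum_congr rfl fun i hi => ?_
      have : i ≠ e := by rintro rfl; exact he hi
      simp [hy, this, hi]
  have heS : ∀ S : Set α, S ⊆ E → e ∉ S := fun S hS h => he (hS h)
  refine ⟨y, fun S hS => ?_, fun S heS hS => ?_, ?_⟩
  · rw [h0, if_neg (heS S hS), zero_add, Set.inter_eq_left.2 hS]
    exact hle S hS
  · have e1 : S ∪ E = insert e (E : Set α) := by
      refine (Set.union_subset hS (Set.subset_insert _ _)).antisymm ?_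
      exact Set.insert_subset (Or.inl heS) Set.subset_union_right
    rw [h0, if_pos heS, e1]
    have := hle (S ∩ E) Set.inter_subset_right
    linarith
  · rw [h0, if_pos (Set.mem_insert _ _), Set.inter_eq_right.2 (Set.subset_insert _ _)]
    linarith

theorem exists_modularSum_le (E : Finset α) {c : Set α → ℝ} (hc : StrictlySubmodularOn E c) :
    ∃ x : α → ℝ, (∀ S : Set α, S ⊆ E → c ∅ + modularSum E x S ≤ c S) ∧
      c ∅ + modularSum E x E = c E := by
  classical
  induction E using Finset.induction_on with
  | empty =>
    refine ⟨0, fun S hS => ?_, ?_⟩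
    · have : S = ∅ := by simpa using hS
      simp [this, modularSum]
    · simp [modularSum]
  | insert e E he ih =>
    rw [Finset.coe_insert] at hc
    obtain ⟨x, h1, h2⟩ := ih (hc.mono (Set.subset_insert _ _))
    obtain ⟨y, h3, h4, h5⟩ := exists_modularSum_insert he h1 h2
    refine ⟨y, fun S hS => ?_, ?_⟩
    · rw [Finset.coe_insert] at hS
      by_cases heS : e ∈ S
      · have := hc.le hS (Set.subset_insert e (E : Set α))
        have := h4 S heS hS
        linarith
      · refine h3 S fun i hi => ?_
        exact (hS hi).resolve_left (by rintro rfl; exact heS hi)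
    · rw [Finset.coe_insert]
      exact h5

/-- Here `e` is processed last in the greedy algorithm. A proper subset containing `e` is
incomparable with `E \ {e}`, so the last comparison is strict for it. -/
theorem exists_modularSum_lt_of_mem (E : Finset α) {e : α} (he : e ∈ E) {c : Set α → ℝ}
    (hc : StrictlySubmodularOn E c) :
    ∃ x : α → ℝ, (∀ S : Set α, S ⊆ E → c ∅ + modularSum E x S ≤ c S) ∧
      (∀ S : Set α, S ⊆ E → e ∈ S → S ≠ E → c ∅ + modularSum E x S < c S) ∧
      c ∅ + modularSum E x E = c E := by
  classical
  obtain ⟨E', he', rfl⟩ : ∃ E', e ∉ E' ∧ insert e E' = E :=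
    ⟨E.erase e, Finset.notMem_erase e E, Finset.insert_erase he⟩
  rw [Finset.coe_insert] at hc
  obtain ⟨x, h1, h2⟩ := exists_modularSum_le E' (hc.mono (Set.subset_insert _ _))
  obtain ⟨y, h3, h4, h5⟩ := exists_modularSum_insert he' h1 h2
  rw [Finset.coe_insert]
  refine ⟨y, fun S hS => ?_, fun S hS heS hne => ?_, h5⟩
  · by_cases heS : e ∈ S
    · have := hc.le hS (Set.subset_insert e (E' : Set α))
      have := h4 S heS hS
      linarith
    · refine h3 S fun i hi => ?_
      exact (hS hi).resolve_left (by rintro rfl; exact heS hi)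
  · have := hc S E' hS (Set.subset_insert e (E' : Set α)) (fun h => he' (h heS))
      (fun h => hne (hS.antisymm (Set.insert_subset heS h)))
    have := h4 S heS hS
    linarith

/-- A strictly submodular function on a nonempty finite set lies strictly above a modular function
that agrees with it at `∅` and at the whole set. -/
theorem exists_modularSum_lt (E : Finset α) (hE : E.Nonempty) {c : Set α → ℝ}
    (hc : StrictlySubmodularOn E c) :
    ∃ x : α → ℝ, (∀ S : Set α, S ⊆ E → S ≠ ∅ → S ≠ E → c ∅ + modularSum E x S < c S) ∧
      c ∅ + modularSum E x E = c E := by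
  classical
  obtain ⟨e, he⟩ := hE
  obtain ⟨x, h1, h2, h3⟩ := exists_modularSum_lt_of_mem E he hc
  -- The weights `y` for `S ↦ c (E \ S)`, with sign reversed, lie below `c` and strictly so at
  -- nonempty sets avoiding `e`. Averaging with `x`, which is strict at proper sets containing `e`,
  -- is strict at all nonempty proper sets.
  obtain ⟨y, h4, h5, h6⟩ := exists_modularSum_lt_of_mem E he hc.compl
  simp only [Set.sdiff_empty, Set.sdiff_self] at h4 h5 h6
  have hcompl : ∀ S : Set α, modularSum E y ((E : Set α) \ S) =
      modularSum E y E - modularSum E y S := by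
    intro S
    rw [modularSum, modularSum, modularSum, ← Finset.sum_sub_distrib]
    refine Finset.sum_congr rfl fun i hi => ?_
    by_cases hiS : i ∈ S <;> simp [hi, hiS]
  have havg : ∀ S : Set α, modularSum E (fun i => (x i - y i) / 2) S =
      (modularSum E x S - modularSum E y S) / 2 := by
    intro S
    rw [modularSum, modularSum, modularSum, ← Finset.sum_sub_distrib, Finset.sum_div]
    refine Finset.sum_congr rfl fun i hi => ?_
    split_ifs <;> simp
  have hdd : ∀ S : Set α, S ⊆ E → (E : Set α) \ ((E : Set α) \ S) = S := fun S hS => by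
    rw [Set.sdiff_sdiff_right_self, Set.inter_eq_right.2 hS]
  refine ⟨fun i => (x i - y i) / 2, fun S hS h0 hSE => ?_, ?_⟩
  · rw [havg]
    by_cases heS : e ∈ S
    · have a1 := h2 S hS heS hSE
      have a2 := h4 (E \ S) Set.sdiff_subset
      rw [hcompl, hdd S hS] at a2
      linarith
    · have a1 := h1 S hS
      have a2 := h5 (E \ S) Set.sdiff_subset ⟨he, heS⟩ (fun h => h0 (by
        rw [← hdd S hS, h, Set.sdiff_self]))
      rw [hcompl, hdd S hS] at a2
      linarith
  · rw [havg]
    linarith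

open MvPolynomial

/-- Subtracting the modular function from `exists_modularSum_lt` leaves the derivative unchanged.
The difference vanishes at both ends, so normalization does nothing and its positive values at flats
are the coefficients. -/
theorem VolPolySpec.exists_dirDeriv_eq_sum {M : Matroid α} (hM : IsFinLoopless M)
    (hr : 0 < rk M) {c : Set α → ℝ} (hc : StrictlySubmodularOn M.E c) :
    ∃ l : Set α → ℝ, (∀ F ∈ properFlats M, 0 < l F) ∧ dirDeriv c (volPoly M) =
      ∑ F ∈ properFlats M, C (l F) * splitPoly M F := by
  classical
  have hs := volPolySpec M hM hr
  obtain ⟨j, hj⟩ := hM.rk_pos_iff.1 hr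
  set E := hM.finite.ground_finite.toFinset with hEdef
  have hE : (E : Set α) = M.E := hM.finite.ground_finite.coe_toFinset
  obtain ⟨x, h1, h2⟩ := exists_modularSum_lt E ⟨j, by rwa [← Finset.mem_coe, hE]⟩
    (c := c) (by rwa [hE])
  rw [hE] at h1 h2
  set m : Set α → ℝ := fun S => c ∅ + modularSum E x S with hm
  have hm0 : dirDeriv m (volPoly M) = 0 := by
    have e1 : m = c ∅ • (fun _ => (1 : ℝ)) +
        ∑ i ∈ E, x i • (fun S : Set α => if i ∈ S then (1 : ℝ) else 0) := by
      funext S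
      simp [hm, modularSum, Finset.sum_apply]
    rw [e1, dirDeriv_add, dirDeriv_sum, dirDeriv_smul,
      hs.dirDeriv_eq_zero hj (w := fun _ => 1) (fun F _ => by simp [normalize]), mul_zero, zero_add]
    refine Finset.sum_eq_zero fun i hi => ?_
    have hiE : i ∈ M.E := by rwa [← hE]
    rw [dirDeriv_smul, hs.dirDeriv_eq_zero hiE (w := fun S => if i ∈ S then 1 else 0)
      (fun F _ => by by_cases h : i ∈ F <;> simp [normalize, hiE, h]), mul_zero]
  have hcm : dirDeriv c (volPoly M) = dirDeriv (c - m) (volPoly M) := by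
    rw [dirDeriv_sub, hm0, sub_zero]
  refine ⟨c - m, fun F hF => ?_, ?_⟩
  · have := h1 F (hM.ssubset hF).subset (hM.nonempty hF).ne_empty (hM.ssubset hF).ne
    simp only [Pi.sub_apply, hm]
    linarith
  · rw [hcm, hs.dirDeriv_eq j hj]
    refine Finset.sum_congr rfl fun F hF => ?_
    have e1 : (c - m) M.E = 0 := by simp only [Pi.sub_apply, hm]; linarith
    have e2 : (c - m) ∅ = 0 := by simp [hm, modularSum_empty]
    rw [normalize, e1, e2, ite_self, sub_zero]

end Submodular

/-! ### Products of volume polynomials and positivity of their full derivatives -/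

section Products

open MvPolynomial

section IteratedDerivatives

variable {σ τ : Type*}

/-- The iterated directional derivative of a polynomial along a list of constant vectors. -/
def iterDirDeriv : List (σ → ℝ) → MvPolynomial σ ℝ →ₗ[ℝ] MvPolynomial σ ℝ
  | [] => LinearMap.id
  | v :: us => (dirDeriv v : MvPolynomial σ ℝ →ₗ[ℝ] MvPolynomial σ ℝ) ∘ₗ iterDirDeriv us

@[simp] theorem iterDirDeriv_nil (p : MvPolynomial σ ℝ) : iterDirDeriv [] p = p := rfl

@[simp] theorem iterDirDeriv_cons (v : σ → ℝ) (us : List (σ → ℝ)) (p : MvPolynomial σ ℝ) :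
    iterDirDeriv (v :: us) p = dirDeriv v (iterDirDeriv us p) := rfl

theorem iterDirDeriv_dirDeriv (us : List (σ → ℝ)) (v : σ → ℝ) (p : MvPolynomial σ ℝ) :
    iterDirDeriv us (dirDeriv v p) = dirDeriv v (iterDirDeriv us p) := by
  induction us with
  | nil => rfl
  | cons u us ih => rw [iterDirDeriv_cons, iterDirDeriv_cons, ih, dirDeriv_comm]

theorem iterDirDeriv_rename (f : σ → τ) (us : List (τ → ℝ)) (p : MvPolynomial σ ℝ) :
    iterDirDeriv us (rename f p) = rename f (iterDirDeriv (us.map (· ∘ f)) p) := by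
  induction us with
  | nil => rfl
  | cons u us ih =>
    rw [List.map_cons, iterDirDeriv_cons, iterDirDeriv_cons, ih, dirDeriv_rename]

theorem IsHomogeneous.iterDirDeriv {p : MvPolynomial σ ℝ} {n : ℕ} (hp : p.IsHomogeneous n)
    (us : List (σ → ℝ)) : (iterDirDeriv us p).IsHomogeneous (n - us.length) := by
  induction us with
  | nil => simpa using hp
  | cons u us ih =>
    have := IsHomogeneous.dirDeriv ih u
    rwa [Nat.sub_sub] at this

theorem eval_zero_rename (f : σ → τ) (p : MvPolynomial σ ℝ) :
    eval 0 (rename f p) = eval 0 p := by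
  rw [eval_rename]; rfl

/-- The bilinear form of second derivatives at the origin of an iterated directional derivative. -/
def hessForm (us : List (σ → ℝ)) (p : MvPolynomial σ ℝ) : (σ → ℝ) →ₗ[ℝ] (σ → ℝ) →ₗ[ℝ] ℝ :=
  LinearMap.mk₂ ℝ (fun x y => eval 0 (dirDeriv x (dirDeriv y (iterDirDeriv us p))))
    (fun x x' y => by rw [dirDeriv_add, map_add])
    (fun c x y => by rw [dirDeriv_smul, map_mul, eval_C, smul_eq_mul])
    (fun x y y' => by rw [dirDeriv_add, map_add, map_add])
    (fun c x y => by rw [dirDeriv_smul, dirDeriv_C_mul, map_mul, eval_C, smul_eq_mul])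

theorem hessForm_apply (us : List (σ → ℝ)) (p : MvPolynomial σ ℝ) (x y : σ → ℝ) :
    hessForm us p x y = eval 0 (dirDeriv x (dirDeriv y (iterDirDeriv us p))) := rfl

theorem hessForm_comm (us : List (σ → ℝ)) (p : MvPolynomial σ ℝ) (x y : σ → ℝ) :
    hessForm us p x y = hessForm us p y x := by
  rw [hessForm_apply, hessForm_apply, dirDeriv_comm]

theorem hessForm_rename (f : σ → τ) (us : List (τ → ℝ)) (p : MvPolynomial σ ℝ) (x y : τ → ℝ) :
    hessForm us (rename f p) x y = hessForm (us.map (· ∘ f)) p (x ∘ f) (y ∘ f) := by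
  rw [hessForm_apply, hessForm_apply, iterDirDeriv_rename, dirDeriv_rename, dirDeriv_rename,
    eval_zero_rename]

theorem HasNonposKernel.rename {f : σ → τ} {us : List (τ → ℝ)} {p : MvPolynomial σ ℝ}
    (h : HasNonposKernel (hessForm (us.map (· ∘ f)) p)) :
    HasNonposKernel (hessForm us (rename f p)) := by
  obtain ⟨s, hs⟩ := h
  refine ⟨s ∘ₗ LinearMap.funLeft ℝ ℝ f, fun z hz => ?_⟩
  rw [hessForm_rename]
  exact hs _ hz

end IteratedDerivatives

variable {J : Type} [Fintype J] [DecidableEq J] {N : J → Matroid α}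

/-- A family of finite loopless matroids of positive rank. -/
def IsLooplessFamily (N : J → Matroid α) : Prop := ∀ j, IsFinLoopless (N j) ∧ 0 < rk (N j)

/-- The product of the volume polynomials of a family of matroids, in separate variables. -/
def prodVolPoly (N : J → Matroid α) : MvPolynomial (J × Set α) ℝ :=
  ∏ j, rename (Prod.mk j) (volPoly (N j))

/-- The vectors whose components are strictly submodular. -/
def InSubmodularCone (N : J → Matroid α) (c : J × Set α → ℝ) : Prop :=
  ∀ j, StrictlySubmodularOn (N j).E (c ∘ Prod.mk j)

/-- The degree of the product of the volume polynomials. -/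
def familyDegree (N : J → Matroid α) : ℕ := ∑ j, (rk (N j) - 1)

/-- The family obtained by replacing the matroid `N j` by its restriction to `F` and its
contraction of `F`. -/
def splitFamily (N : J → Matroid α) (j : J) (F : Set α) : Option J → Matroid α
  | none => N j ／ F
  | some k => if k = j then N j ↾ F else N k

/-- The map of variables that goes with `splitFamily`. -/
def splitMap (j : J) (F : Set α) : Option J × Set α → J × Set α
  | (none, S) => (j, S ∪ F)
  | (some k, S) => (k, S)

/-- The product of volume polynomials with one factor replaced by the product for a restriction and
a contraction. -/
def splitProdPoly (N : J → Matroid α) (j : J) (F : Set α) : MvPolynomial (J × Set α) ℝ :=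
  (∏ k ∈ Finset.univ.erase j, rename (Prod.mk k) (volPoly (N k))) *
    rename (Prod.mk j) (splitPoly (N j) F)

theorem splitProdPoly_eq (N : J → Matroid α) (j : J) (F : Set α) :
    splitProdPoly N j F = rename (splitMap j F) (prodVolPoly (splitFamily N j F)) := by
  rw [prodVolPoly, map_prod, Fintype.prod_option, splitProdPoly, splitPoly,
    ← Finset.prod_erase_mul Finset.univ _ (Finset.mem_univ j)]
  have h1 : ∀ k ∈ Finset.univ.erase j,
      rename (splitMap j F) (rename (Prod.mk (some k)) (volPoly (splitFamily N j F (some k)))) =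
      rename (Prod.mk k) (volPoly (N k)) := by
    intro k hk
    rw [rename_rename, splitFamily, if_neg (Finset.ne_of_mem_erase hk)]
    rfl
  rw [Finset.prod_congr rfl h1, rename_rename, rename_rename, splitFamily, splitFamily,
    if_pos rfl, map_mul, rename_rename]
  have e1 : splitMap j F ∘ Prod.mk (some j) = Prod.mk j := rfl
  have e2 : splitMap j F ∘ Prod.mk none = Prod.mk j ∘ (· ∪ F) := rfl
  rw [e1, e2]
  ring

theorem dirDeriv_prodVolPoly (N : J → Matroid α) (w : J × Set α → ℝ) :
    dirDeriv w (prodVolPoly N) = ∑ j, (∏ k ∈ Finset.univ.erase j,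
      rename (Prod.mk k) (volPoly (N k))) *
        rename (Prod.mk j) (dirDeriv (w ∘ Prod.mk j) (volPoly (N j))) := by
  rw [prodVolPoly, dirDeriv_prod]
  exact Finset.sum_congr rfl fun j _ => by rw [dirDeriv_rename]

theorem dirDeriv_prodVolPoly_of_eq {w : J × Set α → ℝ} {l : J → Set α → ℝ}
    (h : ∀ j, dirDeriv (w ∘ Prod.mk j) (volPoly (N j)) =
      ∑ F ∈ properFlats (N j), C (l j F) * splitPoly (N j) F) :
    dirDeriv w (prodVolPoly N) =
      ∑ j, ∑ F ∈ properFlats (N j), C (l j F) * splitProdPoly N j F := by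
  rw [dirDeriv_prodVolPoly]
  refine Finset.sum_congr rfl fun j _ => ?_
  rw [h j, map_sum, Finset.mul_sum]
  refine Finset.sum_congr rfl fun F _ => ?_
  rw [map_mul, rename_C, splitProdPoly]
  ring

omit [Fintype J] in
open Classical in
theorem single_comp_mk (j k : J) (F : Set α) :
    (Pi.single (j, F) 1 : J × Set α → ℝ) ∘ Prod.mk k = if k = j then Pi.single F 1 else 0 := by
  funext S
  by_cases h : k = j
  · subst h
    simp [Pi.single_apply]
  · simp [h]

open Classical in
theorem dirDeriv_single_prodVolPoly (hN : IsLooplessFamily N) {j : J} {F : Set α}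
    (hF : F ∈ properFlats (N j)) :
    dirDeriv (Pi.single (j, F) 1) (prodVolPoly N) = splitProdPoly N j F := by
  rw [dirDeriv_prodVolPoly, Finset.sum_eq_single j]
  · rw [single_comp_mk, if_pos rfl,
      (volPolySpec (N j) (hN j).1 (hN j).2).dirDeriv_single (hN j).1 hF, splitProdPoly]
  · intro k _ hk
    rw [single_comp_mk, if_neg hk, dirDeriv_zero, map_zero, mul_zero]
  · intro h; exact absurd (Finset.mem_univ j) h

omit [Fintype J] in
theorem IsLooplessFamily.split (hN : IsLooplessFamily N) {j : J} {F : Set α}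
    (hF : F ∈ properFlats (N j)) : IsLooplessFamily (splitFamily N j F) := by
  obtain ⟨h1, h2⟩ := hN j
  rintro (_ | k)
  · exact ⟨h1.contract (h1.isFlat hF), h1.rk_contract_pos hF⟩
  · rw [splitFamily]
    split_ifs
    · exact ⟨h1.restrict (h1.ssubset hF).subset, h1.rk_restrict_pos hF⟩
    · exact hN k

theorem familyDegree_split (hN : IsLooplessFamily N) {j : J} {F : Set α}
    (hF : F ∈ properFlats (N j)) :
    familyDegree (splitFamily N j F) + 1 = familyDegree N := by
  obtain ⟨h1, h2⟩ := hN j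
  rw [familyDegree, familyDegree, Fintype.sum_option,
    ← Finset.sum_erase_add Finset.univ _ (Finset.mem_univ j),
    ← Finset.sum_erase_add Finset.univ (fun j => rk (N j) - 1) (Finset.mem_univ j)]
  have : ∀ k ∈ Finset.univ.erase j, rk (splitFamily N j F (some k)) - 1 = rk (N k) - 1 := by
    intro k hk
    rw [splitFamily, if_neg (Finset.ne_of_mem_erase hk)]
  rw [Finset.sum_congr rfl this, splitFamily, splitFamily, if_pos rfl]
  have h3 := h1.rk_add hF
  have h4 := h1.rk_restrict_pos hF
  have h5 := h1.rk_contract_pos hF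
  omega

omit [Fintype J] in
theorem InSubmodularCone.split (hN : IsLooplessFamily N) {j : J} {F : Set α}
    (hF : F ∈ properFlats (N j)) {c : J × Set α → ℝ} (hc : InSubmodularCone N c) :
    InSubmodularCone (splitFamily N j F) (c ∘ splitMap j F) := by
  have hFE := ((hN j).1.ssubset hF).subset
  rintro (_ | k)
  · exact (hc j).union hFE
  · rw [splitFamily]
    split_ifs with h
    · subst h
      exact (hc k).mono hFE
    · exact hc k

omit [DecidableEq J] in
theorem exists_rk_of_familyDegree_pos (h : 0 < familyDegree N) : ∃ j, 2 ≤ rk (N j) := by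
  by_contra! h'
  refine h.ne' (Finset.sum_eq_zero fun j _ => ?_)
  have := h' j
  omega

omit [DecidableEq J] in
theorem prodVolPoly_of_familyDegree_eq_zero (hN : IsLooplessFamily N) (h : familyDegree N = 0) :
    prodVolPoly N = 1 := by
  refine Finset.prod_eq_one fun j _ => ?_
  have h1 := (Finset.sum_eq_zero_iff.1 h) j (Finset.mem_univ j)
  have h2 := (hN j).2
  rw [volPoly_rank_one (by omega), map_one]

omit [DecidableEq J] in
theorem isHomogeneous_prodVolPoly (hN : IsLooplessFamily N) :
    (prodVolPoly N).IsHomogeneous (familyDegree N) :=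
  IsHomogeneous.prod _ _ _ fun j _ =>
    (volPolySpec (N j) (hN j).1 (hN j).2).isHomogeneous.rename_isHomogeneous

theorem exists_dirDeriv_prodVolPoly_eq (hN : IsLooplessFamily N) {c : J × Set α → ℝ}
    (hc : InSubmodularCone N c) : ∃ l : J → Set α → ℝ,
      (∀ j, ∀ F ∈ properFlats (N j), 0 < l j F) ∧ dirDeriv c (prodVolPoly N) =
        ∑ j, ∑ F ∈ properFlats (N j), C (l j F) * splitProdPoly N j F := by
  choose l h1 h2 using fun j => VolPolySpec.exists_dirDeriv_eq_sum (hN j).1 (hN j).2 (hc j)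
  exact ⟨l, h1, dirDeriv_prodVolPoly_of_eq h2⟩

/-- Full iterated derivatives of products of volume polynomials along strictly submodular vectors
are positive. -/
theorem eval_iterDirDeriv_pos (d : ℕ) : ∀ {J : Type} [Fintype J] [DecidableEq J]
    {N : J → Matroid α}, IsLooplessFamily N → familyDegree N = d →
    ∀ us : List (J × Set α → ℝ), us.length = d → (∀ u ∈ us, InSubmodularCone N u) →
      0 < eval 0 (iterDirDeriv us (prodVolPoly N)) := by
  induction d with
  | zero =>
    intro J _ _ N hN hd us hus _
    rw [List.length_eq_zero_iff.1 hus, iterDirDeriv_nil,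
      prodVolPoly_of_familyDegree_eq_zero hN hd, map_one]
    exact one_pos
  | succ d ih =>
    intro J _ _ N hN hd us hus hcone
    obtain ⟨u, us, rfl⟩ : ∃ u us', us = u :: us' := List.exists_cons_of_length_eq_add_one hus
    rw [List.length_cons, add_left_inj] at hus
    obtain ⟨l, hl, he⟩ := exists_dirDeriv_prodVolPoly_eq hN (hcone u (by simp))
    -- The derivative along `u` is moved inside, next to the product, where it becomes a positive
    -- combination of split products of lower degree.
    rw [iterDirDeriv_cons, ← iterDirDeriv_dirDeriv, he]
    simp only [map_sum, C_mul', map_smul, smul_eval]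
    have hpos : ∀ j, ∀ F ∈ properFlats (N j),
        0 < l j F * eval 0 (iterDirDeriv us (splitProdPoly N j F)) := by
      intro j F hF
      refine mul_pos (hl j F hF) ?_
      rw [splitProdPoly_eq, iterDirDeriv_rename, eval_zero_rename]
      refine ih (hN.split hF) ?_ _ (by rw [List.length_map, hus]) fun v hv => ?_
      · have := familyDegree_split hN hF
        omega
      · obtain ⟨w, hw, rfl⟩ := List.mem_map.1 hv
        exact (hcone w (by simp [hw])).split hN hF
    obtain ⟨j, hj⟩ := exists_rk_of_familyDegree_pos (N := N) (by omega)
    obtain ⟨i, hi⟩ := (hN j).1.rk_pos_iff.1 (hN j).2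
    refine Finset.sum_pos' (fun j _ => Finset.sum_nonneg fun F hF => (hpos j F hF).le)
      ⟨j, Finset.mem_univ j, Finset.sum_pos (hpos j)
        ⟨_, (hN j).1.closure_singleton_mem_properFlats hi hj⟩⟩

theorem eval_iterDirDeriv_splitProdPoly_pos (hN : IsLooplessFamily N) {j : J} {F : Set α}
    (hF : F ∈ properFlats (N j)) (us : List (J × Set α → ℝ))
    (hus : us.length + 1 = familyDegree N) (hcone : ∀ u ∈ us, InSubmodularCone N u) :
    0 < eval 0 (iterDirDeriv us (splitProdPoly N j F)) := by
  have h := familyDegree_split hN hF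
  rw [splitProdPoly_eq, iterDirDeriv_rename, eval_zero_rename]
  refine eval_iterDirDeriv_pos us.length (hN.split hF) (by omega) _ (List.length_map _)
    fun v hv => ?_
  obtain ⟨w, hw, rfl⟩ := List.mem_map.1 hv
  exact (hcone w hw).split hN hF

open Classical in
-- With `G` in another factor, or strictly below `F`, the coordinate `(k, G)` pulls back to a flat
-- coordinate of the split family. The case `F ⊂ G` is left to symmetry of the Hessian.
theorem dirDeriv_single_splitProdPoly (hN : IsLooplessFamily N) {j k : J} {F G : Set α}
    (hF : F ∈ properFlats (N j)) (hG : G ∈ properFlats (N k)) (h : j ≠ k ∨ j = k ∧ G ⊂ F) :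
    G ∈ properFlats (splitFamily N j F (some k)) ∧
      dirDeriv (Pi.single (k, G) 1) (splitProdPoly N j F) =
        rename (splitMap j F) (splitProdPoly (splitFamily N j F) (some k) G) := by
  have hG' : G ∈ properFlats (splitFamily N j F (some k)) := by
    rw [splitFamily]
    split_ifs with hkj
    · subst hkj
      have hGF : G ⊂ F := by
        rcases h with h | h
        · exact absurd rfl h
        · exact h.2
      exact ((hN k).1.mem_properFlats_restrict ((hN k).1.isFlat hF)
        ((hN k).1.ssubset hF).ne).2 ⟨hG, hGF⟩
    · exact hG
  refine ⟨hG', ?_⟩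
  have key : (Pi.single (k, G) 1 : J × Set α → ℝ) ∘ splitMap j F = Pi.single (some k, G) 1 := by
    funext ⟨o, S⟩
    rcases o with _ | l
    · have h1 : ((none : Option J), S) ≠ (some k, G) := by simp
      have h2 : (j, S ∪ F) ≠ (k, G) := by
        intro he
        obtain ⟨rfl, rfl⟩ := Prod.mk.inj he
        rcases h with h | h
        · exact h rfl
        · exact h.2.not_subset Set.subset_union_right
      rw [Pi.single_eq_of_ne h1, Function.comp, splitMap, Pi.single_eq_of_ne h2]
    · by_cases h1 : (l, S) = (k, G)
      · obtain ⟨rfl, rfl⟩ := Prod.mk.inj h1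
        rw [Pi.single_eq_same, Function.comp, splitMap, Pi.single_eq_same]
      · have h2 : (some l, S) ≠ (some k, G) := by
          intro he
          obtain ⟨e1, e2⟩ := Prod.mk.inj he
          exact h1 (Prod.ext (Option.some.inj e1) e2)
        rw [Pi.single_eq_of_ne h2, Function.comp, splitMap, Pi.single_eq_of_ne h1]
  rw [splitProdPoly_eq N, dirDeriv_rename, key, dirDeriv_single_prodVolPoly (hN.split hF) hG']

open Classical in
theorem dirDeriv_single_splitProdPoly_eq_zero (hN : IsLooplessFamily N) {j : J} {F G : Set α}
    (hF : F ∈ properFlats (N j)) (hG : G ∈ properFlats (N j)) (h : ¬ G ⊆ F) (h' : ¬ F ⊆ G) :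
    dirDeriv (Pi.single (j, G) 1) (splitProdPoly N j F) = 0 := by
  have h1 : dirDeriv (Pi.single (j, G) 1) (∏ k ∈ Finset.univ.erase j,
      rename (Prod.mk k) (volPoly (N k)) : MvPolynomial (J × Set α) ℝ) = 0 := by
    rw [dirDeriv_prod]
    refine Finset.sum_eq_zero fun k hk => ?_
    rw [dirDeriv_rename, single_comp_mk, if_neg (Finset.ne_of_mem_erase hk), dirDeriv_zero,
      map_zero, mul_zero]
  rw [splitProdPoly, dirDeriv_mul, h1, dirDeriv_rename, single_comp_mk, if_pos rfl,
    dirDeriv_single_splitPoly_of_incomparable (hN j).1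
      (fun N hN h _ => volPolySpec N hN h) hF hG h h']
  simp

end Products

/-! ### Hessians of products: degree two and the inductive step -/

section Lorentzian

open MvPolynomial Matrix

/-- The hyperplane is orthogonality to `α = -δ_E`. On it the derivatives `h F` sum to zero over the
flats through each element, so at a rank one flat `h` is determined by the rank two flats above it.
Eliminating rank one flats leaves `-Σ h(G)²` over the rank two flats. -/
theorem hasNonposKernel_of_rk_eq_three {M : Matroid α} (hM : IsFinLoopless M) (hr : rk M = 3) :
    HasNonposKernel (hessForm [] (volPoly M)) := by
  classical
  have spec : ∀ N : Matroid α, IsFinLoopless N → 0 < rk N → rk N < rk M → VolPolySpec N :=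
    fun N hN h _ => volPolySpec N hN h
  have hs := volPolySpec M hM (by omega)
  obtain ⟨i, hi⟩ := hM.rk_pos_iff.1 (by omega : 0 < rk M)
  refine ⟨(hessForm [] (volPoly M)).flip (Pi.single M.E 1), fun x hx => ?_⟩
  rw [LinearMap.flip_apply, hessForm_apply, iterDirDeriv_nil] at hx
  set y : Set α → ℝ := normalize M i x with hy
  have hyE : y M.E = 0 := by simp [hy, normalize, hi]
  have hy0 : y ∅ = 0 := by simp [hy, normalize]
  set h : Set α → ℝ := fun F => eval 0 (dirDeriv x (splitPoly M F)) with hh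
  have hsum : ∀ j ∈ M.E, ∑ F ∈ properFlats M with j ∈ F, h F = 0 := by
    intro j hj
    rw [hs.dirDeriv_eq j hj, map_sum, map_sum] at hx
    rw [Finset.sum_filter]
    refine neg_eq_zero.1 (Eq.trans ?_ hx)
    rw [← Finset.sum_neg_distrib]
    refine Finset.sum_congr rfl fun F hF => ?_
    rw [normalize, Pi.single_eq_of_ne (hM.ssubset hF).ne, Pi.single_eq_same,
      Pi.single_eq_of_ne (Set.nonempty_of_mem hj).ne_empty.symm, dirDeriv_C_mul, map_mul, eval_C]
    split_ifs <;> simp [hh]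
  have hxy : ∀ F ∈ properFlats M, h F = eval 0 (dirDeriv y (splitPoly M F)) := by
    intro F hF
    have h0 := dirDeriv_splitPoly_eq_zero hM spec hF hi (w := x - y) (fun G _ => by
      simp only [hy, normalize, Pi.sub_apply, hi, if_true, Set.mem_empty_iff_false, if_false]
      split_ifs <;> ring)
    rw [dirDeriv_sub, sub_eq_zero] at h0
    simp only [hh]
    rw [h0]
  have hquad : hessForm [] (volPoly M) x x = ∑ F ∈ properFlats M, y F * h F := by
    rw [hessForm_apply, iterDirDeriv_nil, hs.dirDeriv_eq i hi, map_sum, map_sum]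
    refine Finset.sum_congr rfl fun F _ => ?_
    rw [dirDeriv_C_mul, map_mul, eval_C]
  have hrk : ∀ F ∈ properFlats M, rk (M ↾ F) = 1 ∨ rk (M ↾ F) = 2 ∧ rk (M ／ F) = 1 := by
    intro F hF
    have h1 := hM.rk_restrict_pos hF
    have h2 := hM.rk_contract_pos hF
    have h3 := hM.rk_add hF
    omega
  have hpoint : ∀ F ∈ properFlats M, rk (M ↾ F) = 1 →
      h F = -∑ G ∈ properFlats M with F ⊂ G, h G := by
    intro F hF hF1
    obtain ⟨j, hj⟩ := hM.nonempty hF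
    have h1 := hsum j ((hM.ssubset hF).subset hj)
    have h2 : {G ∈ properFlats M | j ∈ G} = insert F {G ∈ properFlats M | F ⊂ G} := by
      ext G
      simp only [Finset.mem_filter, Finset.mem_insert]
      constructor
      · rintro ⟨hG, hjG⟩
        rcases eq_or_ssubset_of_subset
          (hM.subset_of_rk_restrict_eq_one hF hF1 hj (hM.isFlat hG) hjG) with h | h
        · exact Or.inl h.symm
        · exact Or.inr ⟨hG, h⟩
      · rintro (rfl | ⟨hG, hFG⟩)
        · exact ⟨hF, hj⟩
        · exact ⟨hG, hFG.subset hj⟩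
    rw [h2, Finset.sum_insert (by simp)] at h1
    exact eq_neg_of_add_eq_zero_left h1
  have hline : ∀ G ∈ properFlats M, ¬ rk (M ↾ G) = 1 →
      h G = ∑ F ∈ properFlats (M ↾ G), y F - y G := by
    intro G hG hG1
    obtain ⟨h2, h3⟩ := (hrk G hG).resolve_left hG1
    have hMG := hM.restrict (hM.ssubset hG).subset
    obtain ⟨j, hj⟩ := hM.nonempty hG
    have hone : ∀ F ∈ properFlats (M ↾ G), splitPoly (M ↾ G) F = 1 := by
      intro F hF
      have h4 := hMG.rk_restrict_pos hF
      have h5 := hMG.rk_contract_pos hF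
      have h6 := hMG.rk_add hF
      rw [splitPoly, volPoly_rank_one (by omega), volPoly_rank_one (by omega), map_one, mul_one]
    have hcount : ∑ F ∈ properFlats (M ↾ G), (if j ∈ F then y G else y ∅) = y G := by
      rw [hy0, ← Finset.sum_filter, hMG.filter_mem_properFlats h2 hj, Finset.sum_singleton]
    rw [hxy G hG, splitPoly, volPoly_rank_one h3, map_one, mul_one,
      (volPolySpec (M ↾ G) hMG (by omega)).dirDeriv_eq j hj, map_sum]
    conv_rhs => rw [← hcount, ← Finset.sum_sub_distrib]
    refine Finset.sum_congr rfl fun F hF => ?_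
    rw [hone F hF, mul_one, eval_C, normalize, restrict_ground_eq]
  have hswap : ∑ F ∈ properFlats M with rk (M ↾ F) = 1, y F * h F =
      -∑ G ∈ properFlats M with ¬ rk (M ↾ G) = 1, ∑ F ∈ properFlats (M ↾ G), y F * h G := by
    rw [Finset.sum_comm' (t' := {F ∈ properFlats M | rk (M ↾ F) = 1})
      (s' := fun F => {G ∈ properFlats M | F ⊂ G}), ← Finset.sum_neg_distrib]
    · refine Finset.sum_congr rfl fun F hF => ?_
      rw [Finset.mem_filter] at hF
      rw [hpoint F hF.1 hF.2, mul_neg, Finset.mul_sum]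
    · intro G F
      simp only [Finset.mem_filter]
      constructor
      · rintro ⟨⟨hG, hG1⟩, hF⟩
        have hMG := hM.restrict (hM.ssubset hG).subset
        have hF' := (hM.mem_properFlats_restrict (hM.isFlat hG) (hM.ssubset hG).ne).1 hF
        refine ⟨⟨hG, hF'.2⟩, hF'.1, ?_⟩
        have h2 := ((hrk G hG).resolve_left hG1).1
        have h4 := hMG.rk_restrict_pos hF
        have h5 := hMG.rk_contract_pos hF
        have h6 := hMG.rk_add hF
        rw [M.restrict_restrict_eq hF'.2.subset] at h4 h6
        omega
      · rintro ⟨⟨hG, hFG⟩, hF, -⟩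
        have hMG := hM.restrict (hM.ssubset hG).subset
        have hF' := (hM.mem_properFlats_restrict (hM.isFlat hG) (hM.ssubset hG).ne).2 ⟨hF, hFG⟩
        refine ⟨⟨hG, fun h1 => ?_⟩, hF'⟩
        rw [hMG.properFlats_eq_empty h1.le] at hF'
        simp at hF'
  rw [hquad, ← Finset.sum_filter_add_sum_filter_not _ (fun F => rk (M ↾ F) = 1), hswap,
    neg_add_eq_sub, ← Finset.sum_sub_distrib]
  refine Finset.sum_nonpos fun G hG => ?_
  rw [Finset.mem_filter] at hG
  rw [← Finset.sum_mul, ← sub_mul, show y G - ∑ F ∈ properFlats (M ↾ G), y F = -h G by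
    rw [hline G hG.1 hG.2]; ring]
  nlinarith [sq_nonneg (h G)]

/-- For linear forms the quadratic form is `2 p(z) q(z)`, which is `-2 q(z)²` on the hyperplane `p +
q = 0`. -/
theorem hasNonposKernel_mul {σ : Type*} {p q : MvPolynomial σ ℝ} (hp : p.IsHomogeneous 1)
    (hq : q.IsHomogeneous 1) : HasNonposKernel (hessForm [] (p * q)) := by
  have h0 : ∀ {p : MvPolynomial σ ℝ}, p.IsHomogeneous 1 → eval 0 p = 0 := by
    intro p hp
    have := eval_dirDeriv_self hp 0
    rw [dirDeriv_zero, map_zero, Nat.cast_one, one_mul] at this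
    exact this.symm
  refine ⟨{ toFun := fun z => eval 0 (dirDeriv z p) + eval 0 (dirDeriv z q)
            map_add' := fun y z => by
              rw [dirDeriv_add, dirDeriv_add, map_add, map_add]; ring
            map_smul' := fun c z => by
              rw [dirDeriv_smul, dirDeriv_smul, map_mul, map_mul, eval_C, RingHom.id_apply,
                smul_eq_mul]; ring }, fun z hz => ?_⟩
  have hz' : eval 0 (dirDeriv z p) + eval 0 (dirDeriv z q) = 0 := hz
  rw [hessForm_apply, iterDirDeriv_nil, dirDeriv_mul, map_add, dirDeriv_mul, dirDeriv_mul]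
  simp only [map_add, map_mul, h0 hp, h0 hq]
  rw [eq_neg_of_add_eq_zero_left hz']
  nlinarith [sq_nonneg (eval 0 (dirDeriv z q))]

variable {J : Type} [Fintype J] [DecidableEq J] {N : J → Matroid α}

/-- Rank one factors equal `1`, so what remains is either one factor of rank three or two of rank
two. -/
theorem hasNonposKernel_of_familyDegree_eq_two (hN : IsLooplessFamily N)
    (hd : familyDegree N = 2) : HasNonposKernel (hessForm [] (prodVolPoly N)) := by
  have hprod : ∀ s : Finset J, ∑ k ∈ s, (rk (N k) - 1) = 0 →
      ∏ k ∈ s, rename (Prod.mk k) (volPoly (N k)) = 1 := by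
    intro s hs
    refine Finset.prod_eq_one fun k hk => ?_
    have h1 := (Finset.sum_eq_zero_iff.1 hs) k hk
    have h2 := (hN k).2
    rw [volPoly_rank_one (by omega), map_one]
  obtain ⟨j, hj⟩ := exists_rk_of_familyDegree_pos (N := N) (by omega)
  have hsum := Finset.add_sum_erase Finset.univ (fun k => rk (N k) - 1) (Finset.mem_univ j)
  rw [familyDegree] at hd
  rw [hd] at hsum
  rw [prodVolPoly, ← Finset.mul_prod_erase Finset.univ _ (Finset.mem_univ j)]
  by_cases h3 : rk (N j) = 3
  · rw [hprod _ (by omega), mul_one]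
    exact HasNonposKernel.rename (us := []) (hasNonposKernel_of_rk_eq_three (hN j).1 h3)
  · obtain ⟨k, hk, hk0⟩ : ∃ k ∈ Finset.univ.erase j, rk (N k) - 1 ≠ 0 := by
      by_contra! h
      rw [Finset.sum_eq_zero h] at hsum
      omega
    have hsum' := Finset.add_sum_erase _ (fun k => rk (N k) - 1) hk
    rw [← Finset.mul_prod_erase _ _ hk, hprod _ (by omega), mul_one]
    have hhom : ∀ k, rk (N k) - 1 = 1 →
        (rename (Prod.mk k) (volPoly (N k))).IsHomogeneous 1 := fun k h => by
      rw [← h]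
      exact (volPolySpec (N k) (hN k).1 (hN k).2).isHomogeneous.rename_isHomogeneous
    exact hasNonposKernel_mul (hhom j (by omega)) (hhom k (by omega))

theorem hessForm_eq_eval {σ : Type*} (us : List (σ → ℝ)) (p : MvPolynomial σ ℝ) (x y : σ → ℝ) :
    hessForm us p x y = eval 0 (dirDeriv y (iterDirDeriv us (dirDeriv x p))) := by
  rw [hessForm_comm, hessForm_apply, iterDirDeriv_dirDeriv]

theorem hessForm_eq_sum {σ ι : Type*} [Fintype ι] (us : List (σ → ℝ)) {p : MvPolynomial σ ℝ}
    {x : σ → ℝ} {l : ι → ℝ} {e : ι → σ → ℝ}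
    (h : dirDeriv x p = ∑ a, C (l a) * dirDeriv (e a) p) (y : σ → ℝ) :
    hessForm us p x y = ∑ a, l a * hessForm us p (e a) y := by
  simp only [hessForm_eq_eval, h, map_sum, C_mul', map_smul, Derivation.map_smul, smul_eval]

open Classical in
/-- The Hessian entries of products of volume polynomials at distinct proper flats are nonnegative,
and they are positive for flats in different matroids and for comparable flats. -/
theorem hessForm_single_single (hN : IsLooplessFamily N) (us : List (J × Set α → ℝ))
    (hus : us.length + 2 = familyDegree N) (hcone : ∀ u ∈ us, InSubmodularCone N u)
    {j k : J} {F G : Set α} (hF : F ∈ properFlats (N j)) (hG : G ∈ properFlats (N k))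
    (h : j ≠ k ∨ j = k ∧ (G ⊂ F ∨ F ⊂ G)) :
    0 < hessForm us (prodVolPoly N) (Pi.single (j, F) 1) (Pi.single (k, G) 1) := by
  have key : ∀ {j k : J} {F G : Set α}, F ∈ properFlats (N j) → G ∈ properFlats (N k) →
      (j ≠ k ∨ j = k ∧ G ⊂ F) →
      0 < hessForm us (prodVolPoly N) (Pi.single (j, F) 1) (Pi.single (k, G) 1) := by
    intro j k F G hF hG h
    obtain ⟨hG', he⟩ := dirDeriv_single_splitProdPoly hN hF hG h
    rw [hessForm_eq_eval, dirDeriv_single_prodVolPoly hN hF, ← iterDirDeriv_dirDeriv, he,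
      iterDirDeriv_rename, eval_zero_rename]
    have hd := familyDegree_split hN hF
    refine eval_iterDirDeriv_splitProdPoly_pos (hN.split hF) hG' _
      (by rw [List.length_map]; omega) fun v hv => ?_
    obtain ⟨w, hw, rfl⟩ := List.mem_map.1 hv
    exact (hcone w hw).split hN hF
  rcases h with h | ⟨h, h' | h'⟩
  · exact key hF hG (Or.inl h)
  · exact key hF hG (Or.inr ⟨h, h'⟩)
  · rw [hessForm_comm]
    exact key hG hF (Or.inr ⟨h.symm, h'⟩)

open Classical in
theorem hessForm_single_single_nonneg (hN : IsLooplessFamily N) (us : List (J × Set α → ℝ))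
    (hus : us.length + 2 = familyDegree N) (hcone : ∀ u ∈ us, InSubmodularCone N u)
    {j k : J} {F G : Set α} (hF : F ∈ properFlats (N j)) (hG : G ∈ properFlats (N k))
    (h : ¬ (j = k ∧ F = G)) :
    0 ≤ hessForm us (prodVolPoly N) (Pi.single (j, F) 1) (Pi.single (k, G) 1) := by
  by_cases h' : j ≠ k ∨ j = k ∧ (G ⊂ F ∨ F ⊂ G)
  · exact (hessForm_single_single hN us hus hcone hF hG h').le
  · push Not at h'
    obtain ⟨rfl, h'⟩ := h'
    have h2 := h' rfl
    have hFG : F ≠ G := fun e => h ⟨rfl, e⟩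
    rw [hessForm_eq_eval, dirDeriv_single_prodVolPoly hN hF, ← iterDirDeriv_dirDeriv,
      dirDeriv_single_splitProdPoly_eq_zero hN hF hG (fun hs => h2.1 (hs.ssubset_of_ne hFG.symm))
        (fun hs => h2.2 (hs.ssubset_of_ne hFG)), map_zero, map_zero]

/-- Connectedness of the support of the Hessian. Two flats of one factor are joined through another
factor of rank at least two if there is one; otherwise this factor carries the whole degree, and
comparability alone connects its proper flats. -/
theorem eq_of_linked (hN : IsLooplessFamily N) (hd : 3 ≤ familyDegree N)
    (φ : (Σ j, {F // F ∈ properFlats (N j)}) → ℝ)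
    (h1 : ∀ a b, a.1 ≠ b.1 → φ a = φ b)
    (h2 : ∀ j F G (hF : F ∈ properFlats (N j)) (hG : G ∈ properFlats (N j)), F ⊂ G →
      φ ⟨j, F, hF⟩ = φ ⟨j, G, hG⟩) (a b) : φ a = φ b := by
  classical
  obtain ⟨j, F, hF⟩ := a
  obtain ⟨k, G, hG⟩ := b
  by_cases hjk : j = k
  · subst hjk
    by_cases hex : ∃ l, l ≠ j ∧ 2 ≤ rk (N l)
    · obtain ⟨l, hl, hr⟩ := hex
      obtain ⟨i, hi⟩ := (hN l).1.rk_pos_iff.1 (hN l).2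
      have hH := (hN l).1.closure_singleton_mem_properFlats hi hr
      rw [h1 ⟨j, F, hF⟩ ⟨l, _, hH⟩ hl.symm, h1 ⟨l, _, hH⟩ ⟨j, G, hG⟩ hl]
    · push Not at hex
      have hsum := Finset.add_sum_erase Finset.univ (fun k => rk (N k) - 1) (Finset.mem_univ j)
      rw [Finset.sum_eq_zero (fun l hl => by
        have := hex l (Finset.ne_of_mem_erase hl)
        omega)] at hsum
      rw [familyDegree, ← hsum] at hd
      have := (hN j).1.eq_of_comparable (by omega)
        (fun F => if h : F ∈ properFlats (N j) then φ ⟨j, F, h⟩ else 0)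
        (fun F hF G hG hFG => by simpa [hF, hG] using h2 j F G hF hG hFG) hF hG
      simpa [hF, hG] using this
  · exact h1 _ _ hjk

/-- The inductive step: `exists_nonpos_kernel_of_connected` is applied to the Hessian in flat
coordinates, with `v` the positive coefficients of the derivative along `u`. -/
theorem hasNonposKernel_cons (hN : IsLooplessFamily N) (u : J × Set α → ℝ)
    (us : List (J × Set α → ℝ)) (hus : us.length + 3 = familyDegree N)
    (hcone : ∀ v ∈ u :: us, InSubmodularCone N v)
    (ih : ∀ j, ∀ F ∈ properFlats (N j), HasNonposKernel (hessForm us (splitProdPoly N j F))) :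
    HasNonposKernel (hessForm (u :: us) (prodVolPoly N)) := by
  classical
  obtain ⟨i, hi⟩ : ∃ i : J → α, ∀ j, i j ∈ (N j).E :=
    ⟨fun j => ((hN j).1.rk_pos_iff.1 (hN j).2).some,
      fun j => ((hN j).1.rk_pos_iff.1 (hN j).2).some_mem⟩
  set f := prodVolPoly N with hf
  set A := Σ j, {F // F ∈ properFlats (N j)} with hA
  set e : A → J × Set α → ℝ := fun a => Pi.single (a.1, a.2.1) 1 with he
  have hDe : ∀ a, dirDeriv (e a) f = splitProdPoly N a.1 a.2.1 := fun a =>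
    dirDeriv_single_prodVolPoly hN a.2.2
  have hlen : (u :: us).length + 2 = familyDegree N := by rw [List.length_cons]; omega
  set B : Matrix A A ℝ := Matrix.of fun a b => hessForm (u :: us) f (e a) (e b) with hB
  have hmulVec : ∀ x a, (B *ᵥ x) a = hessForm (u :: us) f (e a) (∑ b, x b • e b) := by
    intro x a
    rw [map_sum]
    simp only [Matrix.mulVec, dotProduct, hB, Matrix.of_apply, map_smul, smul_eq_mul]
    exact Finset.sum_congr rfl fun b _ => mul_comm _ _
  have hlin : ∀ (x : A → ℝ) Y, hessForm (u :: us) f (∑ b, x b • e b) Y =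
      ∑ a, x a * hessForm (u :: us) f (e a) Y := by
    intro x Y
    rw [map_sum, LinearMap.sum_apply]
    simp only [map_smul, LinearMap.smul_apply, smul_eq_mul]
  have hquad : ∀ x : A → ℝ, x ⬝ᵥ B *ᵥ x =
      hessForm (u :: us) f (∑ b, x b • e b) (∑ b, x b • e b) := by
    intro x
    rw [hlin]
    simp only [dotProduct, hmulVec]
  obtain ⟨l, hl, hDu⟩ := exists_dirDeriv_prodVolPoly_eq hN (hcone u (by simp))
  set v : A → ℝ := fun a => l a.1 a.2.1 with hv
  have hvpos : ∀ a, 0 < v a := fun a => hl a.1 a.2.1 a.2.2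
  have hDu' : dirDeriv u f = ∑ a, C (v a) * dirDeriv (e a) f := by
    simp only [hDe]
    rw [hDu, Finset.sum_congr rfl fun j _ => (Finset.sum_coe_sort (properFlats (N j))
      fun F => C (l j F) * splitProdPoly N j F).symm, ← Fintype.sum_sigma']
  -- Contracting with `v` is one more derivative along `u`, so this entry is a full derivative of a
  -- split product along cone vectors, hence positive.
  have hBv : ∀ a, (B *ᵥ v) a = hessForm us (splitProdPoly N a.1 a.2.1) u u := by
    intro a
    rw [hmulVec, hessForm_comm, hlin, ← hessForm_eq_sum (u :: us) hDu', hessForm_comm, hessForm_eq_eval, hDe]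
    rfl
  have hBvpos : ∀ a, 0 < (B *ᵥ v) a := by
    intro a
    rw [hBv]
    refine eval_iterDirDeriv_splitProdPoly_pos hN a.2.2 (u :: u :: us) ?_ fun w hw => ?_
    · simp only [List.length_cons]; omega
    · exact hcone w (by simpa using hw)
  have hconn : ∀ φ : A → ℝ, (∀ a b, a ≠ b → 0 < B a b → φ a = φ b) → ∀ a b, φ a = φ b := by
    intro φ hφ
    refine eq_of_linked hN (by omega) φ (fun a b hab => hφ a b (fun h => hab (h ▸ rfl)) ?_)
      (fun j F G hF hG hFG => hφ _ _ (fun h => ?_) ?_)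
    · exact hessForm_single_single hN _ hlen hcone a.2.2 b.2.2 (Or.inl hab)
    · exact hFG.ne (congrArg Subtype.val (eq_of_heq (Sigma.mk.inj_iff.1 h).2))
    · exact hessForm_single_single hN _ hlen hcone hF hG (Or.inr ⟨rfl, Or.inr hFG⟩)
  have hoff : ∀ a b, a ≠ b → 0 ≤ B a b := by
    rintro ⟨j, F, hF⟩ ⟨k, G, hG⟩ hab
    refine hessForm_single_single_nonneg hN _ hlen hcone hF hG ?_
    rintro ⟨rfl, rfl⟩
    exact hab rfl
  -- The `u` at the head of the list is expanded in flat coordinates, writing `x·Bx` as a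
  -- `v`-weighted sum of Hessians of the split products; `mul_le_sq` bounds each by its value
  -- against `u`.
  have hkey : ∀ x : A → ℝ, x ⬝ᵥ B *ᵥ x ≤ ∑ a, v a / (B *ᵥ v) a * (B *ᵥ x) a ^ 2 := by
    intro x
    set X := ∑ b, x b • e b with hX
    have h1 : hessForm (u :: us) f X X =
        ∑ a, v a * hessForm us (splitProdPoly N a.1 a.2.1) X X := by
      rw [hessForm_apply, iterDirDeriv_cons, ← iterDirDeriv_dirDeriv, hDu']
      simp only [hDe, C_mul', map_sum, map_smul, Derivation.map_smul, smul_eval, hessForm_apply]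
    rw [hquad, h1]
    refine Finset.sum_le_sum fun a _ => ?_
    have h2 := (ih a.1 a.2.1 a.2.2).mul_le_sq (hessForm_comm _ _) (v := u)
      (by rw [← hBv]; exact hBvpos a) X
    have h3 : hessForm us (splitProdPoly N a.1 a.2.1) X u = (B *ᵥ x) a := by
      rw [hmulVec, hessForm_eq_eval (u :: us), hDe]
      rfl
    rw [h3, ← hBv] at h2
    rw [div_mul_eq_mul_div, mul_div_assoc]
    exact mul_le_mul_of_nonneg_left ((le_div_iff₀ (hBvpos a)).2 h2) (hvpos a).le
  obtain ⟨s, hs⟩ := exists_nonpos_kernel_of_connected (B := B)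
    (fun a b => hessForm_comm _ _ _ _) hoff hconn hvpos hBvpos hkey
  -- Normalization reduces arbitrary directions to flat coordinates without changing the form, so
  -- the hyperplane pulls back.
  let Λ : (J × Set α → ℝ) →ₗ[ℝ] (A → ℝ) :=
    { toFun := fun w a => normalize (N a.1) (i a.1) (w ∘ Prod.mk a.1) a.2.1
      map_add' := fun w w' => by
        funext a
        simp only [normalize, Function.comp, Pi.add_apply]
        split_ifs <;> ring
      map_smul' := fun c w => by
        funext a
        simp only [normalize, Function.comp, Pi.smul_apply, smul_eq_mul, RingHom.id_apply]
        split_ifs <;> ring }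
  refine ⟨s ∘ₗ Λ, fun w hw => ?_⟩
  have hDw : dirDeriv w f = ∑ a, C (Λ w a) * dirDeriv (e a) f := by
    simp only [hDe]
    rw [dirDeriv_prodVolPoly_of_eq fun j =>
      (volPolySpec (N j) (hN j).1 (hN j).2).dirDeriv_eq (i j) (hi j) (w ∘ Prod.mk j),
      Finset.sum_congr rfl fun j _ => (Finset.sum_coe_sort (properFlats (N j)) fun F =>
        C (normalize (N j) (i j) (w ∘ Prod.mk j) F) * splitProdPoly N j F).symm,
      ← Fintype.sum_sigma']
    rfl
  have hsame : ∀ y, hessForm (u :: us) f w y = hessForm (u :: us) f (∑ b, Λ w b • e b) y := by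
    intro y
    rw [hessForm_eq_sum (u :: us) hDw, hlin]
  rw [hsame, hessForm_comm, hsame, ← hquad]
  exact hs _ hw

/-- The Hessians of products of volume polynomials have at most one positive direction. -/
theorem hasNonposKernel_prodVolPoly (d : ℕ) : ∀ {J : Type} [Fintype J] [DecidableEq J]
    {N : J → Matroid α}, IsLooplessFamily N → familyDegree N = d + 2 →
    ∀ us : List (J × Set α → ℝ), us.length = d → (∀ u ∈ us, InSubmodularCone N u) →
      HasNonposKernel (hessForm us (prodVolPoly N)) := by
  induction d with
  | zero =>
    intro J _ _ N hN hd us hus _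
    rw [List.length_eq_zero_iff.1 hus]
    exact hasNonposKernel_of_familyDegree_eq_two hN hd
  | succ d ih =>
    intro J _ _ N hN hd us hus hcone
    obtain ⟨u, us, rfl⟩ : ∃ u us', us = u :: us' := List.exists_cons_of_length_eq_add_one hus
    rw [List.length_cons, add_left_inj] at hus
    refine hasNonposKernel_cons hN u us (by omega) hcone fun j F hF => ?_
    rw [splitProdPoly_eq]
    have := familyDegree_split hN hF
    refine HasNonposKernel.rename (ih (hN.split hF) (by omega) _
      (by rw [List.length_map, hus]) fun v hv => ?_)
    obtain ⟨w, hw, rfl⟩ := List.mem_map.1 hv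
    exact (hcone w (by simp [hw])).split hN hF

end Lorentzian

/-! ### From formal derivatives to values, Hessians and ample classes -/

section Representation

open MvPolynomial Matrix

section Evaluation

variable {σ : Type*}

theorem iterDirDeriv_append (us vs : List (σ → ℝ)) (p : MvPolynomial σ ℝ) :
    iterDirDeriv (us ++ vs) p = iterDirDeriv us (iterDirDeriv vs p) := by
  induction us with
  | nil => rfl
  | cons u us ih => rw [List.cons_append, iterDirDeriv_cons, iterDirDeriv_cons, ih]

theorem iterDirDeriv_comm (us vs : List (σ → ℝ)) (p : MvPolynomial σ ℝ) :
    iterDirDeriv us (iterDirDeriv vs p) = iterDirDeriv vs (iterDirDeriv us p) := by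
  induction us with
  | nil => rfl
  | cons u us ih => rw [iterDirDeriv_cons, iterDirDeriv_cons, ih, iterDirDeriv_dirDeriv]

/-- Iterated Euler identity. It turns values at any point into full derivatives at the origin, where
the preceding results apply. -/
theorem eval_mul_factorial (x : σ → ℝ) (n : ℕ) : ∀ {p : MvPolynomial σ ℝ}, p.IsHomogeneous n →
    eval x p * n.factorial = eval 0 (iterDirDeriv (List.replicate n x) p) := by
  induction n with
  | zero =>
    intro p hp
    have h := totalDegree_eq_zero_iff_eq_C.1 ((totalDegree_zero_iff_isHomogeneous _).2 hp)
    rw [h]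
    simp
  | succ n ih =>
    intro p hp
    have h1 := ih (IsHomogeneous.dirDeriv hp x)
    rw [eval_dirDeriv_self hp, iterDirDeriv_dirDeriv] at h1
    rw [List.replicate_succ, iterDirDeriv_cons, ← h1, Nat.factorial_succ]
    push_cast
    ring

/-- Derivatives commute, so each direction can be brought next to `p` and exchanged there for its
representative in `K`. -/
theorem exists_list_of_forall {K : Set (σ → ℝ)} {p : MvPolynomial σ ℝ} (us : List (σ → ℝ))
    (h : ∀ v ∈ us, ∃ c ∈ K, dirDeriv v p = dirDeriv c p) :
    ∃ cs : List (σ → ℝ), cs.length = us.length ∧ (∀ c ∈ cs, c ∈ K) ∧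
      iterDirDeriv us p = iterDirDeriv cs p := by
  induction us with
  | nil => exact ⟨[], rfl, by simp, rfl⟩
  | cons u us ih =>
    obtain ⟨cs, h1, h2, h3⟩ := ih fun v hv => h v (List.mem_cons_of_mem _ hv)
    obtain ⟨c, hc, he⟩ := h u List.mem_cons_self
    refine ⟨c :: cs, by simp [h1], ?_, ?_⟩
    · simpa [hc] using h2
    · rw [iterDirDeriv_cons, iterDirDeriv_cons, ← iterDirDeriv_dirDeriv, he,
        iterDirDeriv_dirDeriv, h3]

theorem iterD_eval_comp {ι : Type*} (E : (ι → ℝ) →ₗ[ℝ] (σ → ℝ)) (p : MvPolynomial σ ℝ)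
    (us : List (ι → ℝ)) : iterD us (fun t => eval (E t) p) =
      fun t => eval (E t) (iterDirDeriv (us.map E) p) := by
  induction us with
  | nil => rfl
  | cons u us ih =>
    have h : iterD (u :: us) (fun t => eval (E t) p) =
        fun x => lineDeriv ℝ (iterD us (fun t => eval (E t) p)) x u := rfl
    rw [h, ih]
    funext x
    refine HasLineDerivAt.lineDeriv ?_
    have h1 := hasDerivAt_eval (E x) (E u) (iterDirDeriv (us.map E) p) 0
    rw [zero_smul, add_zero] at h1
    refine h1.congr_of_eventuallyEq (Filter.Eventually.of_forall fun r => ?_)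
    simp only [map_add, map_smul]

end Evaluation

variable {J : Type} [Fintype J] [DecidableEq J] {N : J → Matroid α}

/-- A vector represents an element of the cone of strictly submodular vectors if the product of the
volume polynomials has the same derivative along both. -/
def RepresentsCone (N : J → Matroid α) (w : J × Set α → ℝ) : Prop :=
  ∃ c ∈ {c | InSubmodularCone N c}, dirDeriv w (prodVolPoly N) = dirDeriv c (prodVolPoly N)

theorem eval_iterDirDeriv_pos_of_representsCone (hN : IsLooplessFamily N)
    {us : List (J × Set α → ℝ)} {u : J × Set α → ℝ} (hus : us.length ≤ familyDegree N)
    (hu : RepresentsCone N u) (h : ∀ v ∈ us, RepresentsCone N v) :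
    0 < eval u (iterDirDeriv us (prodVolPoly N)) := by
  have h1 := eval_mul_factorial u _
    (IsHomogeneous.iterDirDeriv (isHomogeneous_prodVolPoly hN) us)
  rw [← iterDirDeriv_append] at h1
  obtain ⟨cs, hlen, hcs, he⟩ := exists_list_of_forall
    (List.replicate (familyDegree N - us.length) u ++ us) fun v hv => by
      rcases List.mem_append.1 hv with hv | hv
      · rw [List.eq_of_mem_replicate hv]; exact hu
      · exact h v hv
  have h2 := eval_iterDirDeriv_pos (familyDegree N) hN rfl cs
    (by rw [hlen, List.length_append, List.length_replicate]; omega) hcs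
  rw [← he, ← h1] at h2
  exact pos_of_mul_pos_left h2 (Nat.cast_nonneg _)

omit [DecidableEq J] in
theorem hessian_eval_comp {ι : Type*} [DecidableEq ι] (hN : IsLooplessFamily N)
    (E : (ι → ℝ) →ₗ[ℝ] (J × Set α → ℝ)) (us : List (ι → ℝ)) (u : ι → ℝ)
    (i j : ι) :
    hessian (iterD us fun t => eval (E t) (prodVolPoly N)) u i j *
      (familyDegree N - us.length - 2).factorial =
      hessForm (List.replicate (familyDegree N - us.length - 2) (E u) ++ us.map E)
        (prodVolPoly N) (E (Pi.single i 1)) (E (Pi.single j 1)) := by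
  have h1 : hessian (iterD us fun t => eval (E t) (prodVolPoly N)) u i j =
      eval (E u) (iterDirDeriv [E (Pi.single i 1), E (Pi.single j 1)]
        (iterDirDeriv (us.map E) (prodVolPoly N))) := by
    rw [iterD_eval_comp, hessian, Matrix.of_apply, iterD_eval_comp]
    simp only [List.map_cons, List.map_nil]
    congr!
  have h2 := IsHomogeneous.iterDirDeriv
    (IsHomogeneous.iterDirDeriv (isHomogeneous_prodVolPoly hN) (us.map E))
    [E (Pi.single i 1), E (Pi.single j 1)]
  rw [List.length_map] at h2
  rw [h1, hessForm_apply, iterDirDeriv_append]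
  have h3 := eval_mul_factorial (E u) _ h2
  simp only [List.length_cons, List.length_nil, zero_add, Nat.reduceAdd] at h3
  rw [h3, iterDirDeriv_comm]
  rfl

/-- Up to a factorial, the Hessian at `u` is the form at the origin with `u` repeated to fill the
degree. The direction `u` itself is positive, and the hyperplane is pulled back along `E`. -/
theorem hasUniquePosEigenvalue_hessian {ι : Type*} [Fintype ι] (hN : IsLooplessFamily N)
    (E : (ι → ℝ) →ₗ[ℝ] (J × Set α → ℝ)) (us : List (ι → ℝ)) (u : ι → ℝ)
    (hus : us.length + 2 ≤ familyDegree N) (hu : RepresentsCone N (E u))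
    (h : ∀ v ∈ us, RepresentsCone N (E v)) :
    HasUniquePosEigenvalue
      (hessian (iterD us fun t => eval (E t) (prodVolPoly N)) u) := by
  classical
  set n := familyDegree N - us.length - 2 with hn
  set H := hessian (iterD us fun t => eval (E t) (prodVolPoly N)) u with hH
  set A := hessForm (List.replicate n (E u) ++ us.map E) (prodVolPoly N) with hA
  have hfac : (0 : ℝ) < n.factorial := by exact_mod_cast n.factorial_pos
  have hent : ∀ i j, H i j * n.factorial = A (E (Pi.single i 1)) (E (Pi.single j 1)) :=
    hessian_eval_comp hN E us u
  have hrep : ∀ v ∈ List.replicate n (E u) ++ us.map E, RepresentsCone N v := by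
    intro v hv
    rcases List.mem_append.1 hv with hv | hv
    · rw [List.eq_of_mem_replicate hv]; exact hu
    · obtain ⟨w, hw, rfl⟩ := List.mem_map.1 hv
      exact h w hw
  have hlen : (List.replicate n (E u) ++ us.map E).length + 2 = familyDegree N := by
    rw [List.length_append, List.length_replicate, List.length_map]; omega
  have hquad : ∀ z : ι → ℝ, z ⬝ᵥ H *ᵥ z * n.factorial = A (E z) (E z) := by
    intro z
    have hz : E z = ∑ i, z i • E (Pi.single i 1) := by
      conv_lhs => rw [pi_eq_sum_univ' z, map_sum]
      refine Finset.sum_congr rfl fun i _ => ?_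
      rw [map_smul]
    have hlin : ∀ Y, A (E z) Y = ∑ i, z i * A (E (Pi.single i 1)) Y := by
      intro Y
      rw [hz, map_sum, LinearMap.sum_apply]
      simp only [map_smul, LinearMap.smul_apply, smul_eq_mul]
    rw [hlin]
    simp only [hA, hessForm_comm _ _ _ (E z)]
    rw [← hA]
    simp only [hlin, dotProduct, mulVec, Finset.sum_mul, Finset.mul_sum]
    refine Finset.sum_congr rfl fun i _ => Finset.sum_congr rfl fun j _ => ?_
    rw [hA, hessForm_comm, ← hA, ← hent]
    ring
  have hherm : H.IsHermitian := by
    ext i j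
    rw [conjTranspose_apply, star_trivial]
    refine mul_right_cancel₀ hfac.ne' ?_
    rw [hent, hent, hA, hessForm_comm]
  refine ⟨hherm, ?_⟩
  obtain ⟨cs, hcl, hcs, he⟩ := exists_list_of_forall _ hrep
  obtain ⟨s, hs⟩ := hasNonposKernel_prodVolPoly cs.length hN (by omega) cs rfl hcs
  have hA' : A = hessForm cs (prodVolPoly N) := by
    refine LinearMap.ext₂ fun x y => ?_
    rw [hA, hessForm_apply, hessForm_apply, he]
  refine existsUnique_pos_eigenvalue hherm (v := u) ?_ (s ∘ₗ E) fun z hz => ?_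
  · refine pos_of_mul_pos_left (b := (n.factorial : ℝ)) ?_ hfac.le
    rw [hquad, hA]
    obtain ⟨ds, hdl, hds, hde⟩ := exists_list_of_forall
      (E u :: E u :: (List.replicate n (E u) ++ us.map E)) (p := prodVolPoly N)
      (K := {c | InSubmodularCone N c}) fun v hv => by
        simp only [List.mem_cons] at hv
        rcases hv with rfl | rfl | hv
        · exact hu
        · exact hu
        · exact hrep v hv
    have h1 := eval_iterDirDeriv_pos (familyDegree N) hN rfl ds
      (by rw [hdl, List.length_cons, List.length_cons]; omega) hds
    rw [← hde] at h1
    exact h1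
  · have h1 : A (E z) (E z) ≤ 0 := hA' ▸ hs (E z) hz
    rw [← hquad] at h1
    exact nonpos_of_mul_nonpos_left h1 hfac

/-- The vector in all coordinates that represents a vector in the coordinates of proper flats. -/
def extendFamily (N : J → Matroid α) :
    ((Σ j, ProperFlat (N j)) → ℝ) →ₗ[ℝ] (J × Set α → ℝ) where
  toFun t x := extendZero (N x.1) (fun F => t ⟨x.1, F⟩) x.2
  map_add' s t := by
    funext x
    exact congrFun ((extendZero (N x.1)).map_add (fun F => s ⟨x.1, F⟩) fun F => t ⟨x.1, F⟩) x.2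
  map_smul' r t := by
    funext x
    exact congrFun ((extendZero (N x.1)).map_smul r fun F => t ⟨x.1, F⟩) x.2

theorem VolPolySpec.dirDeriv_extendZero {M : Matroid α} (hM : IsFinLoopless M) (hr : 0 < rk M)
    {t : ProperFlat M → ℝ} {c : Set α → ℝ} (h0 : c ∅ = 0) (h1 : c M.E = 0)
    (h : proj M t = proj M fun F => c F.1) :
    dirDeriv (extendZero M t) (volPoly M) = dirDeriv c (volPoly M) := by
  have hs := volPolySpec M hM hr
  rw [proj, Submodule.mkQ_apply, Submodule.mkQ_apply, Submodule.Quotient.eq] at h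
  have h2 := hs.dirDeriv_extendZero_of_mem_W hM h
  rw [map_sub, dirDeriv_sub, sub_eq_zero] at h2
  rw [h2]
  refine hs.dirDeriv_congr (hM.rk_pos_iff.1 hr) (fun F hF => ?_) ?_ ?_
  · exact extendZero_apply _ ⟨F, hM.mem_properFlats'.1 hF⟩
  · rw [extendZero_empty hM, h0]
  · rw [extendZero_ground, h1]

theorem representsCone_of_mem_ampleCone (hN : IsLooplessFamily N)
    {w : J × Set α → ℝ} (t : ∀ j, ProperFlat (N j) → ℝ)
    (hw : ∀ j, w ∘ Prod.mk j = extendZero (N j) (t j))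
    (h : ∀ j, proj (N j) (t j) ∈ ampleCone (N j)) : RepresentsCone N w := by
  choose c hc he using h
  refine ⟨fun x => c x.1 x.2, fun j => (hc j).strictlySubmodularOn, ?_⟩
  rw [dirDeriv_prodVolPoly, dirDeriv_prodVolPoly]
  refine Finset.sum_congr rfl fun j _ => ?_
  rw [hw, VolPolySpec.dirDeriv_extendZero (hN j).1 (hN j).2 (hc j).map_empty (hc j).map_ground
    (he j)]
  rfl

omit [DecidableEq J] in
theorem prod_volFun_eq (hN : IsLooplessFamily N) {w : J × Set α → ℝ}
    (t : ∀ j, ProperFlat (N j) → ℝ) (hw : ∀ j, w ∘ Prod.mk j = extendZero (N j) (t j)) :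
    ∏ j, volFun (N j) (t j) = eval w (prodVolPoly N) := by
  rw [prodVolPoly, map_prod]
  refine Finset.prod_congr rfl fun j _ => ?_
  rw [volFun_eq (hN j).1, eval_rename, hw]

open Classical in
/-- The product of the volume polynomials in the coordinates of proper flats. -/
def reducedPoly (N : J → Matroid α) : MvPolynomial (Σ j, ProperFlat (N j)) ℝ :=
  aeval (fun x : J × Set α =>
    if h : (N x.1).IsFlat x.2 ∧ x.2 ≠ (N x.1).loops ∧ x.2 ≠ (N x.1).E then X ⟨x.1, ⟨x.2, h⟩⟩
    else 0) (prodVolPoly N)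

omit [DecidableEq J] in
theorem eval_reducedPoly (t : (Σ j, ProperFlat (N j)) → ℝ) :
    eval t (reducedPoly N) = eval (extendFamily N t) (prodVolPoly N) := by
  classical
  rw [reducedPoly]
  induction prodVolPoly N using MvPolynomial.induction_on with
  | C a => simp
  | add p q hp hq => simp only [map_add, hp, hq]
  | mul_X p x hp =>
    rw [map_mul, map_mul, map_mul, hp, aeval_X, eval_X]
    congr 1
    by_cases h : (N x.1).IsFlat x.2 ∧ x.2 ≠ (N x.1).loops ∧ x.2 ≠ (N x.1).E
    · rw [dif_pos h, eval_X]
      exact (extendZero_apply (fun F => t ⟨x.1, F⟩) ⟨x.2, h⟩).symm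
    · rw [dif_neg h, map_zero]
      exact (extendZero_of_not (fun F => t ⟨x.1, F⟩) h).symm

omit [DecidableEq J] in
theorem isHomogeneous_reducedPoly (hN : IsLooplessFamily N) :
    (reducedPoly N).IsHomogeneous (familyDegree N) := by
  classical
  have := (isHomogeneous_prodVolPoly hN).aeval (n := 1) (fun x : J × Set α =>
    if h : (N x.1).IsFlat x.2 ∧ x.2 ≠ (N x.1).loops ∧ x.2 ≠ (N x.1).E then
      (X ⟨x.1, ⟨x.2, h⟩⟩ : MvPolynomial (Σ j, ProperFlat (N j)) ℝ) else 0) fun x => by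
        split_ifs
        · exact isHomogeneous_X _ _
        · exact isHomogeneous_zero _ _ _
  rwa [one_mul] at this

theorem exists_isStrictlySubmodular {E : Set α} (hE : E.Finite) :
    ∃ c : Set α → ℝ, IsStrictlySubmodular E c := by
  -- The witness is `|S| (|E| - |S|)`; the submodular gap equals `2 (|I| - |I ∩ J|) (|J| - |I ∩
  -- J|)`.
  refine ⟨fun S => E.ncard * S.ncard - (S.ncard : ℝ) ^ 2, by simp, by ring, ?_⟩
  intro I J _ hI _ hJ h1 h2
  have fI := hE.subset hI.subset
  have fJ := hE.subset hJ.subset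
  have e1 := Set.ncard_union_add_ncard_inter I J fI fJ
  have e2 := Set.ncard_lt_ncard (Set.inter_ssubset_left_iff.2 h1) fI
  have e3 := Set.ncard_lt_ncard (Set.inter_ssubset_right_iff.2 h2) fJ
  have e1' : ((I ∪ J).ncard : ℝ) = I.ncard + J.ncard - (I ∩ J).ncard := by
    rw [eq_sub_iff_add_eq]; exact_mod_cast e1
  have e2' : ((I ∩ J).ncard : ℝ) < I.ncard := by exact_mod_cast e2
  have e3' : ((I ∩ J).ncard : ℝ) < J.ncard := by exact_mod_cast e3
  simp only [e1']
  nlinarith [mul_pos (sub_pos.2 e2') (sub_pos.2 e3')]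

/-- The ample cone is nonempty for every finite ground set, and the polynomial is positive at a
representative of an ample class. -/
theorem reducedPoly_ne_zero (hN : IsLooplessFamily N) : reducedPoly N ≠ 0 := by
  intro h0
  choose c hc using fun j => exists_isStrictlySubmodular (hN j).1.finite.ground_finite
  have h1 := eval_reducedPoly (N := N) fun x => c x.1 x.2.1
  rw [h0, map_zero] at h1
  have h2 := eval_iterDirDeriv_pos_of_representsCone hN (us := [])
    (u := extendFamily N fun x => c x.1 x.2.1) (Nat.zero_le _)
    (representsCone_of_mem_ampleCone hN (fun j F => c j F.1) (fun _ => rfl)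
      fun j => ⟨c j, hc j, rfl⟩) (by simp)
  rw [iterDirDeriv_nil, ← h1] at h2
  exact lt_irrefl _ h2

end Representation

/-! ### Degrees along a chain of flats -/

section Chains

variable {M : Matroid α} {ℓ : ℕ}

theorem FlatChain.isLooplessFamily (hM : IsFinLoopless M) (C : FlatChain M ℓ) :
    IsLooplessFamily C.minor := by
  intro i
  have hlt := C.strictMono (Fin.castSucc_lt_succ (i := i))
  have h1 := hM.restrict (C.isFlat i.succ).subset_ground
  have h2 : IsFinLoopless (C.minor i) :=
    h1.contract ((isFlat_restrict_iff (C.isFlat _)).2 ⟨C.isFlat _, hlt.le⟩)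
  exact ⟨h2, h2.rk_pos_iff.2 (Set.nonempty_of_ssubset hlt)⟩

theorem sum_add_eq_last {n : ℕ} (g : Fin (n + 1) → ℕ) (h : Fin n → ℕ)
    (hgh : ∀ i : Fin n, g i.castSucc + h i = g i.succ) : g 0 + ∑ i, h i = g (Fin.last n) := by
  induction n with
  | zero => simp
  | succ n ih =>
    have := ih (fun i => g i.castSucc) (fun i => h i.castSucc) fun i => hgh i.castSucc
    rw [Fin.sum_univ_castSucc, ← add_assoc]
    rw [Fin.castSucc_zero] at this
    rw [this, hgh, Fin.succ_last]

/-- The ranks of the minors telescope to `rk M`, and each of the `ℓ + 1` factors loses one in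
degree. -/
theorem FlatChain.familyDegree_add (hM : IsFinLoopless M) (C : FlatChain M ℓ) :
    familyDegree C.minor + ℓ + 1 = rk M := by
  have := hM.loopless
  have h1 := sum_add_eq_last (fun i => rk (M ↾ C.flat i)) (fun i => rk (C.minor i)) fun i => by
    have hle := (C.strictMono (Fin.castSucc_lt_succ (i := i))).le
    have h := (hM.restrict (C.isFlat i.succ).subset_ground).rk_contract_add_rk_restrict
      (F := C.flat i.castSucc) hle
    rwa [M.restrict_restrict_eq hle] at h
  have h0 : rk (M ↾ C.flat 0) = 0 := by
    rw [C.bot, M.loops_eq_empty]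
    exact (hM.restrict (Set.empty_subset _)).rk_eq_zero_iff.2 rfl
  simp only [h0, zero_add] at h1
  rw [C.top, restrict_ground_eq_self] at h1
  have h2 : ∑ i, (rk (C.minor i) - 1 + 1) = ∑ i, rk (C.minor i) :=
    Finset.sum_congr rfl fun i _ => Nat.sub_add_cancel (C.isLooplessFamily hM i).2
  rw [Finset.sum_add_distrib] at h2
  simp only [Finset.sum_const, Finset.card_univ, Fintype.card_fin, smul_eq_mul, mul_one] at h2
  rw [familyDegree, ← h1, ← h2]
  ring

end Chains

end MatroidVolume

end

theorem theoremt {α : Type*} (M : Matroid α) [M.Finite] [M.Loopless] :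
    (∀ (us : List (MatroidVolume.ProperFlat M → ℝ)) (u : MatroidVolume.ProperFlat M → ℝ),
      us.length + 3 ≤ MatroidVolume.rk M →
      MatroidVolume.proj M u ∈ MatroidVolume.ampleCone M →
      (∀ v ∈ us, MatroidVolume.proj M v ∈ MatroidVolume.ampleCone M) →
      MatroidVolume.HasUniquePosEigenvalue
        (MatroidVolume.hessian (MatroidVolume.iterD us (MatroidVolume.volFun M)) u)) ∧
    (∀ (ℓ : ℕ) (C : MatroidVolume.FlatChain M ℓ),
      ∃ d : ℕ, d + ℓ + 1 = MatroidVolume.rk M ∧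
        (∃ Q : MvPolynomial C.Index ℝ, Q ≠ 0 ∧ Q.IsHomogeneous d ∧
          ∀ t : C.Index → ℝ, C.prodVol t = MvPolynomial.eval t Q) ∧
        ∀ (us : List (C.Index → ℝ)) (u : C.Index → ℝ),
          us.length + 2 ≤ d → C.MemAmple u → (∀ v ∈ us, C.MemAmple v) →
          0 < MatroidVolume.iterD us C.prodVol u ∧
          MatroidVolume.HasUniquePosEigenvalue
            (MatroidVolume.hessian (MatroidVolume.iterD us C.prodVol) u)) := by
  have hM : MatroidVolume.IsFinLoopless M := ⟨inferInstance, inferInstance⟩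
  refine ⟨fun us u hus hu h => ?_, fun ℓ C => ?_⟩
  · have hr : 0 < MatroidVolume.rk M := by omega
    -- The first part is treated as a product with a single factor, of degree `rk M - 1`.
    have hN : MatroidVolume.IsLooplessFamily fun _ : Unit => M := fun _ => ⟨hM, hr⟩
    have hd : MatroidVolume.familyDegree (fun _ : Unit => M) = MatroidVolume.rk M - 1 := by
      simp [MatroidVolume.familyDegree]
    let E : (MatroidVolume.ProperFlat M → ℝ) →ₗ[ℝ] (Unit × Set α → ℝ) :=
      LinearMap.funLeft ℝ ℝ Prod.snd ∘ₗ MatroidVolume.extendZero M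
    have hf : MatroidVolume.volFun M = fun t => MvPolynomial.eval (E t)
        (MatroidVolume.prodVolPoly fun _ : Unit => M) := by
      funext t
      rw [← MatroidVolume.prod_volFun_eq hN (fun _ => t) fun _ => rfl]
      simp
    have hrep : ∀ t, MatroidVolume.proj M t ∈ MatroidVolume.ampleCone M →
        MatroidVolume.RepresentsCone (fun _ : Unit => M) (E t) := fun t ht =>
      MatroidVolume.representsCone_of_mem_ampleCone hN (fun _ => t) (fun _ => rfl) fun _ => ht
    rw [hf]
    exact MatroidVolume.hasUniquePosEigenvalue_hessian hN E us u (by rw [hd]; omega) (hrep u hu)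
      fun v hv => hrep v (h v hv)
  · have hN := C.isLooplessFamily hM
    have hf : C.prodVol = fun t => MvPolynomial.eval (MatroidVolume.extendFamily C.minor t)
        (MatroidVolume.prodVolPoly C.minor) := by
      funext t
      exact MatroidVolume.prod_volFun_eq hN (C.component t) fun _ => rfl
    have hrep : ∀ t, C.MemAmple t →
        MatroidVolume.RepresentsCone C.minor (MatroidVolume.extendFamily C.minor t) := fun t ht =>
      MatroidVolume.representsCone_of_mem_ampleCone hN (C.component t) (fun _ => rfl) ht
    refine ⟨MatroidVolume.familyDegree C.minor, C.familyDegree_add hM,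
      ⟨MatroidVolume.reducedPoly C.minor, MatroidVolume.reducedPoly_ne_zero hN,
        MatroidVolume.isHomogeneous_reducedPoly hN, fun t => ?_⟩, fun us u hus hu h => ⟨?_, ?_⟩⟩
    · rw [hf, MatroidVolume.eval_reducedPoly]
    · rw [hf, MatroidVolume.iterD_eval_comp]
      refine MatroidVolume.eval_iterDirDeriv_pos_of_representsCone hN
        (by rw [List.length_map]; omega) (hrep u hu) fun v hv => ?_
      obtain ⟨w, hw, rfl⟩ := List.mem_map.1 hv
      exact hrep w (h w hw)
    · rw [hf]
      exact MatroidVolume.hasUniquePosEigenvalue_hessian hN _ us u hus (hrep u hu)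
        fun v hv => hrep v (h v hv)
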